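/- Let $n\ge 3$, $\kappa\in\{1,0,-1\}$, and let $M_\kappa$ be the $n$-dimensional space form of curvature $\kappa$ ($\mathbb S^n$, $\mathbb R^n$ or $\mathbb H^n$) with metric $g$. Let $r$ be the distance to a fixed point, $d=\pi$ if $\kappa=1$ and $d=\infty$ otherwise, $(\mathrm s_\kappa,\mathrm c_\kappa)=(\sin,\cos),\ (r,1),\ (\sinh,\cosh)$ for $\kappa=1,0,-1$, $N=\frac{2n}{n-2}$ and $h=(n-1)\frac{\mathrm c_\kappa}{\mathrm s_\kappa}$; a prime is a derivative in $r$. Let $V\in C^0(\mathbb R)$, let $\psi(r)\in C^1(M_\kappa)$, $\rho(r)\in C^0(M_\kappa)$, $\tau(r)\in C^1(M_\kappa)$ be radial functions with $\rho\psi'\equiv0$, and let $\varphi(r)\in C^3(M_\kappa)$ be a positive radial function. Put $(LW)_{ij}=\nabla_iW_j+\nabla_jW_i-\frac2n(\mathrm{div}\,W)g_{ij}$. We say that $\varphi$ is a solution of the conformal equations (with $\sigma\equiv0$) if there is a $1$-form $W$ of class $C^2$ on $M_\kappa$, which for $\kappa\in\{0,-1\}$ is required to be radial, $W=u(r)\,dr$,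 such that on $M_\kappa$ $$-\tfrac{4(n-1)}{n-2}\Delta\varphi+(\mathrm{Scal}_g-|d\psi|^2)\varphi=\big(-\tfrac{n-1}{n}\tau^2+2V(\psi)\big)\varphi^{N-1}+\frac{|LW|^2+\rho^2}{\varphi^{N+1}},\qquad \mathrm{div}(LW)=\tfrac{n-1}{n}\varphi^N d\tau-\rho\,d\psi .$$ Define on $(0,d)$ $$I=\tfrac n{n-1}\big(2V(\psi)\varphi^{2N}+|\psi'|^2\varphi^{N+2}+\rho^2\big),$$ $$S=N^2(\varphi')^2-n^2\kappa\varphi^2+2nN\tfrac{\mathrm c_\kappa}{\mathrm s_\kappa}\varphi\varphi'+\frac1{\mathrm s_\kappa^n}\int_0^r I\varphi^{-2N}(\varphi^N\mathrm s_\kappa^n)'\,dt .$$ Then: (i) $\varphi$ is a solution of the conformal equations if and only if on $(0,d)$ $$-2N\varphi^{N+1}(\varphi''+h\varphi')+\kappa n^2\varphi^{N+2}+\tau^2\varphi^{2N}=\Big(\frac1{\mathrm s_\kappa^n}\int_0^r\tau'\varphi^N\mathrm s_\kappa^n\,dt\Big)^2+I .$$ (ii) If $\varphi$ is a solution of the conformal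 equations, then $S\ge0$ on $(0,d)$. (iii) If $S>0$ on $(0,d)$ and $(\varphi^N\mathrm s_\kappa^n)'\ne0$ almost everywhere on $(0,d)$, then $\varphi$ is a solution of the conformal equations if and only if, for one of the two signs, on all of $(0,d)$ $$\tau=\pm\frac{S+2N\big(\varphi''+(n-1)\frac{\mathrm c_\kappa}{\mathrm s_\kappa}\varphi'\big)\varphi-\kappa n^2\varphi^2+I\varphi^{-N}}{2\sqrt{\varphi^NS}} .$$ (iv) If $\varphi$ is a solution of the conformal equations, then $W=\frac n{n-1}F_v'(r)\,dr$ is of class $C^2$ on $M_\kappa$ and solves them together with $\varphi$, where $v=\frac{n-1}n\varphi^N\tau'$, $f_v(r)=\frac12\int_0^rv$, and $F_v$ is defined as follows. Put $q_v(s)=\frac1{\mathrm c_\kappa^2(s)\mathrm s_\kappa^{n-1}(s)}\int_0^sf_v\mathrm c_\kappa\mathrm s_\kappa^{n-1}\,dt$. If $\kappa\le0$, then $F_v(r)=\mathrm c_\kappa(r)\int_0^rq_v$. If $\kappa=1$, then $F_v=G_v+c_v\cos r$ for $r<\frac\pi2$ and $F_v=G_v$ for $r\ge\frac\pi2$, where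 $G_v(r)=\cos r\int_0^rq_v$ for $r<\frac\pi2$, $G_v(\frac\pi2)=\int_0^{\pi/2}f_v\cos\sin^{n-1}dt$, $G_v(r)=-\cos r\int_r^\pi q_v$ for $r>\frac\pi2$, and $c_v=\int_0^\pi(f_v-nG_v)\sin^{n-1}dt$. -/

import Mathlib

open MeasureTheory Set

noncomputable section

namespace ConformalConstraint

/-! ### Tensor calculus in a coordinate chart

A metric is given by its components `g x i j` in coordinates `x ∈ ℝⁿ`; the same is done for
1-forms `W x i` and for covariant 2-tensors `T x i j`. -/

section Coordinates

variable {n : ℕ}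

/-- The coordinate space `ℝⁿ`. -/
abbrev Coord (n : ℕ) : Type := EuclideanSpace ℝ (Fin n)

/-- The partial derivative `∂ᵢ f`. -/
def pd (i : Fin n) (f : Coord n → ℝ) (x : Coord n) : ℝ :=
  fderiv ℝ f x (EuclideanSpace.single i 1)

/-- The Christoffel symbols `Γᵏᵢⱼ` of the Levi-Civita connection of `g`. -/
def christoffel (g : Coord n → Matrix (Fin n) (Fin n) ℝ) (k i j : Fin n) (x : Coord n) : ℝ :=
  (1 / 2) * ∑ l, (g x)⁻¹ k l *
    (pd i (fun y => g y j l) x + pd j (fun y => g y i l) x - pd l (fun y => g y i j) x)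

/-- The Ricci curvature `Ricⱼₖ`. -/
def ricci (g : Coord n → Matrix (Fin n) (Fin n) ℝ) (x : Coord n) (j k : Fin n) : ℝ :=
  ∑ i, (pd i (christoffel g i j k) x - pd j (christoffel g i i k) x
    + ∑ p, (christoffel g i i p x * christoffel g p j k x
      - christoffel g i j p x * christoffel g p i k x))

/-- The scalar curvature. -/
def scal (g : Coord n → Matrix (Fin n) (Fin n) ℝ) (x : Coord n) : ℝ :=
  ∑ j, ∑ k, (g x)⁻¹ j k * ricci g x j k

/-- The covariant derivative `∇ᵢ Wⱼ` of a 1-form. -/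
def covDeriv (g : Coord n → Matrix (Fin n) (Fin n) ℝ) (W : Coord n → Fin n → ℝ)
    (x : Coord n) (i j : Fin n) : ℝ :=
  pd i (fun y => W y j) x - ∑ k, christoffel g k i j x * W x k

/-- The divergence `gⁱʲ ∇ᵢ Wⱼ` of a 1-form. -/
def div₁ (g : Coord n → Matrix (Fin n) (Fin n) ℝ) (W : Coord n → Fin n → ℝ)
    (x : Coord n) : ℝ :=
  ∑ i, ∑ j, (g x)⁻¹ i j * covDeriv g W x i j

/-- The covariant derivative `∇ₖ Tᵢⱼ` of a covariant 2-tensor. -/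
def covDeriv₂ (g : Coord n → Matrix (Fin n) (Fin n) ℝ) (T : Coord n → Fin n → Fin n → ℝ)
    (x : Coord n) (k i j : Fin n) : ℝ :=
  pd k (fun y => T y i j) x
    - ∑ l, (christoffel g l k i x * T x l j + christoffel g l k j x * T x i l)

/-- The divergence `gᵏⁱ ∇ₖ Tᵢⱼ` of a symmetric covariant 2-tensor. -/
def div₂ (g : Coord n → Matrix (Fin n) (Fin n) ℝ) (T : Coord n → Fin n → Fin n → ℝ)
    (x : Coord n) (j : Fin n) : ℝ :=
  ∑ k, ∑ i, (g x)⁻¹ k i * covDeriv₂ g T x k i j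

/-- The conformal Killing operator
`(LW)ᵢⱼ = ∇ᵢ Wⱼ + ∇ⱼ Wᵢ - (2 / n) (div W) gᵢⱼ`. -/
def confKilling (g : Coord n → Matrix (Fin n) (Fin n) ℝ) (W : Coord n → Fin n → ℝ)
    (x : Coord n) (i j : Fin n) : ℝ :=
  covDeriv g W x i j + covDeriv g W x j i - 2 / (n : ℝ) * div₁ g W x * g x i j

/-- The Laplacian `Δ f = div (df)`. -/
def laplacian (g : Coord n → Matrix (Fin n) (Fin n) ℝ) (f : Coord n → ℝ) (x : Coord n) : ℝ :=
  div₁ g (fun y i => pd i f y) x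

/-- The squared norm `|w|²` of a covector at `x`. -/
def normSq₁ (g : Coord n → Matrix (Fin n) (Fin n) ℝ) (x : Coord n) (w : Fin n → ℝ) : ℝ :=
  ∑ i, ∑ j, (g x)⁻¹ i j * w i * w j

/-- The squared norm `|T|²` of a covariant 2-tensor at `x`. -/
def normSq₂ (g : Coord n → Matrix (Fin n) (Fin n) ℝ) (x : Coord n)
    (T : Fin n → Fin n → ℝ) : ℝ :=
  ∑ i, ∑ j, ∑ k, ∑ l, (g x)⁻¹ i k * (g x)⁻¹ j l * T i j * T k l

end Coordinates

/-- The exponent `N = 2n / (n - 2)`. -/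
def critExp (n : ℕ) : ℝ := 2 * (n : ℝ) / ((n : ℝ) - 2)

/-! ### The space forms -/

/-- The generalized sine `s_κ`. -/
def sk : SignType → ℝ → ℝ
  | .pos, r => Real.sin r
  | .zero, r => r
  | .neg, r => Real.sinh r

/-- The generalized cosine `c_κ`. -/
def ck : SignType → ℝ → ℝ
  | .pos, r => Real.cos r
  | .zero, _ => 1
  | .neg, r => Real.cosh r

/-- The range of the distance to the pole, away from the pole and (on the sphere) from its
antipode: `(0, π)` if `κ = 1`, and `(0, ∞)` otherwise. -/
def radii (κ : SignType) : Set ℝ := {r | 0 < r ∧ (κ = 1 → r < Real.pi)}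

/-- The linear space `ℝ × ℝⁿ` that contains the space forms. -/
abbrev Ambient (n : ℕ) : Type := ℝ × EuclideanSpace ℝ (Fin n)

/-- The symmetric bilinear form `κ dt² + |dx|²` on `ℝ × ℝⁿ`; its restriction to the tangent
spaces of the space form is the Riemannian metric. -/
def ambientForm (n : ℕ) (κ : SignType) (v w : Ambient n) : ℝ :=
  (κ : ℝ) * v.1 * w.1 + inner ℝ v.2 w.2

/-- The space form `M_κ` of dimension `n` and curvature `κ`, as a hypersurface of `ℝ × ℝⁿ`:
the unit sphere (`κ = 1`), the hyperplane `t = 1` (`κ = 0`), or the upper sheet of the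
hyperboloid `t² - |x|² = 1` (`κ = -1`). -/
def spaceForm (n : ℕ) (κ : SignType) : Set (Ambient n) :=
  {p | p.1 ^ 2 + (κ : ℝ) * ‖p.2‖ ^ 2 = 1 ∧ (κ = 1 ∨ 0 < p.1)}

/-- The geodesic distance in `M_κ` from the pole `(1, 0)`. -/
def radius {n : ℕ} : SignType → Ambient n → ℝ
  | .pos, p => Real.arccos p.1
  | .zero, p => ‖p.2‖
  | .neg, p => Real.arsinh ‖p.2‖

/-- The domain of the stereographic charts: `ℝⁿ` if `κ = 1` or `κ = 0`, and the open ball of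
radius `2` if `κ = -1`. -/
def chartDomain (n : ℕ) (κ : SignType) : Set (Coord n) := {x | 0 < 1 + (κ : ℝ) / 4 * ‖x‖ ^ 2}

/-- The labels of the charts: one chart, centred at the pole (label `1`), and on the sphere
a second one, centred at the antipode of the pole (label `-1`). -/
def chartLabels (κ : SignType) : Set ℝ := {ε | ε = 1 ∨ (κ = 1 ∧ ε = -1)}

/-- The inverses `chartDomain n κ → M_κ` of the stereographic charts. -/
def param (n : ℕ) (κ : SignType) (ε : ℝ) (x : Coord n) : Ambient n :=
  (ε * (1 - (κ : ℝ) / 4 * ‖x‖ ^ 2) / (1 + (κ : ℝ) / 4 * ‖x‖ ^ 2),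
    (1 / (1 + (κ : ℝ) / 4 * ‖x‖ ^ 2)) • x)

/-- The coordinate vector field `∂ᵢ` of a chart, as a vector of the ambient space. -/
def coordVec (n : ℕ) (κ : SignType) (ε : ℝ) (x : Coord n) (i : Fin n) : Ambient n :=
  fderiv ℝ (param n κ ε) x (EuclideanSpace.single i 1)

/-- The components of the metric of `M_κ` in a chart. -/
def metric (n : ℕ) (κ : SignType) (ε : ℝ) (x : Coord n) : Matrix (Fin n) (Fin n) ℝ :=
  Matrix.of fun i j => ambientForm n κ (coordVec n κ ε x i) (coordVec n κ ε x j)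

/-- The components in a chart of a 1-form on `M_κ`. A 1-form is given by linear forms on the
ambient space, of which only the restriction to the tangent spaces of `M_κ` is used. -/
def formComp {n : ℕ} (κ : SignType) (ε : ℝ) (W : Ambient n → (Ambient n →L[ℝ] ℝ))
    (x : Coord n) (i : Fin n) : ℝ :=
  W (param n κ ε x) (coordVec n κ ε x i)

/-- The components in a chart of a covariant 2-tensor on `M_κ`, which is given by bilinear forms
on the ambient space, of which only the restriction to the tangent spaces of `M_κ` is used. -/
def tensorComp {n : ℕ} (κ : SignType) (ε : ℝ)
    (σ : Ambient n → (Ambient n →L[ℝ] Ambient n →L[ℝ] ℝ)) (x : Coord n) (i j : Fin n) : ℝ :=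
  σ (param n κ ε x) (coordVec n κ ε x i) (coordVec n κ ε x j)

/-- `f` is of class `C^k` on `M_κ` (only the values of `f` on `M_κ` matter). -/
def IsCk {n : ℕ} (κ : SignType) (k : ℕ) (f : Ambient n → ℝ) : Prop :=
  ∀ ε ∈ chartLabels κ, ContDiffOn ℝ k (fun x => f (param n κ ε x)) (chartDomain n κ)

/-- The 1-form `W` is of class `C^k` on `M_κ`. -/
def IsCkForm {n : ℕ} (κ : SignType) (k : ℕ) (W : Ambient n → (Ambient n →L[ℝ] ℝ)) : Prop :=
  ∀ ε ∈ chartLabels κ, ∀ i, ContDiffOn ℝ k (fun x => formComp κ ε W x i) (chartDomain n κ)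

/-- The radial function `f(r)` on `M_κ` with profile `f`. -/
def radial (n : ℕ) (κ : SignType) (f : ℝ → ℝ) : Ambient n → ℝ := fun p => f (radius κ p)

/-- `W = u(r) dr` away from the pole and (on the sphere) from its antipode, which are the
centres of the charts. -/
def IsRadialForm {n : ℕ} (κ : SignType) (u : ℝ → ℝ) (W : Ambient n → (Ambient n →L[ℝ] ℝ)) :
    Prop :=
  ∀ ε ∈ chartLabels κ, ∀ x ∈ chartDomain n κ, x ≠ 0 → ∀ i,
    formComp κ ε W x i =
      u (radius κ (param n κ ε x)) * pd i (fun y => radius κ (param n κ ε y)) x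

/-! ### The conformal equations -/

/-- `(φ, W)` satisfies the Einstein-scalar field conformal constraint equations on `M_κ` for the
data `(V, ψ, ρ, τ, σ)`: the Lichnerowicz equation and the vector equations hold at every point
of every chart. -/
def SolvesWith {n : ℕ} (κ : SignType) (V : ℝ → ℝ) (ψ ρ τ : Ambient n → ℝ)
    (σ : Ambient n → (Ambient n →L[ℝ] Ambient n →L[ℝ] ℝ)) (φ : Ambient n → ℝ)
    (W : Ambient n → (Ambient n →L[ℝ] ℝ)) : Prop :=
  ∀ ε ∈ chartLabels κ, ∀ x ∈ chartDomain n κ,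
    let g := metric n κ ε
    let P := param n κ ε
    let N := critExp n
    let LW := confKilling g (formComp κ ε W)
    (-(4 * ((n : ℝ) - 1) / ((n : ℝ) - 2)) * laplacian g (fun y => φ (P y)) x
        + (scal g x - normSq₁ g x (fun i => pd i (fun y => ψ (P y)) x)) * φ (P x)
      = (-(((n : ℝ) - 1) / n) * τ (P x) ^ 2 + 2 * V (ψ (P x))) * φ (P x) ^ (N - 1)
        + (normSq₂ g x (fun i j => tensorComp κ ε σ x i j + LW x i j) + ρ (P x) ^ 2)
          / φ (P x) ^ (N + 1)) ∧
    ∀ j, div₂ g LW x j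
      = ((n : ℝ) - 1) / n * φ (P x) ^ N * pd j (fun y => τ (P y)) x
        - ρ (P x) * pd j (fun y => ψ (P y)) x

/-- The radial function `φ(r)` is a solution of the conformal equations on `M_κ` with `σ ≡ 0` and
with radial data: there is a 1-form `W` of class `C²` such that `(φ, W)` satisfies them. On the
sphere `W` may be any such 1-form; on the Euclidean and on the hyperbolic space, where no
condition at infinity is imposed, `W` is radial like the rest of the data, `W = u(r) dr`. -/
def IsSolution (n : ℕ) (κ : SignType) (V ψ ρ τ φ : ℝ → ℝ) : Prop :=
  ∃ W : Ambient n → (Ambient n →L[ℝ] ℝ),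
    IsCkForm κ 2 W ∧ (κ = 1 ∨ ∃ u : ℝ → ℝ, IsRadialForm κ u W) ∧
    SolvesWith κ V (radial n κ ψ) (radial n κ ρ) (radial n κ τ) (fun _ => 0) (radial n κ φ) W

/-! ### The radial quantities -/

/-- The mean curvature `h = (n - 1) c_κ / s_κ` of the geodesic sphere of radius `r`. -/
def meanCurv (n : ℕ) (κ : SignType) (r : ℝ) : ℝ := ((n : ℝ) - 1) * (ck κ r / sk κ r)

/-- The function `φ^N s_κ^n`. -/
def weight (n : ℕ) (κ : SignType) (φ : ℝ → ℝ) (r : ℝ) : ℝ := φ r ^ critExp n * sk κ r ^ n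

/-- The function `I_{V,ψ,ρ,φ}`. -/
def Ifun (n : ℕ) (V ψ ρ φ : ℝ → ℝ) (r : ℝ) : ℝ :=
  (n : ℝ) / ((n : ℝ) - 1) * (2 * V (ψ r) * φ r ^ (2 * critExp n)
    + |deriv ψ r| ^ 2 * φ r ^ (critExp n + 2) + ρ r ^ 2)

/-- The function `S_{V,ψ,ρ,φ}`. -/
def Sfun (n : ℕ) (κ : SignType) (V ψ ρ φ : ℝ → ℝ) (r : ℝ) : ℝ :=
  critExp n ^ 2 * deriv φ r ^ 2 - (n : ℝ) ^ 2 * (κ : ℝ) * φ r ^ 2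
    + 2 * n * critExp n * (ck κ r / sk κ r) * φ r * deriv φ r
    + 1 / sk κ r ^ n *
      ∫ t in (0 : ℝ)..r, Ifun n V ψ ρ φ t * φ t ^ (-(2 * critExp n)) * deriv (weight n κ φ) t

/-- The radial Lichnerowicz-type equation at `r`. -/
def RadialLichnerowicz (n : ℕ) (κ : SignType) (V ψ ρ τ φ : ℝ → ℝ) (r : ℝ) : Prop :=
  -(2 * critExp n) * φ r ^ (critExp n + 1) * (deriv (deriv φ) r + meanCurv n κ r * deriv φ r)
      + (κ : ℝ) * (n : ℝ) ^ 2 * φ r ^ (critExp n + 2) + τ r ^ 2 * φ r ^ (2 * critExp n)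
    = (1 / sk κ r ^ n *
        ∫ t in (0 : ℝ)..r, deriv τ t * φ t ^ critExp n * sk κ t ^ n) ^ 2
      + Ifun n V ψ ρ φ r

/-- The explicit mean curvature (with the sign `+`). -/
def explicitTau (n : ℕ) (κ : SignType) (V ψ ρ φ : ℝ → ℝ) (r : ℝ) : ℝ :=
  (Sfun n κ V ψ ρ φ r
      + 2 * critExp n * (deriv (deriv φ) r + ((n : ℝ) - 1) * (ck κ r / sk κ r) * deriv φ r) * φ r
      - (κ : ℝ) * (n : ℝ) ^ 2 * φ r ^ 2 + Ifun n V ψ ρ φ r * φ r ^ (-critExp n))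
    / (2 * Real.sqrt (φ r ^ critExp n * Sfun n κ V ψ ρ φ r))

/-! ### The explicit 1-form

With `θ = s_κ^(n-1)` and `u₀ = c_κ`, the function `F_v` is a solution of
`F'' + h F' + n κ F = f_v` that is regular at the pole and, on the sphere, at its antipode. -/

/-- The function `f_v(r) = (1 / 2) ∫₀ʳ v`. -/
def fv (v : ℝ → ℝ) (r : ℝ) : ℝ := (1 / 2) * ∫ s in (0 : ℝ)..r, v s

/-- The function `(1 / (u₀² θ)) ∫₀ˢ f_v u₀ θ`. -/
def quotv (n : ℕ) (κ : SignType) (v : ℝ → ℝ) (s : ℝ) : ℝ :=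
  1 / (ck κ s ^ 2 * sk κ s ^ (n - 1)) * ∫ t in (0 : ℝ)..s, fv v t * ck κ t * sk κ t ^ (n - 1)

/-- The function `G_v` on the sphere, where `u₀ = cos` vanishes at `π / 2`, with
`u₀'(π / 2) θ(π / 2) = -1`. -/
def Gv (n : ℕ) (v : ℝ → ℝ) (r : ℝ) : ℝ :=
  if r < Real.pi / 2 then Real.cos r * ∫ s in (0 : ℝ)..r, quotv n 1 v s
  else if r = Real.pi / 2 then
    ∫ t in (0 : ℝ)..(Real.pi / 2), fv v t * Real.cos t * Real.sin t ^ (n - 1)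
  else -(Real.cos r * ∫ s in r..Real.pi, quotv n 1 v s)

/-- The constant `c_v`, by which `F_v` is differentiable at `π / 2`. -/
def cv (n : ℕ) (v : ℝ → ℝ) : ℝ :=
  ∫ s in (0 : ℝ)..Real.pi, (Real.sin s ^ (n - 1) * fv v s - n * Real.sin s ^ (n - 1) * Gv n v s)

/-- The function `F_v`. -/
def Fv (n : ℕ) : SignType → (ℝ → ℝ) → ℝ → ℝ
  | .pos, v, r => if r < Real.pi / 2 then Gv n v r + cv n v * Real.cos r else Gv n v r
  | .zero, v, r => ck 0 r * ∫ s in (0 : ℝ)..r, quotv n 0 v s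
  | .neg, v, r => ck (-1) r * ∫ s in (0 : ℝ)..r, quotv n (-1) v s

end ConformalConstraint

end

/-!
The space form `M_κ` is covered by stereographic charts, in which the metric is `λ² δ` with
`λ = (1 + κ |x|² / 4)⁻¹`. In such a chart every tensor of the conformal equations has an explicit
form (`confKilling_eq`, `div₂_eq`, `laplacian_eq`, `scal_eq`), and for radial data and a radial
1-form `W = s_κ B dr` with `B' = k / 2` the equations become

* `lichDefect = (k s_κ)²`, where `lichDefect` collects the terms without `W`;
* `k' + (n + 1) (c_κ / s_κ) k = m / s_κ`, where `m = φ^N τ'`.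

The second one integrates to `k = s_κ^(-n-1) ∫₀ʳ m s_κⁿ`, by regularity at the pole, and then the
first one is the radial Lichnerowicz equation. Because `ρ ψ' = 0`, the scalar field drops out of the
vector equation.

If the radial equation holds, then the 1-form `s_κ B dr` built from this `k` is a solution
(`isSolution_of_radial`). On the sphere the radial equation bounds `s_κ⁻ⁿ ∫₀ʳ m s_κⁿ`, so that
`∫₀^π m sinⁿ = 0` and `k` is regular at the antipode too. That the form is of class `C²` at the
centres of the charts comes down to `k → 0` there (`isCkForm_radialForm`).

Conversely, a radial solution is given by the formula above (`radialLichnerowicz_of_isRadialForm`).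
On the sphere the solution `W` is not assumed to be radial. The Lichnerowicz equation bounds `|LW|`.
Contracting the vector equation with the conformal Killing field `x ∂ₓ` and integrating gives
`∫₀^π m sinⁿ = 0` (`moment_pi`), so that there is a radial solution `W₀` of the vector equation, and
contracting it with `W - W₀` gives `∫ |L(W - W₀)|² = 0` (`confKilling_eq_zero_of_div₂`). Hence `|LW|`
is the same as for `W₀`. Both integrations take place in one chart, on `ℝⁿ`, with the divergence
theorem for vector fields of size `O(|x|⁻ⁿ)`.

For the statements on `S` put `w = φ^N s_κⁿ` and `P = τ w - ∫₀ʳ τ' w`, so that `P' = τ w'`. By the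
radial equation `(P² / w)' = (s_κⁿ S)'`, and both functions vanish at the pole, whence
`P² = w s_κⁿ S` (`sq_tauMoment`). This shows `S ≥ 0`. If `S > 0`, then `P` has a constant sign,
`P = ± (φ^N S)^(1/2) s_κⁿ`, and inserting this in the radial equation determines `τ`. Conversely, if
`τ` is given by this formula, then `(φ^N S)^(1/2) s_κⁿ` has the derivative `± τ w'`, like `± P`, and
therefore equals `± P`.

Finally, `H = ∫₀ʳ s_κ B` satisfies `H'' + h H' + n κ H = (1 / 2) ∫₀ʳ m` (`potential_ode`), and `q_v` is
a multiple of the derivative of `H / c_κ`. Thus `F_v` is a multiple of `H`, up to a multiple of `c_κ`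
on the sphere, and `F_v' dr` is a solution because `d c_κ` is a conformal Killing form.
-/

noncomputable section

namespace ConformalConstraint

open scoped Topology ContDiff
open Filter

/-! ### Partial derivatives -/

section PartialDerivatives

variable {n : ℕ}

lemma pd_eq_of_hasFDerivAt {f : Coord n → ℝ} {f' : Coord n →L[ℝ] ℝ} {x : Coord n}
    (h : HasFDerivAt f f' x) (i : Fin n) : pd i f x = f' (EuclideanSpace.single i 1) := by
  rw [pd, h.fderiv]

lemma pd_congr {f g : Coord n → ℝ} {x : Coord n} (h : f =ᶠ[𝓝 x] g) (i : Fin n) :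
    pd i f x = pd i g x := by
  rw [pd, pd, h.fderiv_eq]

lemma pd_congr_of_isOpen {f g : Coord n → ℝ} {s : Set (Coord n)} (hs : IsOpen s)
    (h : EqOn f g s) {x : Coord n} (hx : x ∈ s) (i : Fin n) : pd i f x = pd i g x :=
  pd_congr (h.eventuallyEq_of_mem (hs.mem_nhds hx)) i

lemma pd_const (i : Fin n) (c : ℝ) (x : Coord n) : pd i (fun _ => c) x = 0 := by
  simp [pd]

lemma pd_add {f g : Coord n → ℝ} {x : Coord n} (hf : DifferentiableAt ℝ f x)
    (hg : DifferentiableAt ℝ g x) (i : Fin n) :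
    pd i (fun y => f y + g y) x = pd i f x + pd i g x := by
  rw [pd_eq_of_hasFDerivAt (hf.hasFDerivAt.fun_add hg.hasFDerivAt)]; rfl

lemma pd_sub {f g : Coord n → ℝ} {x : Coord n} (hf : DifferentiableAt ℝ f x)
    (hg : DifferentiableAt ℝ g x) (i : Fin n) :
    pd i (fun y => f y - g y) x = pd i f x - pd i g x := by
  rw [pd_eq_of_hasFDerivAt (hf.hasFDerivAt.fun_sub hg.hasFDerivAt)]; rfl

lemma pd_mul {f g : Coord n → ℝ} {x : Coord n} (hf : DifferentiableAt ℝ f x)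
    (hg : DifferentiableAt ℝ g x) (i : Fin n) :
    pd i (fun y => f y * g y) x = pd i f x * g x + f x * pd i g x := by
  rw [pd_eq_of_hasFDerivAt (hf.hasFDerivAt.fun_mul hg.hasFDerivAt)]
  simp [pd]; ring

lemma pd_const_mul {f : Coord n → ℝ} {x : Coord n} (hf : DifferentiableAt ℝ f x) (c : ℝ)
    (i : Fin n) : pd i (fun y => c * f y) x = c * pd i f x := by
  rw [pd_mul (differentiableAt_const c) hf, pd_const]; ring

lemma pd_mul_const {f : Coord n → ℝ} {x : Coord n} (hf : DifferentiableAt ℝ f x) (c : ℝ)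
    (i : Fin n) : pd i (fun y => f y * c) x = pd i f x * c := by
  rw [pd_mul hf (differentiableAt_const c), pd_const]; ring

lemma pd_sum {ι : Type*} {s : Finset ι} {f : ι → Coord n → ℝ} {x : Coord n}
    (hf : ∀ j ∈ s, DifferentiableAt ℝ (f j) x) (i : Fin n) :
    pd i (fun y => ∑ j ∈ s, f j y) x = ∑ j ∈ s, pd i (f j) x := by
  rw [pd_eq_of_hasFDerivAt (HasFDerivAt.fun_sum fun j hj => (hf j hj).hasFDerivAt)]
  simp [pd]

lemma pd_comp {f : ℝ → ℝ} {f' : ℝ} {g : Coord n → ℝ} {x : Coord n} (hf : HasDerivAt f f' (g x))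
    (hg : DifferentiableAt ℝ g x) (i : Fin n) : pd i (fun y => f (g y)) x = f' * pd i g x := by
  have h := hf.comp_hasFDerivAt x hg.hasFDerivAt
  rw [pd_eq_of_hasFDerivAt (f := fun y => f (g y)) h]
  simp [pd]

lemma hasFDerivAt_coord (j : Fin n) (x : Coord n) :
    HasFDerivAt (fun y : Coord n => y j) (EuclideanSpace.proj j : Coord n →L[ℝ] ℝ) x :=
  (EuclideanSpace.proj j : Coord n →L[ℝ] ℝ).hasFDerivAt

lemma differentiableAt_coord (j : Fin n) (x : Coord n) :
    DifferentiableAt ℝ (fun y : Coord n => y j) x := (hasFDerivAt_coord j x).differentiableAt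

lemma contDiff_coord (j : Fin n) {k : ℕ∞ω} : ContDiff ℝ k (fun y : Coord n => y j) :=
  (EuclideanSpace.proj j : Coord n →L[ℝ] ℝ).contDiff

lemma pd_coord (i j : Fin n) (x : Coord n) :
    pd i (fun y : Coord n => y j) x = if i = j then 1 else 0 := by
  rw [pd_eq_of_hasFDerivAt (hasFDerivAt_coord j x)]
  simp [eq_comm]

lemma contDiffOn_pd {f : Coord n → ℝ} {s : Set (Coord n)} (hs : IsOpen s) {k : ℕ}
    (hf : ContDiffOn ℝ (k + 1 : ℕ) f s) (i : Fin n) : ContDiffOn ℝ k (pd i f) s := by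
  have h : ContDiffOn ℝ k (fderiv ℝ f) s := hf.fderiv_of_isOpen hs (by norm_cast)
  exact h.clm_apply contDiffOn_const

lemma fderiv_eq_sum_pd {f : Coord n → ℝ} (x : Coord n) :
    fderiv ℝ f x = ∑ i, pd i f x • (EuclideanSpace.proj i : Coord n →L[ℝ] ℝ) := by
  ext v
  have hv : v = ∑ i, v i • EuclideanSpace.single i (1 : ℝ) := by
    ext j; simp [Finset.sum_apply, Pi.single_apply]
  conv_lhs => rw [hv, map_sum]
  simp [pd, mul_comm]

end PartialDerivatives

/-! ### The conformal factor of the stereographic charts -/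

section ConformalFactor

variable {n : ℕ} {κ : SignType} {ε : ℝ} {x : Coord n}

/-- The conformal factor `λ = (1 + κ |x|² / 4)⁻¹`: the metric is `λ² δᵢⱼ` in either chart. -/
def lam (κ : SignType) (x : Coord n) : ℝ := (1 + (κ : ℝ) / 4 * ‖x‖ ^ 2)⁻¹

/-- The partial derivatives `∂ᵢ log λ`. -/
def dlog (κ : SignType) (i : Fin n) (x : Coord n) : ℝ := -((κ : ℝ) / 2) * lam κ x * x i

lemma cast_cube (κ : SignType) : (κ : ℝ) ^ 3 = κ := by
  rcases κ with _ | _ | _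
  · simp
  · rw [show SignType.neg = -1 from rfl]; norm_num
  · rw [show SignType.pos = 1 from rfl]; norm_num

lemma isOpen_chartDomain (n : ℕ) (κ : SignType) : IsOpen (chartDomain n κ) :=
  isOpen_lt continuous_const (by fun_prop)

lemma zero_mem_chartDomain (n : ℕ) (κ : SignType) : (0 : Coord n) ∈ chartDomain n κ := by
  simp [chartDomain]

lemma lam_pos (hx : x ∈ chartDomain n κ) : 0 < lam κ x := inv_pos.2 hx

lemma lam_ne (hx : x ∈ chartDomain n κ) : lam κ x ≠ 0 := (lam_pos hx).ne'

lemma lam_mul (hx : x ∈ chartDomain n κ) : lam κ x * (1 + (κ : ℝ) / 4 * ‖x‖ ^ 2) = 1 :=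
  inv_mul_cancel₀ (ne_of_gt hx)

lemma label_sq (hε : ε ∈ chartLabels κ) : ε ^ 2 = 1 := by
  rcases hε with rfl | ⟨-, rfl⟩ <;> norm_num

lemma norm_sq_eq (x : Coord n) : ‖x‖ ^ 2 = ∑ i, x i ^ 2 := by
  rw [EuclideanSpace.norm_sq_eq]; simp

lemma contDiffOn_lam {k : ℕ∞ω} : ContDiffOn ℝ k (lam (n := n) κ) (chartDomain n κ) := by
  have h : ContDiff ℝ k fun x : Coord n => 1 + (κ : ℝ) / 4 * ‖x‖ ^ 2 :=
    contDiff_const.add (contDiff_const.mul (contDiff_norm_sq ℝ))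
  exact h.contDiffOn.inv fun x hx => ne_of_gt hx

lemma hasFDerivAt_lam (hx : x ∈ chartDomain n κ) :
    HasFDerivAt (lam κ) (-((κ : ℝ) / 2 * lam κ x ^ 2) • innerSL ℝ x) x := by
  have h1 : HasFDerivAt (fun x : Coord n => 1 + (κ : ℝ) / 4 * ‖x‖ ^ 2)
      (((κ : ℝ) / 4) • (2 • innerSL ℝ x)) x :=
    ((HasStrictFDerivAt.hasFDerivAt (hasStrictFDerivAt_norm_sq x)).const_mul _).const_add _
  have h2 := (hasDerivAt_inv (ne_of_gt hx)).comp_hasFDerivAt x h1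
  refine h2.congr_fderiv ?_
  ext v
  simp [lam]
  ring

lemma differentiableAt_lam (hx : x ∈ chartDomain n κ) : DifferentiableAt ℝ (lam κ) x :=
  (hasFDerivAt_lam hx).differentiableAt

lemma pd_lam (hx : x ∈ chartDomain n κ) (i : Fin n) :
    pd i (lam κ) x = dlog κ i x * lam κ x := by
  rw [pd_eq_of_hasFDerivAt (hasFDerivAt_lam hx)]
  simp [dlog, EuclideanSpace.inner_single_right]
  ring

lemma contDiffOn_dlog {k : ℕ∞ω} (i : Fin n) :
    ContDiffOn ℝ k (dlog κ i) (chartDomain n κ) :=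
  (contDiffOn_const.mul contDiffOn_lam).mul (contDiff_coord i).contDiffOn

lemma ContDiffOn.differentiableAt' {f : Coord n → ℝ} {s : Set (Coord n)} (hs : IsOpen s)
    {k : ℕ} (hk : k ≠ 0) (hf : ContDiffOn ℝ k f s) (hx : x ∈ s) : DifferentiableAt ℝ f x :=
  (hf.contDiffAt (hs.mem_nhds hx)).differentiableAt (by exact_mod_cast hk)

lemma differentiableAt_dlog (hx : x ∈ chartDomain n κ) (i : Fin n) :
    DifferentiableAt ℝ (dlog κ i) x :=
  ContDiffOn.differentiableAt' (isOpen_chartDomain n κ) one_ne_zero (contDiffOn_dlog i) hx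

lemma pd_dlog (hx : x ∈ chartDomain n κ) (i j : Fin n) :
    pd i (dlog κ j) x
      = dlog κ i x * dlog κ j x - (κ : ℝ) / 2 * lam κ x * (if i = j then 1 else 0) := by
  have : dlog κ j = fun x : Coord n => (-((κ : ℝ) / 2) * lam κ x) * x j := rfl
  rw [this, pd_mul ((differentiableAt_lam hx).const_mul _) (differentiableAt_coord j x),
    pd_const_mul (differentiableAt_lam hx), pd_lam hx, pd_coord]
  simp only [dlog]; ring

lemma sum_dlog_sq (hx : x ∈ chartDomain n κ) :
    ∑ i, dlog κ i x ^ 2 = κ * lam κ x * (1 - lam κ x) := by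
  have h : ∑ i, dlog κ i x ^ 2 = ((κ : ℝ) / 2 * lam κ x) ^ 2 * ‖x‖ ^ 2 := by
    rw [norm_sq_eq, Finset.mul_sum]
    exact Finset.sum_congr rfl fun i _ => by simp only [dlog]; ring
  rw [h]
  linear_combination ((κ : ℝ) * lam κ x) * lam_mul hx

lemma param_fst (hx : x ∈ chartDomain n κ) :
    (param n κ ε x).1 = ε * (2 * lam κ x - 1) := by
  have h : (param n κ ε x).1 = ε * (1 - (κ : ℝ) / 4 * ‖x‖ ^ 2) * lam κ x := by
    simp only [param, lam, div_eq_mul_inv]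
  rw [h]
  linear_combination (-ε) * lam_mul hx

lemma param_snd : (param n κ ε x).2 = lam κ x • x := by simp [param, lam]

lemma hasFDerivAt_param (hx : x ∈ chartDomain n κ) :
    HasFDerivAt (param n κ ε)
      ((((2 * ε) * -((κ : ℝ) / 2 * lam κ x ^ 2)) • innerSL ℝ x).prod
        (lam κ x • ContinuousLinearMap.id ℝ (Coord n)
          + (-((κ : ℝ) / 2 * lam κ x ^ 2) • innerSL ℝ x).smulRight x)) x := by
  have h1 : HasFDerivAt (fun y : Coord n => ε * (2 * lam κ y - 1))
      (((2 * ε) * -((κ : ℝ) / 2 * lam κ x ^ 2)) • innerSL ℝ x) x := by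
    refine ((((hasFDerivAt_lam hx).const_mul 2).sub_const 1).const_mul ε).congr_fderiv ?_
    ext v; simp; ring
  have h2 := (hasFDerivAt_lam hx).smul (hasFDerivAt_id x)
  refine (h1.prodMk h2).congr_of_eventuallyEq ?_
  filter_upwards [(isOpen_chartDomain n κ).mem_nhds hx] with y hy
  exact Prod.ext (param_fst hy) param_snd

lemma coordVec_fst (hx : x ∈ chartDomain n κ) (i : Fin n) :
    (coordVec n κ ε x i).1 = -(ε * κ * lam κ x ^ 2 * x i) := by
  rw [coordVec, (hasFDerivAt_param hx).fderiv]
  simp only [ContinuousLinearMap.prod_apply, smul_apply, innerSL_apply_apply,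
    EuclideanSpace.inner_single_right, conj_trivial, smul_eq_mul]
  ring

lemma coordVec_snd (hx : x ∈ chartDomain n κ) (i : Fin n) :
    (coordVec n κ ε x i).2 = lam κ x • EuclideanSpace.single i (1 : ℝ)
      - ((κ : ℝ) / 2 * lam κ x ^ 2 * x i) • x := by
  rw [coordVec, (hasFDerivAt_param hx).fderiv]
  simp [EuclideanSpace.inner_single_right]
  rw [sub_eq_add_neg]

/-- The stereographic charts are conformal. -/
lemma metric_eq (hε : ε ∈ chartLabels κ) (hx : x ∈ chartDomain n κ) :
    metric n κ ε x = lam κ x ^ 2 • (1 : Matrix (Fin n) (Fin n) ℝ) := by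
  ext i j
  simp only [metric, Matrix.of_apply, ambientForm, coordVec_fst hx, coordVec_snd hx,
    Matrix.smul_apply, Matrix.one_apply, smul_eq_mul]
  simp only [inner_sub_left, inner_sub_right, inner_smul_left, inner_smul_right,
    EuclideanSpace.inner_single_right, EuclideanSpace.inner_single_left, real_inner_self_eq_norm_sq]
  simp only [conj_trivial, PiLp.single_apply]
  have h1 := lam_mul hx
  have h2 := label_sq hε
  have h3 := cast_cube κ
  have h4 : (if i = j then (1 : ℝ) else 0) = if j = i then 1 else 0 := by simp [eq_comm]
  rw [h4]
  set d : ℝ := if j = i then 1 else 0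
  generalize lam κ x = l at *
  generalize (κ : ℝ) = k at *
  linear_combination (k ^ 3 * l ^ 4 * x i * x j) * h2 + (l ^ 4 * x i * x j) * h3
    + (k * l ^ 3 * x i * x j) * h1

lemma metric_inv (hε : ε ∈ chartLabels κ) (hx : x ∈ chartDomain n κ) (i j : Fin n) :
    (metric n κ ε x)⁻¹ i j = if i = j then (lam κ x ^ 2)⁻¹ else 0 := by
  rw [metric_eq hε hx, Matrix.inv_eq_right_inv (B := (lam κ x ^ 2)⁻¹ • 1), Matrix.smul_apply,
    Matrix.one_apply]
  · simp
  · have := lam_ne hx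
    ext i j; simp [Matrix.one_apply, this]

lemma metric_apply (hε : ε ∈ chartLabels κ) (hx : x ∈ chartDomain n κ) (i j : Fin n) :
    metric n κ ε x i j = lam κ x ^ 2 * if i = j then 1 else 0 := by
  rw [metric_eq hε hx]; simp [Matrix.one_apply]

lemma pd_metric (hε : ε ∈ chartLabels κ) (hx : x ∈ chartDomain n κ) (i j k : Fin n) :
    pd k (fun y => metric n κ ε y i j) x
      = 2 * dlog κ k x * lam κ x ^ 2 * if i = j then 1 else 0 := by
  have h : EqOn (fun y => metric n κ ε y i j)
      (fun y => (lam κ y * lam κ y) * if i = j then 1 else 0) (chartDomain n κ) := fun y hy => by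
    simp only [metric_apply hε hy, sq]
  rw [pd_congr_of_isOpen (isOpen_chartDomain n κ) h hx,
    pd_mul_const ((differentiableAt_lam hx).fun_mul (differentiableAt_lam hx)),
    pd_mul (differentiableAt_lam hx) (differentiableAt_lam hx), pd_lam hx]
  ring

end ConformalFactor

/-! ### Tensor calculus in the stereographic charts -/

section ConformalCalculus

variable {n : ℕ} {κ : SignType} {ε : ℝ} {x : Coord n}

lemma christoffel_eq (hε : ε ∈ chartLabels κ) (hx : x ∈ chartDomain n κ) (k i j : Fin n) :
    christoffel (metric n κ ε) k i j x = (if k = i then dlog κ j x else 0)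
      + (if k = j then dlog κ i x else 0) - (if i = j then dlog κ k x else 0) := by
  have hl := lam_ne hx
  simp only [christoffel, metric_inv hε hx, pd_metric hε hx]
  simp only [ite_mul, zero_mul, Finset.sum_ite_eq, Finset.mem_univ, if_true]
  by_cases h1 : i = j
  · subst h1
    by_cases h2 : k = i
    · subst h2; simp; field_simp
    · have h2' : i ≠ k := fun h => h2 h.symm
      simp [h2, h2']; field_simp
  · by_cases h2 : k = i
    · subst h2
      have h1' : j ≠ k := fun h => h1 h.symm
      simp [h1, h1']; field_simp
    · have h2' : i ≠ k := fun h => h2 h.symm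
      by_cases h3 : k = j
      · subst h3; simp [h1, h2]; field_simp
      · have h3' : j ≠ k := fun h => h3 h.symm
        simp [h1, h2, h3, h3', h2']

lemma pd_christoffel (hε : ε ∈ chartLabels κ) (hx : x ∈ chartDomain n κ) (l k i j : Fin n) :
    pd l (christoffel (metric n κ ε) k i j) x = (if k = i then pd l (dlog κ j) x else 0)
      + (if k = j then pd l (dlog κ i) x else 0) - (if i = j then pd l (dlog κ k) x else 0) := by
  have h : EqOn (christoffel (metric n κ ε) k i j) (fun y =>
      (dlog κ j y * (if k = i then 1 else 0) + dlog κ i y * (if k = j then 1 else 0))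
        - dlog κ k y * (if i = j then 1 else 0)) (chartDomain n κ) := fun y hy => by
    simp only [christoffel_eq hε hy, mul_ite, mul_one, mul_zero]
  have hd := fun i => differentiableAt_dlog (κ := κ) hx i
  rw [pd_congr_of_isOpen (isOpen_chartDomain n κ) h hx,
    pd_sub (((hd j).mul_const _).fun_add ((hd i).mul_const _)) ((hd k).mul_const _),
    pd_add ((hd j).mul_const _) ((hd i).mul_const _), pd_mul_const (hd j), pd_mul_const (hd i),
    pd_mul_const (hd k)]
  simp only [mul_ite, mul_one, mul_zero]

/-- The space form is an Einstein manifold. -/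
lemma ricci_eq (hε : ε ∈ chartLabels κ) (hx : x ∈ chartDomain n κ) (j k : Fin n) :
    ricci (metric n κ ε) x j k
      = if j = k then ((n : ℝ) - 1) * κ * lam κ x ^ 2 else 0 := by
  have h1 : ∑ i, pd i (christoffel (metric n κ ε) i j k) x
      = 2 * dlog κ j x * dlog κ k x - (κ : ℝ) * lam κ x * (if j = k then 1 else 0)
        - (if j = k then (κ : ℝ) * lam κ x * (1 - lam κ x) - n * ((κ : ℝ) / 2 * lam κ x) else 0) := by
    simp only [pd_christoffel hε hx, Finset.sum_add_distrib, Finset.sum_sub_distrib,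
      Finset.sum_ite_eq', Finset.mem_univ, if_true, pd_dlog hx]
    have h2 : ∑ i : Fin n, (if j = k then dlog κ i x * dlog κ i x - (κ : ℝ) / 2 * lam κ x *
        1 else 0)
        = if j = k then (κ : ℝ) * lam κ x * (1 - lam κ x) - n * ((κ : ℝ) / 2 * lam κ x) else 0 := by
      split_ifs
      · rw [← sum_dlog_sq hx]
        simp [Finset.sum_sub_distrib, sq]
      · simp
    rw [h2]
    have h4 : (if k = j then (1 : ℝ) else 0) = if j = k then 1 else 0 := by simp [eq_comm]
    rw [h4]; ring
  have h2 : ∑ i, pd j (christoffel (metric n κ ε) i i k) x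
      = n * (dlog κ j x * dlog κ k x - (κ : ℝ) / 2 * lam κ x * (if j = k then 1 else 0)) := by
    simp [pd_christoffel hε hx, pd_dlog hx]
    split_ifs <;> ring
  have h3 : ∀ p, ∑ i, christoffel (metric n κ ε) i i p x = n * dlog κ p x := by
    intro p
    simp [christoffel_eq hε hx]
  have h4 : ∑ i, ∑ p, christoffel (metric n κ ε) i i p x * christoffel (metric n κ ε) p j k x
      = n * (2 * dlog κ j x * dlog κ k x
        - if j = k then (κ : ℝ) * lam κ x * (1 - lam κ x) else 0) := by
    rw [Finset.sum_comm]
    simp only [← Finset.sum_mul, h3]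
    simp only [christoffel_eq hε hx, mul_add, mul_sub,
      Finset.sum_add_distrib, Finset.sum_sub_distrib, mul_ite, mul_zero, Finset.sum_ite_eq',
      Finset.mem_univ, if_true]
    split_ifs
    · have h0 : ∑ i, (n : ℝ) * dlog κ i x ^ 2 = n * (κ * lam κ x * (1 - lam κ x)) := by
        rw [← sum_dlog_sq hx, Finset.mul_sum]
      have : ∀ i, (n : ℝ) * dlog κ i x * dlog κ i x = n * dlog κ i x ^ 2 := fun i => by ring
      simp only [this, h0]; ring
    · simp; ring
  have h5 : ∑ i, ∑ p, christoffel (metric n κ ε) i j p x * christoffel (metric n κ ε) p i k x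
      = (n + 2) * (dlog κ j x * dlog κ k x)
        - 2 * if j = k then (κ : ℝ) * lam κ x * (1 - lam κ x) else 0 := by
    have hs : (if j = k then (κ : ℝ) * lam κ x * (1 - lam κ x) else 0)
        = ∑ i, if j = k then dlog κ i x ^ 2 else 0 := by
      split_ifs
      · rw [sum_dlog_sq hx]
      · simp
    rw [hs]
    have e : ∀ i p, christoffel (metric n κ ε) i j p x * christoffel (metric n κ ε) p i k x
        = (if i = j then dlog κ p x * christoffel (metric n κ ε) p i k x else 0)
          + (if i = p then dlog κ j x * christoffel (metric n κ ε) p i k x else 0)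
          - (if j = p then dlog κ i x * christoffel (metric n κ ε) p i k x else 0) := by
      intro i p
      rw [christoffel_eq hε hx i j p]
      split_ifs <;> ring
    simp only [e, Finset.sum_add_distrib, Finset.sum_sub_distrib]
    have e1 : ∑ i, ∑ p, (if i = j then dlog κ p x * christoffel (metric n κ ε) p i k x else 0)
        = 2 * (dlog κ j x * dlog κ k x) - ∑ i, if j = k then dlog κ i x ^ 2 else 0 := by
      rw [Finset.sum_comm]
      simp only [Finset.sum_ite_eq', Finset.mem_univ, if_true, christoffel_eq hε hx, mul_add,
        mul_sub, Finset.sum_add_distrib, Finset.sum_sub_distrib, mul_ite, mul_zero]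
      congr 1
      · ring
      · exact Finset.sum_congr rfl fun i _ => by split_ifs <;> ring
    have e2 : ∑ i, ∑ p, (if i = p then dlog κ j x * christoffel (metric n κ ε) p i k x else 0)
        = n * (dlog κ j x * dlog κ k x) := by
      simp only [Finset.sum_ite_eq, Finset.mem_univ, if_true, ← Finset.mul_sum, h3]
      ring
    have e3 : ∑ i, ∑ p, (if j = p then dlog κ i x * christoffel (metric n κ ε) p i k x else 0)
        = ∑ i, if j = k then dlog κ i x ^ 2 else 0 := by
      simp only [Finset.sum_ite_eq, Finset.mem_univ, if_true, christoffel_eq hε hx, mul_add,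
        mul_sub, Finset.sum_add_distrib, Finset.sum_sub_distrib, mul_ite, mul_zero]
      simp [sq]
      ring
    rw [e1, e2, e3]; ring
  simp only [ricci, Finset.sum_add_distrib, Finset.sum_sub_distrib]
  rw [h1, h2, h4, h5]
  split_ifs <;> ring

lemma scal_eq (hε : ε ∈ chartLabels κ) (hx : x ∈ chartDomain n κ) :
    scal (metric n κ ε) x = n * ((n : ℝ) - 1) * κ := by
  have hl := lam_ne hx
  simp only [scal, metric_inv hε hx, ricci_eq hε hx]
  simp
  field_simp

lemma covDeriv_eq (hε : ε ∈ chartLabels κ) (hx : x ∈ chartDomain n κ) (W : Coord n → Fin n → ℝ)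
    (i j : Fin n) :
    covDeriv (metric n κ ε) W x i j = pd i (fun y => W y j) x - dlog κ j x * W x i
      - dlog κ i x * W x j + if i = j then ∑ k, dlog κ k x * W x k else 0 := by
  simp only [covDeriv, christoffel_eq hε hx, add_mul, sub_mul, Finset.sum_add_distrib,
    Finset.sum_sub_distrib, ite_mul, zero_mul, Finset.sum_ite_eq', Finset.mem_univ, if_true]
  split_ifs
  · ring
  · simp; ring

lemma div₁_eq (hε : ε ∈ chartLabels κ) (hx : x ∈ chartDomain n κ) (W : Coord n → Fin n → ℝ) :
    div₁ (metric n κ ε) W x = (lam κ x ^ 2)⁻¹ * ((∑ i, pd i (fun y => W y i) x)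
      + ((n : ℝ) - 2) * ∑ i, dlog κ i x * W x i) := by
  simp only [div₁, metric_inv hε hx, covDeriv_eq hε hx, ite_mul, zero_mul, Finset.sum_ite_eq,
    Finset.mem_univ, if_true, ← Finset.mul_sum, Finset.sum_add_distrib, Finset.sum_sub_distrib,
    Finset.sum_const, Finset.card_univ, Fintype.card_fin, nsmul_eq_mul]
  ring

lemma confKilling_eq (hn : n ≠ 0) (hε : ε ∈ chartLabels κ) (hx : x ∈ chartDomain n κ)
    (W : Coord n → Fin n → ℝ) (i j : Fin n) :
    confKilling (metric n κ ε) W x i j = pd i (fun y => W y j) x + pd j (fun y => W y i) x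
      - 2 * (dlog κ j x * W x i + dlog κ i x * W x j)
      - 2 / (n : ℝ) * (if i = j then 1 else 0) * ((∑ k, pd k (fun y => W y k) x)
        - 2 * ∑ k, dlog κ k x * W x k) := by
  have hl := lam_ne hx
  have hn' : (n : ℝ) ≠ 0 := by exact_mod_cast hn
  have h4 : ∀ a : ℝ, (if j = i then a else 0) = if i = j then a else 0 := by simp [eq_comm]
  simp only [confKilling, covDeriv_eq hε hx, div₁_eq hε hx, metric_apply hε hx, h4]
  split_ifs
  · field_simp; ring
  · ring

lemma confKilling_symm (W : Coord n → Fin n → ℝ) (hn : n ≠ 0) (hε : ε ∈ chartLabels κ)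
    (hx : x ∈ chartDomain n κ) (i j : Fin n) :
    confKilling (metric n κ ε) W x i j = confKilling (metric n κ ε) W x j i := by
  have h4 : (if j = i then (1 : ℝ) else 0) = if i = j then 1 else 0 := by simp [eq_comm]
  rw [confKilling_eq hn hε hx, confKilling_eq hn hε hx, h4]
  ring

lemma confKilling_trace (W : Coord n → Fin n → ℝ) (hn : n ≠ 0) (hε : ε ∈ chartLabels κ)
    (hx : x ∈ chartDomain n κ) : ∑ i, confKilling (metric n κ ε) W x i i = 0 := by
  have hn' : (n : ℝ) ≠ 0 := by exact_mod_cast hn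
  simp only [confKilling_eq hn hε hx, if_true, Finset.sum_add_distrib, Finset.sum_sub_distrib,
    ← Finset.mul_sum, Finset.sum_const, Finset.card_univ, Fintype.card_fin, nsmul_eq_mul]
  field_simp
  ring

/-- The divergence of a symmetric trace-free tensor in a conformally flat metric. -/
lemma div₂_eq (hε : ε ∈ chartLabels κ) (hx : x ∈ chartDomain n κ) (T : Coord n → Fin n → Fin n → ℝ)
    (hT : ∀ i j, T x i j = T x j i) (hT' : ∑ i, T x i i = 0) (j : Fin n) :
    div₂ (metric n κ ε) T x j = (lam κ x ^ 2)⁻¹ * ((∑ k, pd k (fun y => T y k j) x)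
      + ((n : ℝ) - 2) * ∑ k, dlog κ k x * T x k j) := by
  simp only [div₂, covDeriv₂, metric_inv hε hx, ite_mul, zero_mul, Finset.sum_ite_eq,
    Finset.mem_univ, if_true, ← Finset.mul_sum, Finset.sum_sub_distrib, Finset.sum_add_distrib]
  have h1 : ∑ k, ∑ l, christoffel (metric n κ ε) l k k x * T x l j
      = (2 - (n : ℝ)) * ∑ k, dlog κ k x * T x k j := by
    simp only [christoffel_eq hε hx, add_mul, sub_mul, Finset.sum_add_distrib,
      Finset.sum_sub_distrib, ite_mul, zero_mul, Finset.sum_ite_eq', Finset.mem_univ, if_true,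
      Finset.sum_const, Finset.card_univ, Fintype.card_fin, nsmul_eq_mul]
    ring
  have h2 : ∑ k, ∑ l, christoffel (metric n κ ε) l k j x * T x k l = 0 := by
    simp only [christoffel_eq hε hx, add_mul, sub_mul, Finset.sum_add_distrib,
      Finset.sum_sub_distrib, ite_mul, zero_mul, Finset.sum_ite_eq', Finset.mem_univ, if_true]
    rw [← Finset.mul_sum, hT', Finset.sum_comm (γ := Fin n)]
    simp only [Finset.sum_ite_eq', Finset.mem_univ, if_true]
    rw [mul_zero, zero_add, sub_eq_zero]
    exact Finset.sum_congr rfl fun k _ => by rw [hT]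
  rw [h1, h2]
  ring

lemma laplacian_eq (hε : ε ∈ chartLabels κ) (hx : x ∈ chartDomain n κ) (f : Coord n → ℝ) :
    laplacian (metric n κ ε) f x = (lam κ x ^ 2)⁻¹ * ((∑ i, pd i (pd i f) x)
      + ((n : ℝ) - 2) * ∑ i, dlog κ i x * pd i f x) := by
  rw [laplacian, div₁_eq hε hx]

lemma normSq₁_eq (hε : ε ∈ chartLabels κ) (hx : x ∈ chartDomain n κ) (w : Fin n → ℝ) :
    normSq₁ (metric n κ ε) x w = (lam κ x ^ 2)⁻¹ * ∑ i, w i ^ 2 := by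
  simp only [normSq₁, metric_inv hε hx, ite_mul, zero_mul, Finset.sum_ite_eq, Finset.mem_univ,
    if_true, Finset.mul_sum]
  exact Finset.sum_congr rfl fun i _ => by ring

lemma normSq₂_eq (hε : ε ∈ chartLabels κ) (hx : x ∈ chartDomain n κ) (T : Fin n → Fin n → ℝ) :
    normSq₂ (metric n κ ε) x T = (lam κ x ^ 4)⁻¹ * ∑ i, ∑ j, T i j ^ 2 := by
  have hl := lam_ne hx
  simp only [normSq₂, metric_inv hε hx, ite_mul, mul_ite, mul_zero, zero_mul, Finset.sum_ite_eq,
    Finset.mem_univ, if_true, Finset.mul_sum]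
  refine Finset.sum_congr rfl fun i _ => ?_
  refine Finset.sum_congr rfl fun j _ => ?_
  field_simp

end ConformalCalculus

/-! ### Generalized trigonometric functions -/

section Trigonometry

variable {κ : SignType} {r r' : ℝ}

lemma cast_pos : ((SignType.pos : SignType) : ℝ) = 1 := by
  rw [show SignType.pos = 1 from rfl]; norm_num

lemma cast_zero : ((SignType.zero : SignType) : ℝ) = 0 := by
  rw [show SignType.zero = 0 from rfl]; norm_num

lemma cast_neg : ((SignType.neg : SignType) : ℝ) = -1 := by
  rw [show SignType.neg = -1 from rfl]; norm_num

lemma hasDerivAt_sk (κ : SignType) (r : ℝ) : HasDerivAt (sk κ) (ck κ r) r := by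
  rcases κ with _ | _ | _
  · exact hasDerivAt_id r
  · exact Real.hasDerivAt_sinh r
  · exact Real.hasDerivAt_sin r

lemma hasDerivAt_ck (κ : SignType) (r : ℝ) : HasDerivAt (ck κ) (-κ * sk κ r) r := by
  rcases κ with _ | _ | _
  · rw [cast_zero, neg_zero, zero_mul]; exact hasDerivAt_const r 1
  · rw [cast_neg, neg_neg, one_mul]; exact Real.hasDerivAt_cosh r
  · rw [cast_pos, neg_one_mul]; exact Real.hasDerivAt_cos r

lemma contDiff_sk {k : ℕ∞ω} (κ : SignType) : ContDiff ℝ k (sk κ) := by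
  rcases κ with _ | _ | _
  exacts [contDiff_id, Real.contDiff_sinh, Real.contDiff_sin]

lemma contDiff_ck {k : ℕ∞ω} (κ : SignType) : ContDiff ℝ k (ck κ) := by
  rcases κ with _ | _ | _
  exacts [contDiff_const, Real.contDiff_cosh, Real.contDiff_cos]

lemma continuous_sk (κ : SignType) : Continuous (sk κ) := (contDiff_sk (k := 0) κ).continuous

lemma continuous_ck (κ : SignType) : Continuous (ck κ) := (contDiff_ck (k := 0) κ).continuous

lemma ck_sq_add (κ : SignType) (r : ℝ) : ck κ r ^ 2 + κ * sk κ r ^ 2 = 1 := by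
  rcases κ with _ | _ | _
  · simp [ck]
  · rw [cast_neg]; simp only [ck, sk]; linarith [Real.cosh_sq r]
  · rw [cast_pos]; simp only [ck, sk]; linarith [Real.sin_sq_add_cos_sq r]

lemma sk_zero (κ : SignType) : sk κ 0 = 0 := by
  rcases κ with _ | _ | _ <;> simp [sk]

lemma ck_zero (κ : SignType) : ck κ 0 = 1 := by
  rcases κ with _ | _ | _ <;> simp [ck]

lemma isOpen_radii (κ : SignType) : IsOpen (radii κ) := by
  by_cases h : κ = 1
  · have : radii κ = Ioo 0 Real.pi := by ext r; simp [radii, h]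
    rw [this]; exact isOpen_Ioo
  · have : radii κ = Ioi 0 := by ext r; simp [radii, h]
    rw [this]; exact isOpen_Ioi

lemma radii_one : radii 1 = Ioo 0 Real.pi := by ext r; simp [radii]

lemma Ioc_subset_radii (hr : r ∈ radii κ) : Ioc 0 r ⊆ radii κ :=
  fun _ ht => ⟨ht.1, fun h => ht.2.trans_lt (hr.2 h)⟩

lemma ordConnected_radii (κ : SignType) : OrdConnected (radii κ) :=
  ⟨fun _ ha _ hb _ ht => ⟨ha.1.trans_le ht.1, fun h => ht.2.trans_lt (hb.2 h)⟩⟩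

lemma sk_pos (hr : r ∈ radii κ) : 0 < sk κ r := by
  rcases κ with _ | _ | _
  · exact hr.1
  · exact Real.sinh_pos_iff.2 hr.1
  · exact Real.sin_pos_of_pos_of_lt_pi hr.1 (hr.2 rfl)

lemma sk_ne (hr : r ∈ radii κ) : sk κ r ≠ 0 := (sk_pos hr).ne'

lemma one_add_label_mul_ck_pos {ε : ℝ} (hε : ε ∈ chartLabels κ) (hr : r ∈ radii κ) :
    0 < 1 + ε * ck κ r := by
  have h : κ = 1 → ck κ r ^ 2 < 1 := by
    rintro rfl
    have := ck_sq_add 1 r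
    have h1 := sk_pos hr
    simp at this
    nlinarith [sq_pos_of_pos h1]
  rcases hε with rfl | ⟨hκ, rfl⟩
  · rcases κ with _ | _ | _
    · simp [ck]
    · have := Real.cosh_pos r
      simp only [ck]; linarith
    · nlinarith [h rfl]
  · nlinarith [h hκ]

lemma eq_of_sk_eq_of_ck_eq (hr : r ∈ radii κ) (hr' : r' ∈ radii κ) (h : sk κ r = sk κ r')
    (h' : ck κ r = ck κ r') : r = r' := by
  rcases κ with _ | _ | _
  · exact h
  · exact Real.sinh_injective h
  · exact Real.injOn_cos ⟨hr.1.le, (hr.2 rfl).le⟩ ⟨hr'.1.le, (hr'.2 rfl).le⟩ h'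

end Trigonometry

/-! ### The distance to the pole in the stereographic charts -/

section Radius

variable {n : ℕ} {κ : SignType} {ε : ℝ} {x : Coord n}

lemma lam_sq_identity (hx : x ∈ chartDomain n κ) :
    (2 * lam κ x - 1) ^ 2 + κ * (lam κ x * ‖x‖) ^ 2 = 1 := by
  linear_combination (4 * lam κ x) * lam_mul hx

lemma norm_param_snd (hx : x ∈ chartDomain n κ) : ‖(param n κ ε x).2‖ = lam κ x * ‖x‖ := by
  rw [param_snd, norm_smul, Real.norm_of_nonneg (lam_pos hx).le]

lemma lam_zero_curv : lam SignType.zero x = 1 := by simp [lam]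

lemma label_eq_one (hκ : κ ≠ 1) (hε : ε ∈ chartLabels κ) : ε = 1 := by
  rcases hε with h | h
  exacts [h, absurd h.1 hκ]

lemma fst_sq_of_label (hε : ε ∈ chartLabels SignType.pos) (hx : x ∈ chartDomain n SignType.pos) :
    (param n SignType.pos ε x).1 ^ 2 + (lam SignType.pos x * ‖x‖) ^ 2 = 1 := by
  have h := lam_sq_identity hx
  rw [cast_pos, one_mul] at h
  rw [param_fst hx, mul_pow, label_sq hε, one_mul, h]

lemma sk_radius (hε : ε ∈ chartLabels κ) (hx : x ∈ chartDomain n κ) :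
    sk κ (radius κ (param n κ ε x)) = lam κ x * ‖x‖ := by
  have hl := lam_pos hx
  rcases κ with _ | _ | _
  · exact norm_param_snd hx
  · simp only [sk, radius, Real.sinh_arsinh]; exact norm_param_snd hx
  · simp only [sk, radius, Real.sin_arccos]
    rw [show 1 - (param n SignType.pos ε x).1 ^ 2 = (lam SignType.pos x * ‖x‖) ^ 2 by
      linarith [fst_sq_of_label hε hx], Real.sqrt_sq (by positivity)]

lemma ck_radius (hε : ε ∈ chartLabels κ) (hx : x ∈ chartDomain n κ) :
    ck κ (radius κ (param n κ ε x)) = ε * (2 * lam κ x - 1) := by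
  have hl := lam_pos hx
  rcases κ with _ | _ | _
  · rw [label_eq_one (by decide) hε, lam_zero_curv]; norm_num [ck]
  · rw [label_eq_one (by decide) hε, one_mul]
    have h := lam_sq_identity hx
    have h2 := lam_mul hx
    rw [cast_neg] at h h2
    have h1 : 0 ≤ 2 * lam SignType.neg x - 1 := by nlinarith [mul_nonneg hl.le (sq_nonneg ‖x‖)]
    simp only [ck, radius, Real.cosh_arsinh]
    rw [norm_param_snd hx, show 1 + (lam SignType.neg x * ‖x‖) ^ 2
      = (2 * lam SignType.neg x - 1) ^ 2 by linarith, Real.sqrt_sq h1]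
  · have h := fst_sq_of_label hε hx
    rw [← param_fst hx]
    exact Real.cos_arccos (by nlinarith [sq_nonneg (lam SignType.pos x * ‖x‖)])
      (by nlinarith [sq_nonneg (lam SignType.pos x * ‖x‖)])

lemma radius_mem (hε : ε ∈ chartLabels κ) (hx : x ∈ chartDomain n κ) (hx0 : x ≠ 0) :
    radius κ (param n κ ε x) ∈ radii κ := by
  have hs : 0 < lam κ x * ‖x‖ := mul_pos (lam_pos hx) (norm_pos_iff.2 hx0)
  rcases κ with _ | _ | _
  · exact ⟨by simp only [radius]; rwa [norm_param_snd hx], fun h => absurd h (by decide)⟩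
  · exact ⟨by simp only [radius]; rwa [Real.arsinh_pos_iff, norm_param_snd hx],
      fun h => absurd h (by decide)⟩
  · have h := fst_sq_of_label hε hx
    have h1 : (param n SignType.pos ε x).1 < 1 := by nlinarith
    have h2 : -1 < (param n SignType.pos ε x).1 := by nlinarith
    refine ⟨Real.arccos_pos.2 h1, fun _ => ?_⟩
    refine lt_of_le_of_ne (Real.arccos_le_pi _) fun h3 => ?_
    exact absurd (Real.arccos_eq_pi.1 h3) (not_le.2 h2)

/-- The punctured domain of a chart, on which the distance to the pole is smooth. -/
def punctured (n : ℕ) (κ : SignType) : Set (Coord n) := chartDomain n κ \ {0}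

lemma isOpen_punctured (n : ℕ) (κ : SignType) : IsOpen (punctured n κ) :=
  (isOpen_chartDomain n κ).sdiff isClosed_singleton

lemma contDiffOn_param {k : ℕ∞ω} : ContDiffOn ℝ k (param n κ ε) (chartDomain n κ) := by
  have h1 : ContDiffOn ℝ k (fun x : Coord n => (ε * (2 * lam κ x - 1), lam κ x • x))
      (chartDomain n κ) :=
    (contDiffOn_const.mul ((contDiffOn_const.mul contDiffOn_lam).sub contDiffOn_const)).prodMk
      (contDiffOn_lam.smul contDiffOn_id)
  exact h1.congr fun x hx => Prod.ext (param_fst hx) param_snd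

lemma contDiffOn_radius {k : ℕ∞ω} (hε : ε ∈ chartLabels κ) :
    ContDiffOn ℝ k (fun x => radius κ (param n κ ε x)) (punctured n κ) := by
  have hp : ContDiffOn ℝ k (param n κ ε) (punctured n κ) := contDiffOn_param.mono sdiff_subset
  have h0 : ∀ x ∈ punctured n κ, (param n κ ε x).2 ≠ 0 := fun x hx => by
    rw [param_snd]; exact smul_ne_zero (lam_ne hx.1) hx.2
  rcases κ with _ | _ | _
  · exact hp.snd.norm ℝ h0
  · exact Real.contDiff_arsinh.comp_contDiffOn (hp.snd.norm ℝ h0)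
  · intro x hx
    have h := fst_sq_of_label hε hx.1
    have hs : 0 < lam SignType.pos x * ‖x‖ := mul_pos (lam_pos hx.1) (norm_pos_iff.2 hx.2)
    refine (Real.contDiffAt_arccos ?_ ?_).comp_contDiffWithinAt x (hp x hx).fst
    · intro h1; rw [h1] at h; nlinarith
    · intro h1; rw [h1] at h; nlinarith

lemma continuousOn_radius (n : ℕ) (κ : SignType) (ε : ℝ) :
    ContinuousOn (fun x => radius κ (param n κ ε x)) (chartDomain n κ) := by
  have hp : ContinuousOn (param n κ ε) (chartDomain n κ) :=
    (contDiffOn_param (k := 0)).continuousOn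
  rcases κ with _ | _ | _
  · exact hp.snd.norm
  · exact Real.continuous_arsinh.comp_continuousOn hp.snd.norm
  · exact Real.continuous_arccos.comp_continuousOn hp.fst

lemma differentiableAt_radius (hε : ε ∈ chartLabels κ) (hx : x ∈ punctured n κ) :
    DifferentiableAt ℝ (fun x => radius κ (param n κ ε x)) x :=
  ContDiffOn.differentiableAt' (k := 1) (isOpen_punctured n κ) one_ne_zero
    (contDiffOn_radius hε) hx

/-- The components of `dr`. They are found by differentiating the polynomial relation between
`λ` and `(s_κ(r), c_κ(r))`. -/
lemma pd_radius (hε : ε ∈ chartLabels κ) (hx : x ∈ punctured n κ) (i : Fin n) :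
    pd i (fun x => radius κ (param n κ ε x)) x
      = ε * lam κ x ^ 2 * x i / sk κ (radius κ (param n κ ε x)) := by
  have hr := radius_mem hε hx.1 hx.2
  have hd := differentiableAt_radius hε hx
  have hs := sk_ne hr
  have hl := lam_ne hx.1
  have hε2 := label_sq hε
  have hO := (isOpen_chartDomain n κ)
  rw [eq_div_iff hs]
  -- differentiate `s_κ(r)² = λ² |x|²` and `c_κ(r) = ε (2 λ - 1)`
  have e1 := pd_comp (hasDerivAt_ck κ _) hd i
  have e1' : pd i (fun y => ck κ (radius κ (param n κ ε y))) x = ε * (2 * (dlog κ i x * lam κ x)) := by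
    have hc : EqOn (fun y => ck κ (radius κ (param n κ ε y))) (fun y => ε * (2 * lam κ y - 1))
      (chartDomain n κ) := fun y hy => ck_radius hε hy
    have hdl := differentiableAt_lam hx.1
    rw [pd_congr_of_isOpen hO hc hx.1, pd_const_mul ((hdl.const_mul _).sub_const _),
      pd_sub (hdl.const_mul _) (differentiableAt_const _), pd_const_mul hdl, pd_lam hx.1, pd_const,
      sub_zero]
  have e2 := pd_comp ((hasDerivAt_sk κ _).mul (hasDerivAt_sk κ _)) hd i
  have e2' : pd i (fun y => (sk κ * sk κ) (radius κ (param n κ ε y))) x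
      = 2 * lam κ x ^ 2 * (dlog κ i x * ‖x‖ ^ 2 + x i) := by
    have hc : EqOn (fun y => (sk κ * sk κ) (radius κ (param n κ ε y)))
      (fun y => lam κ y * lam κ y * ∑ j, y j * y j) (chartDomain n κ) := fun y hy => by
        simp only [Pi.mul_apply, sk_radius hε hy, ← sq, mul_pow, norm_sq_eq]
    have hdl := differentiableAt_lam hx.1
    have hdx := fun j => differentiableAt_coord j x
    rw [pd_congr_of_isOpen hO hc hx.1, pd_mul (hdl.fun_mul hdl)
      (DifferentiableAt.fun_sum fun j _ => (hdx j).fun_mul (hdx j)), pd_mul hdl hdl, pd_lam hx.1,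
      pd_sum (fun j _ => (hdx j).fun_mul (hdx j)), norm_sq_eq]
    simp only [fun j => pd_mul (hdx j) (hdx j) i, pd_coord]
    simp [Finset.sum_add_distrib, ← sq]
    ring
  rw [e1'] at e1
  rw [e2'] at e2
  rw [sk_radius hε hx.1, ck_radius hε hx.1] at e2
  rw [sk_radius hε hx.1] at e1 ⊢
  set D := pd i (fun x => radius κ (param n κ ε x)) x
  have hm := lam_mul hx.1
  simp only [dlog] at e1 e2
  set l := lam κ x
  set k := (κ : ℝ)
  set ρ := ‖x‖
  have hk : k * (D * (l * ρ)) = k * (ε * l ^ 2 * x i) := by linear_combination e1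
  -- `2 λ - 1 = 1 - (κ / 2) λ |x|²`
  have h3 : 2 * l - 1 = 1 - k / 2 * l * ρ ^ 2 := by linear_combination 2 * hm
  linear_combination (-1 / 2 * ε) * e2 + (1/2 * l * ρ ^ 2) * hk
    - (D * (l * ρ) * ε ^ 2) * h3 - (D * l * ρ * (1 - k / 2 * l * ρ ^ 2)) * hε2

end Radius

/-! ### Rays from the centres of the charts -/

section Rays

variable {n : ℕ} {κ : SignType} {ε : ℝ} {e : Coord n} {r : ℝ}

/-- The point at distance `r` from the pole on the ray with direction `e` from the centre of the
chart with label `ε`. -/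
def ray (κ : SignType) (ε : ℝ) (e : Coord n) (r : ℝ) : Coord n :=
  (2 * sk κ r / (1 + ε * ck κ r)) • e

lemma norm_ray_sq (he : ‖e‖ = 1) :
    ‖ray κ ε e r‖ ^ 2 = (2 * sk κ r / (1 + ε * ck κ r)) ^ 2 := by
  rw [ray, norm_smul, he, mul_one, Real.norm_eq_abs, sq_abs]

lemma one_add_norm_ray_sq (he : ‖e‖ = 1) (hε : ε ∈ chartLabels κ) (hr : r ∈ radii κ) :
    1 + (κ : ℝ) / 4 * ‖ray κ ε e r‖ ^ 2 = 2 / (1 + ε * ck κ r) := by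
  have h := (one_add_label_mul_ck_pos hε hr).ne'
  rw [norm_ray_sq he]
  field_simp
  linear_combination 4 * ck_sq_add κ r + 4 * ck κ r ^ 2 * label_sq hε

lemma lam_ray (he : ‖e‖ = 1) (hε : ε ∈ chartLabels κ) (hr : r ∈ radii κ) :
    lam κ (ray κ ε e r) = (1 + ε * ck κ r) / 2 := by
  rw [lam, one_add_norm_ray_sq he hε hr, inv_div]

lemma ray_mem (he : ‖e‖ = 1) (hε : ε ∈ chartLabels κ) (hr : r ∈ radii κ) :
    ray κ ε e r ∈ punctured n κ := by
  have h := one_add_label_mul_ck_pos hε hr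
  have hs := sk_pos hr
  refine ⟨?_, ?_⟩
  · rw [chartDomain, mem_ofPred_eq, one_add_norm_ray_sq he hε hr]; positivity
  · refine smul_ne_zero (by positivity) fun h0 => ?_
    rw [h0, norm_zero] at he
    exact zero_ne_one he

lemma radius_ray (he : ‖e‖ = 1) (hε : ε ∈ chartLabels κ) (hr : r ∈ radii κ) :
    radius κ (param n κ ε (ray κ ε e r)) = r := by
  have hx := ray_mem he hε hr
  have h := one_add_label_mul_ck_pos hε hr
  have hs := sk_pos hr
  refine eq_of_sk_eq_of_ck_eq (radius_mem hε hx.1 hx.2) hr ?_ ?_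
  · rw [sk_radius hε hx.1, lam_ray he hε hr, ray, norm_smul, he, mul_one, Real.norm_of_nonneg
      (by positivity)]
    field_simp
  · rw [ck_radius hε hx.1, lam_ray he hε hr]
    linear_combination ck κ r * label_sq hε

lemma contDiffOn_ray (hε : ε ∈ chartLabels κ) {k : ℕ∞ω} :
    ContDiffOn ℝ k (ray κ ε e) (radii κ) := by
  have h : ContDiffOn ℝ k (fun r => 2 * sk κ r / (1 + ε * ck κ r)) (radii κ) := by
    refine ContDiffOn.div ?_ ?_ fun r hr => (one_add_label_mul_ck_pos hε hr).ne'
    · exact (contDiff_const.mul (contDiff_sk κ)).contDiffOn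
    · exact (contDiff_const.add (contDiff_const.mul (contDiff_ck κ))).contDiffOn
  exact h.smul contDiffOn_const

/-- The filter of radii that tend to the centre of the chart with label `ε`: to `0` from the right
at the pole, and to `π` from the left at its antipode. -/
def endFilter (ε : ℝ) : Filter ℝ := if ε = 1 then 𝓝[>] 0 else 𝓝[<] Real.pi

/-- The radius of the centre of the chart with label `ε`. -/
def endPoint (ε : ℝ) : ℝ := if ε = 1 then 0 else Real.pi

lemma endFilter_one : endFilter 1 = 𝓝[>] 0 := if_pos rfl

lemma endFilter_neg_one : endFilter (-1) = 𝓝[<] Real.pi := if_neg (by norm_num)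

lemma endPoint_one : endPoint 1 = 0 := if_pos rfl

lemma endPoint_neg_one : endPoint (-1) = Real.pi := if_neg (by norm_num)

lemma endFilter_le (ε : ℝ) : endFilter ε ≤ 𝓝 (endPoint ε) := by
  by_cases h : ε = 1 <;> simp only [endFilter, endPoint, h, if_true, if_false] <;>
    exact nhdsWithin_le_nhds

instance (ε : ℝ) : (endFilter ε).NeBot := by
  by_cases h : ε = 1 <;> simp only [endFilter, h, if_true, if_false] <;> infer_instance

lemma radii_mem_endFilter (hε : ε ∈ chartLabels κ) : radii κ ∈ endFilter ε := by
  rcases hε with rfl | ⟨rfl, rfl⟩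
  · rw [endFilter_one]
    filter_upwards [Ioo_mem_nhdsGT Real.pi_pos] with r hr using ⟨hr.1, fun _ => hr.2⟩
  · rw [endFilter_neg_one]
    filter_upwards [Ioo_mem_nhdsLT Real.pi_pos] with r hr using ⟨hr.1, fun _ => hr.2⟩

lemma sk_endPoint (hε : ε ∈ chartLabels κ) : sk κ (endPoint ε) = 0 := by
  rcases hε with rfl | ⟨rfl, rfl⟩
  · rw [endPoint_one, sk_zero]
  · rw [endPoint_neg_one]; exact Real.sin_pi

lemma ck_endPoint (hε : ε ∈ chartLabels κ) : ck κ (endPoint ε) = ε := by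
  rcases hε with rfl | ⟨rfl, rfl⟩
  · rw [endPoint_one, ck_zero]
  · rw [endPoint_neg_one]; exact Real.cos_pi

lemma tendsto_sk_endFilter (hε : ε ∈ chartLabels κ) : Tendsto (sk κ) (endFilter ε) (𝓝 0) := by
  rw [← sk_endPoint hε]
  exact ((continuous_sk κ).tendsto _).mono_left (endFilter_le ε)

lemma tendsto_ck_endFilter (hε : ε ∈ chartLabels κ) : Tendsto (ck κ) (endFilter ε) (𝓝 ε) := by
  conv => rhs; rw [← ck_endPoint hε]
  exact ((continuous_ck κ).tendsto _).mono_left (endFilter_le ε)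

lemma radius_param_zero (hε : ε ∈ chartLabels κ) :
    radius κ (param n κ ε 0) = endPoint ε := by
  have h1 : (param n κ ε 0).1 = ε := by simp [param]
  have h2 : (param n κ ε 0).2 = 0 := by simp [param]
  generalize param n κ ε 0 = p at h1 h2
  rcases hε with rfl | ⟨rfl, rfl⟩
  · rw [endPoint_one]
    rcases κ with _ | _ | _ <;> simp [radius, h1, h2]
  · rw [endPoint_neg_one]
    change Real.arccos p.1 = _
    rw [h1, Real.arccos_neg_one]

lemma eventually_punctured (n : ℕ) (κ : SignType) :
    ∀ᶠ x in 𝓝[≠] (0 : Coord n), x ∈ punctured n κ := by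
  filter_upwards [self_mem_nhdsWithin, nhdsWithin_le_nhds
    ((isOpen_chartDomain n κ).mem_nhds (zero_mem_chartDomain n κ))] with x h1 h2 using ⟨h2, h1⟩

lemma tendsto_radius (hε : ε ∈ chartLabels κ) :
    Tendsto (fun x => radius κ (param n κ ε x)) (𝓝[≠] 0) (endFilter ε) := by
  have h1 : Tendsto (fun x => radius κ (param n κ ε x)) (𝓝[≠] 0) (𝓝 (endPoint ε)) := by
    rw [← radius_param_zero hε]
    exact (((continuousOn_radius n κ ε).continuousAt
      ((isOpen_chartDomain n κ).mem_nhds (zero_mem_chartDomain n κ))).tendsto).mono_left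
      nhdsWithin_le_nhds
  have h2 : ∀ᶠ x in 𝓝[≠] (0 : Coord n), radius κ (param n κ ε x) ∈ radii κ := by
    filter_upwards [eventually_punctured n κ] with x hx using radius_mem hε hx.1 hx.2
  rcases hε with rfl | ⟨rfl, rfl⟩
  · rw [endFilter_one]; rw [endPoint_one] at h1
    exact tendsto_nhdsWithin_iff.2 ⟨h1, h2.mono fun x hx => hx.1⟩
  · rw [endFilter_neg_one]; rw [endPoint_neg_one] at h1
    exact tendsto_nhdsWithin_iff.2 ⟨h1, h2.mono fun x hx => hx.2 rfl⟩

lemma one_add_label_mul_self_ne {ε : ℝ} (hε : ε ∈ chartLabels κ) : 1 + ε * ε ≠ 0 := by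
  have := label_sq hε
  nlinarith

lemma tendsto_ray (he : ‖e‖ = 1) (hε : ε ∈ chartLabels κ) :
    Tendsto (ray κ ε e) (endFilter ε) (𝓝[≠] 0) := by
  refine tendsto_nhdsWithin_iff.2 ⟨?_, ?_⟩
  · have h : Tendsto (ray κ ε e) (endFilter ε) (𝓝 ((2 * 0 / (1 + ε * ε)) • e)) :=
      ((((tendsto_sk_endFilter hε).const_mul 2).div
        (((tendsto_ck_endFilter hε).const_mul ε).const_add 1) (one_add_label_mul_self_ne hε))).smul_const e
    simpa using h
  · filter_upwards [radii_mem_endFilter hε] with r hr using (ray_mem he hε hr).2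

lemma exists_unit (hn : n ≠ 0) : ∃ e : Coord n, ‖e‖ = 1 :=
  ⟨EuclideanSpace.single ⟨0, Nat.pos_of_ne_zero hn⟩ 1, by simp⟩

end Rays

/-! ### Profiles of radial functions -/

section Profiles

variable {n : ℕ} {κ : SignType} {ε : ℝ} {x : Coord n} {f : ℝ → ℝ} {k : ℕ}

lemma contDiffOn_profile (hn : n ≠ 0) (hf : IsCk κ k (radial n κ f)) :
    ContDiffOn ℝ k f (radii κ) := by
  obtain ⟨e, he⟩ := exists_unit hn
  have h1 : (1 : ℝ) ∈ chartLabels κ := Or.inl rfl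
  have h := (hf 1 h1).comp (contDiffOn_ray (e := e) h1) fun r hr => (ray_mem he h1 hr).1
  refine h.congr fun r hr => ?_
  simp only [Function.comp, radial, radius_ray he h1 hr]

lemma tendsto_profile (hn : n ≠ 0) (hε : ε ∈ chartLabels κ) (hf : IsCk κ k (radial n κ f)) :
    Tendsto f (endFilter ε) (𝓝 (f (endPoint ε))) := by
  obtain ⟨e, he⟩ := exists_unit hn
  have h1 := ((hf ε hε).continuousOn.continuousAt
      ((isOpen_chartDomain n κ).mem_nhds (zero_mem_chartDomain n κ))).tendsto
  have h2 := h1.comp ((tendsto_ray he hε).mono_right nhdsWithin_le_nhds)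
  simp only [radial, radius_param_zero hε] at h2
  refine h2.congr' ?_
  filter_upwards [radii_mem_endFilter hε] with r hr
  simp only [Function.comp, radius_ray he hε hr]

lemma pd_radial (hε : ε ∈ chartLabels κ) (hx : x ∈ punctured n κ) {f' : ℝ}
    (hf : HasDerivAt f f' (radius κ (param n κ ε x))) (i : Fin n) :
    pd i (fun y => f (radius κ (param n κ ε y))) x
      = f' * (ε * lam κ x ^ 2 * x i / sk κ (radius κ (param n κ ε x))) := by
  rw [pd_comp hf (differentiableAt_radius hε hx), pd_radius hε hx]

lemma radius_param_neg (hε : ε ∈ chartLabels κ) (hx : x ∈ chartDomain n κ) :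
    radius κ (param n κ ε (-x)) = radius κ (param n κ ε x) := by
  have h1 : (param n κ ε (-x)).1 = (param n κ ε x).1 := by simp [param]
  have h2 : ‖(param n κ ε (-x)).2‖ = ‖(param n κ ε x).2‖ := by simp [param]
  rcases κ with _ | _ | _ <;> simp only [radius, h1, h2]

lemma pd_radial_zero (hε : ε ∈ chartLabels κ) (hf : IsCk κ 1 (radial n κ f)) (i : Fin n) :
    pd i (fun y => f (radius κ (param n κ ε y))) 0 = 0 := by
  have h0 := zero_mem_chartDomain n κ
  have hd : DifferentiableAt ℝ (fun y => f (radius κ (param n κ ε y))) 0 :=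
    ContDiffOn.differentiableAt' (isOpen_chartDomain n κ) one_ne_zero (hf ε hε) h0
  set F := fun y => f (radius κ (param n κ ε y)) with hF
  have h2 : HasFDerivAt (fun y : Coord n => F (-y)) (-(fderiv ℝ F 0)) 0 := by
    have h3 : HasFDerivAt F (fderiv ℝ F 0) (-0) := by rw [neg_zero]; exact hd.hasFDerivAt
    have h4 := h3.comp (0 : Coord n) (hasFDerivAt_id (0 : Coord n)).neg
    refine h4.congr_fderiv ?_
    ext v; simp
  have h5 : F =ᶠ[𝓝 0] fun y => F (-y) := by
    filter_upwards [(isOpen_chartDomain n κ).mem_nhds h0] with y hy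
    simp only [hF, radius_param_neg hε hy]
  have h6 : fderiv ℝ F 0 = -(fderiv ℝ F 0) := by
    conv_lhs => rw [h5.fderiv_eq, h2.fderiv]
  have h7 := congrArg (fun L => L (EuclideanSpace.single i 1)) h6
  simp only [neg_apply] at h7
  rw [pd]
  linarith

lemma continuousOn_pd {F : Coord n → ℝ} {s : Set (Coord n)} (hs : IsOpen s)
    (hF : ContDiffOn ℝ 1 F s) (i : Fin n) : ContinuousOn (pd i F) s :=
  (contDiffOn_pd (k := 0) hs (by simpa using hF) i).continuousOn

lemma IsCk.of_le {l : ℕ} (h : k ≤ l) {g : Ambient n → ℝ} (hg : IsCk κ l g) : IsCk κ k g :=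
  fun ε hε => (hg ε hε).of_le (by exact_mod_cast h)

lemma hasDerivAt_profile (hn : n ≠ 0) (hk : k ≠ 0) (hf : IsCk κ k (radial n κ f)) {r : ℝ}
    (hr : r ∈ radii κ) : HasDerivAt f (deriv f r) r :=
  (((contDiffOn_profile hn hf).contDiffAt ((isOpen_radii κ).mem_nhds hr)).differentiableAt
    (by exact_mod_cast hk)).hasDerivAt

lemma sum_sq_div_sk (hε : ε ∈ chartLabels κ) (hx : x ∈ punctured n κ) :
    ∑ i, (ε * lam κ x ^ 2 * x i / sk κ (radius κ (param n κ ε x))) ^ 2 = lam κ x ^ 2 := by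
  have hl := lam_ne hx.1
  have hn := norm_ne_zero_iff.2 hx.2
  rw [sk_radius hε hx.1]
  have : ∀ i, (ε * lam κ x ^ 2 * x i / (lam κ x * ‖x‖)) ^ 2
      = (ε ^ 2 * lam κ x ^ 2 / ‖x‖ ^ 2) * x i ^ 2 := fun i => by field_simp
  simp only [this, ← Finset.mul_sum, ← norm_sq_eq, label_sq hε]
  field_simp

/-- The profile of a `C¹` radial function has derivative tending to `0` at both centres, because
the symmetry `x ↦ -x` forces the gradient to vanish there. -/
lemma tendsto_deriv_profile (hn : n ≠ 0) (hε : ε ∈ chartLabels κ)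
    (hf : IsCk κ 1 (radial n κ f)) : Tendsto (deriv f) (endFilter ε) (𝓝 0) := by
  obtain ⟨e, he⟩ := exists_unit hn
  have hO := isOpen_chartDomain n κ
  have h0 := hO.mem_nhds (zero_mem_chartDomain n κ)
  set F : Coord n → ℝ := fun y => f (radius κ (param n κ ε y)) with hF
  set D : Coord n → ℝ := fun y => (∑ i, pd i F y ^ 2) / lam κ y ^ 2 with hD
  have hc : ContinuousAt D 0 := by
    refine ContinuousAt.div ?_ ?_ (pow_ne_zero _ (lam_ne (zero_mem_chartDomain n κ)))
    · refine tendsto_finsetSum _ fun i _ => ContinuousAt.pow ?_ 2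
      exact (continuousOn_pd hO (hf ε hε) i).continuousAt h0
    · exact ((contDiffOn_lam (k := 0)).continuousOn.continuousAt h0).pow 2
  have hD0 : D 0 = 0 := by
    simp only [hD, hF, pd_radial_zero hε hf]
    simp
  have h1 := hc.tendsto.comp ((tendsto_ray he hε).mono_right nhdsWithin_le_nhds)
  rw [hD0] at h1
  have h2 : Tendsto (fun r => deriv f r ^ 2) (endFilter ε) (𝓝 0) := by
    refine h1.congr' ?_
    filter_upwards [radii_mem_endFilter hε] with r hr
    have hx := ray_mem he hε hr
    have hd := hasDerivAt_profile hn one_ne_zero hf hr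
    rw [← radius_ray he hε hr] at hd
    have hl := lam_ne hx.1
    have h4 : ∀ i, pd i F (ray κ ε e r) ^ 2 = _ := fun i => by
      rw [hF, pd_radial hε hx hd, mul_pow]
    simp only [Function.comp, hD, h4, ← Finset.mul_sum, sum_sq_div_sk hε hx]
    rw [radius_ray he hε hr]
    field_simp
  have h3 := (Real.continuous_sqrt.tendsto 0).comp h2
  rw [Real.sqrt_zero] at h3
  refine (tendsto_zero_iff_abs_tendsto_zero _).2 (h3.congr fun r => ?_)
  simp only [Function.comp, Real.sqrt_sq_eq_abs]

lemma continuousOn_laplacian (hε : ε ∈ chartLabels κ) {F : Coord n → ℝ}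
    (hF : ContDiffOn ℝ 2 F (chartDomain n κ)) :
    ContinuousOn (laplacian (metric n κ ε) F) (chartDomain n κ) := by
  have hO := isOpen_chartDomain n κ
  have h : ContinuousOn (fun x => (lam κ x ^ 2)⁻¹ * ((∑ i, pd i (pd i F) x)
      + ((n : ℝ) - 2) * ∑ i, dlog κ i x * pd i F x)) (chartDomain n κ) := by
    have h1 : ∀ i, ContDiffOn ℝ 1 (pd i F) (chartDomain n κ) := fun i =>
      contDiffOn_pd (k := 1) hO (by simpa using hF) i
    refine ContinuousOn.mul (((contDiffOn_lam (k := 0)).continuousOn.pow 2).inv₀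
      fun x hx => pow_ne_zero _ (lam_ne hx)) (ContinuousOn.add ?_ (continuousOn_const.mul ?_))
    · exact continuousOn_finsetSum _ fun i _ => continuousOn_pd hO (h1 i) i
    · exact continuousOn_finsetSum _ fun i _ =>
        ((contDiffOn_dlog (k := 0) i).continuousOn).mul (h1 i).continuousOn
  exact h.congr fun x hx => laplacian_eq hε hx F

lemma hasDerivAt_deriv_profile (hn : n ≠ 0) (hk : 2 ≤ k) (hf : IsCk κ k (radial n κ f)) {r : ℝ}
    (hr : r ∈ radii κ) : HasDerivAt (deriv f) (deriv (deriv f) r) r := by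
  have h : ContDiffOn ℝ 1 (deriv f) (radii κ) :=
    (contDiffOn_profile hn hf).deriv_of_isOpen (isOpen_radii κ) (by exact_mod_cast hk)
  exact ((h.contDiffAt ((isOpen_radii κ).mem_nhds hr)).differentiableAt one_ne_zero).hasDerivAt

/-- The Laplacian of a radial function. -/
lemma laplacian_radial (hn : n ≠ 0) (hε : ε ∈ chartLabels κ) (hx : x ∈ punctured n κ)
    (hf : IsCk κ 2 (radial n κ f)) :
    laplacian (metric n κ ε) (fun y => f (radius κ (param n κ ε y))) x
      = deriv (deriv f) (radius κ (param n κ ε x))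
        + meanCurv n κ (radius κ (param n κ ε x)) * deriv f (radius κ (param n κ ε x)) := by
  have hO := isOpen_punctured n κ
  have hr := radius_mem hε hx.1 hx.2
  have hs := sk_ne hr
  have hl := lam_ne hx.1
  have hdl := differentiableAt_lam hx.1
  have hdx := fun j => differentiableAt_coord j x
  -- the function `f' / s_κ` and its derivative
  have hP : HasDerivAt (fun r => deriv f r / sk κ r) _ (radius κ (param n κ ε x)) :=
    (hasDerivAt_deriv_profile hn le_rfl hf hr).div (hasDerivAt_sk κ _) hs
  have hdP : DifferentiableAt ℝ (fun y => deriv f (radius κ (param n κ ε y))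
      / sk κ (radius κ (param n κ ε y))) x :=
    DifferentiableAt.comp (g := fun r => deriv f r / sk κ r) x hP.differentiableAt
      (differentiableAt_radius hε hx)
  have h1 : ∀ i, EqOn (pd i fun y => f (radius κ (param n κ ε y)))
      (fun y => (deriv f (radius κ (param n κ ε y)) / sk κ (radius κ (param n κ ε y)))
        * ((ε * (lam κ y * lam κ y)) * y i)) (punctured n κ) := fun i y hy => by
    rw [pd_radial hε hy (hasDerivAt_profile hn two_ne_zero hf (radius_mem hε hy.1 hy.2))]
    ring
  have h2 : ∀ i, pd i (pd i fun y => f (radius κ (param n κ ε y))) x = _ := fun i => by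
    rw [pd_congr_of_isOpen hO (h1 i) hx, pd_mul hdP
      (((hdl.fun_mul hdl).const_mul _).fun_mul (hdx i)), pd_radial (f := fun r => deriv f r / sk κ r)
      hε hx hP, pd_mul ((hdl.fun_mul hdl).const_mul _) (hdx i), pd_const_mul (hdl.fun_mul hdl),
      pd_mul hdl hdl, pd_lam hx.1, pd_coord, if_pos rfl]
  rw [laplacian_eq hε hx.1]
  simp only [h2]
  simp only [fun i => h1 i hx]
  have hsk := sk_radius hε hx.1
  have hck := ck_radius hε hx.1
  have hm := lam_mul hx.1
  have hε2 := label_sq hε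
  have hρ := norm_sq_eq x
  set s := sk κ (radius κ (param n κ ε x))
  set c := ck κ (radius κ (param n κ ε x))
  simp only [dlog, meanCurv]
  set l := lam κ x
  set f1 := deriv f (radius κ (param n κ ε x))
  set f2 := deriv (deriv f) (radius κ (param n κ ε x))
  have e1 : ∀ i, (f2 * s - f1 * c) / s ^ 2 * (ε * l ^ 2 * x i / s) * (ε * (l * l) * x i)
      + f1 / s * (ε * (-((κ : ℝ) / 2) * l * x i * l * l + l * (-((κ : ℝ) / 2) * l * x i * l)) * x i
        + ε * (l * l) * 1)
      = ((f2 * s - f1 * c) / s ^ 2 * (ε ^ 2 * l ^ 4 / s) - f1 / s * ε * κ * l ^ 3) * x i ^ 2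
        + f1 / s * ε * l ^ 2 := fun i => by ring
  have e2 : ∀ i, -((κ : ℝ) / 2) * l * x i * (f1 / s * (ε * (l * l) * x i))
      = (-((κ : ℝ) / 2) * l ^ 3 * ε * f1 / s) * x i ^ 2 := fun i => by ring
  simp only [e1, e2, Finset.sum_add_distrib, ← Finset.mul_sum, ← hρ, Finset.sum_const,
    Finset.card_univ, Fintype.card_fin, nsmul_eq_mul]
  have hs2 : l ^ 2 * ‖x‖ ^ 2 = s ^ 2 := by rw [hsk]; ring
  have hc2 : ε * (1 - (κ : ℝ) / 2 * l * ‖x‖ ^ 2) = c := by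
    rw [hck]; linear_combination (-2 * ε) * hm
  rw [inv_mul_eq_iff_eq_mul₀ (pow_ne_zero 2 hl)]
  have hA : (f2 * s - f1 * c) / s ^ 2 / s * s ^ 2 = f2 - f1 * c / s := by field_simp
  linear_combination ((f2 * s - f1 * c) / s ^ 2 / s * ε ^ 2 * l ^ 2) * hs2
    + ((f2 * s - f1 * c) / s ^ 2 / s * l ^ 2 * s ^ 2) * hε2 + (f1 / s * l ^ 2 * n) * hc2 + l ^ 2 * hA

lemma tendsto_laplacian_profile (hn : n ≠ 0) (hε : ε ∈ chartLabels κ)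
    (hf : IsCk κ 2 (radial n κ f)) :
    ∃ c, Tendsto (fun r => deriv (deriv f) r + meanCurv n κ r * deriv f r) (endFilter ε) (𝓝 c) := by
  obtain ⟨e, he⟩ := exists_unit hn
  have h0 := (isOpen_chartDomain n κ).mem_nhds (zero_mem_chartDomain n κ)
  have h1 := ((continuousOn_laplacian hε (hf ε hε)).continuousAt h0).tendsto.comp
    ((tendsto_ray he hε).mono_right nhdsWithin_le_nhds)
  refine ⟨_, h1.congr' ?_⟩
  filter_upwards [radii_mem_endFilter hε] with r hr
  have := laplacian_radial hn hε (ray_mem he hε hr) hf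
  rw [radius_ray he hε hr] at this
  exact this

end Profiles

/-! ### Radial 1-forms -/

section RadialForms

variable {n : ℕ} {κ : SignType} {ε : ℝ} {x : Coord n} {B k : ℝ → ℝ}

/-- The radial 1-form `s_κ(r) B(r) dr` on `M_κ`, as a restriction of linear forms on the ambient
space: `s_κ dr` is the restriction of `t ⟨x, dx⟩ - κ² |x|² dt`. -/
def radialForm (n : ℕ) (κ : SignType) (B : ℝ → ℝ) (p : Ambient n) : Ambient n →L[ℝ] ℝ :=
  B (radius κ p) • (p.1 • (innerSL ℝ p.2).comp (ContinuousLinearMap.snd ℝ ℝ (Coord n))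
    - ((κ : ℝ) ^ 2 * ‖p.2‖ ^ 2) • ContinuousLinearMap.fst ℝ ℝ (Coord n))

lemma formComp_radialForm (hx : x ∈ chartDomain n κ) (i : Fin n) :
    formComp κ ε (radialForm n κ B) x i
      = ε * B (radius κ (param n κ ε x)) * lam κ x ^ 2 * x i := by
  have h : (radialForm n κ B (param n κ ε x)) (coordVec n κ ε x i)
      = B (radius κ (param n κ ε x)) * ((param n κ ε x).1 *
        inner ℝ (param n κ ε x).2 (coordVec n κ ε x i).2
        - (κ : ℝ) ^ 2 * ‖(param n κ ε x).2‖ ^ 2 * (coordVec n κ ε x i).1) := by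
    simp [radialForm]
  rw [formComp, h, coordVec_fst hx, coordVec_snd hx, norm_param_snd hx, param_fst hx, param_snd]
  simp only [inner_sub_right, inner_smul_left, inner_smul_right,
    EuclideanSpace.inner_single_right, real_inner_self_eq_norm_sq, conj_trivial]
  have h1 := lam_mul hx
  have h2 := lam_sq_identity hx
  have h3 := cast_cube κ
  set b := B (radius κ (param n κ ε x))
  set l := lam κ x
  set q := (κ : ℝ)
  linear_combination (-2 * b * ε * (2 * l - 1) * l ^ 2 * x i) * h1
    + (b * ε * l ^ 2 * x i) * h2 + (b * ε * l ^ 2 * x i * l ^ 2 * ‖x‖ ^ 2) * h3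

lemma isRadialForm_radialForm {u : ℝ → ℝ} (hu : ∀ r ∈ radii κ, u r = sk κ r * B r) :
    IsRadialForm κ u (radialForm n κ B) := by
  intro ε hε x hx hx0 i
  have hr := radius_mem hε hx hx0
  have hs := sk_ne hr
  rw [formComp_radialForm hx, hu _ hr, pd_radius hε ⟨hx, hx0⟩]
  field_simp

lemma pd_radial_component (hε : ε ∈ chartLabels κ) (hx : x ∈ punctured n κ)
    {W : Coord n → Fin n → ℝ} {b : ℝ} (hB : HasDerivAt B b (radius κ (param n κ ε x)))
    (hW : ∀ y ∈ punctured n κ, ∀ i, W y i = ε * B (radius κ (param n κ ε y)) * lam κ y ^ 2 * y i)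
    (i j : Fin n) :
    pd i (fun y => W y j) x = b / sk κ (radius κ (param n κ ε x)) * lam κ x ^ 4 * x i * x j
      + ε * B (radius κ (param n κ ε x)) * lam κ x ^ 2
        * (2 * dlog κ i x * x j + if i = j then 1 else 0) := by
  have hdl := differentiableAt_lam hx.1
  have hdx := fun j => differentiableAt_coord j x
  have hdB : DifferentiableAt ℝ (fun y => B (radius κ (param n κ ε y))) x :=
    DifferentiableAt.comp (g := B) x hB.differentiableAt (differentiableAt_radius hε hx)
  have h1 : EqOn (fun y => W y j) (fun y => B (radius κ (param n κ ε y))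
      * ((ε * (lam κ y * lam κ y)) * y j)) (punctured n κ) := fun y hy => by
    simp only [hW y hy]; ring
  rw [pd_congr_of_isOpen (isOpen_punctured n κ) h1 hx, pd_mul hdB
      (((hdl.fun_mul hdl).const_mul _).fun_mul (hdx j)), pd_radial hε hx hB,
      pd_mul ((hdl.fun_mul hdl).const_mul _) (hdx j), pd_const_mul (hdl.fun_mul hdl),
      pd_mul hdl hdl, pd_lam hx.1, pd_coord]
  linear_combination (b / sk κ (radius κ (param n κ ε x)) * lam κ x ^ 4 * x i * x j) * label_sq hε

/-- The conformal Killing operator on the radial form `s_κ B dr`, where `B' = k / 2`. -/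
lemma confKilling_radial (hn : n ≠ 0) (hε : ε ∈ chartLabels κ) (hx : x ∈ punctured n κ)
    {W : Coord n → Fin n → ℝ}
    (hB : HasDerivAt B (k (radius κ (param n κ ε x)) / 2) (radius κ (param n κ ε x)))
    (hW : ∀ y ∈ punctured n κ, ∀ i, W y i = ε * B (radius κ (param n κ ε y)) * lam κ y ^ 2 * y i)
    (i j : Fin n) :
    confKilling (metric n κ ε) W x i j = k (radius κ (param n κ ε x))
      / sk κ (radius κ (param n κ ε x)) * lam κ x ^ 4
      * (x i * x j - ‖x‖ ^ 2 / n * if i = j then 1 else 0) := by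
  have hn' : (n : ℝ) ≠ 0 := by exact_mod_cast hn
  have h4 : (if j = i then (1 : ℝ) else 0) = if i = j then 1 else 0 := by simp [eq_comm]
  rw [confKilling_eq hn hε hx.1]
  simp only [pd_radial_component hε hx hB hW, hW x hx, if_true, h4]
  set d : ℝ := if i = j then 1 else 0
  set b := B (radius κ (param n κ ε x))
  set s := sk κ (radius κ (param n κ ε x))
  set K := k (radius κ (param n κ ε x))
  have e1 : ∀ p, K / 2 / s * lam κ x ^ 4 * x p * x p
      + ε * b * lam κ x ^ 2 * (2 * dlog κ p x * x p + 1)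
      = (K / 2 / s * lam κ x ^ 4) * x p ^ 2 + (2 * (ε * b * lam κ x ^ 2)) * (dlog κ p x * x p)
        + ε * b * lam κ x ^ 2 := fun p => by ring
  have e2 : ∀ p, dlog κ p x * (ε * b * lam κ x ^ 2 * x p)
      = (ε * b * lam κ x ^ 2) * (dlog κ p x * x p) := fun p => by ring
  simp only [e1, e2, Finset.sum_add_distrib, ← Finset.mul_sum, ← norm_sq_eq, Finset.sum_const,
    Finset.card_univ, Fintype.card_fin, nsmul_eq_mul]
  field_simp
  ring

lemma sum_sq_traceless (hn : n ≠ 0) (x : Coord n) :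
    ∑ i, ∑ j, (x i * x j - ‖x‖ ^ 2 / n * if i = j then 1 else 0) ^ 2
      = ((n : ℝ) - 1) / n * ‖x‖ ^ 4 := by
  have hn' : (n : ℝ) ≠ 0 := by exact_mod_cast hn
  have e : ∀ i j, (x i * x j - ‖x‖ ^ 2 / n * if i = j then 1 else 0) ^ 2
      = x i ^ 2 * x j ^ 2 - (if i = j then 2 * (‖x‖ ^ 2 / n) * (x i * x j) else 0)
        + (if i = j then (‖x‖ ^ 2 / n) ^ 2 else 0) := fun i j => by split_ifs <;> ring
  simp only [e, Finset.sum_add_distrib, Finset.sum_sub_distrib, ← Finset.mul_sum,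
    ← Finset.sum_mul, ← norm_sq_eq, Finset.sum_ite_eq, Finset.mem_univ, if_true, ← sq,
    Finset.sum_const, Finset.card_univ, Fintype.card_fin, nsmul_eq_mul]
  field_simp
  ring

lemma normSq_confKilling_radial (hn : n ≠ 0) (hε : ε ∈ chartLabels κ) (hx : x ∈ punctured n κ)
    {W : Coord n → Fin n → ℝ}
    (hB : HasDerivAt B (k (radius κ (param n κ ε x)) / 2) (radius κ (param n κ ε x)))
    (hW : ∀ y ∈ punctured n κ, ∀ i, W y i = ε * B (radius κ (param n κ ε y)) * lam κ y ^ 2 * y i) :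
    normSq₂ (metric n κ ε) x (confKilling (metric n κ ε) W x)
      = ((n : ℝ) - 1) / n
        * (k (radius κ (param n κ ε x)) * sk κ (radius κ (param n κ ε x))) ^ 2 := by
  have hn' : (n : ℝ) ≠ 0 := by exact_mod_cast hn
  have hl := lam_ne hx.1
  have hs := sk_ne (radius_mem hε hx.1 hx.2)
  rw [normSq₂_eq hε hx.1]
  simp only [confKilling_radial hn hε hx hB hW, mul_pow, ← Finset.mul_sum]
  rw [sum_sq_traceless hn]
  have hs4 : sk κ (radius κ (param n κ ε x)) ^ 4 = lam κ x ^ 4 * ‖x‖ ^ 4 := by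
    rw [sk_radius hε hx.1]; ring
  field_simp
  rw [hs4]
  ring

lemma pd_radial_traceless {K : ℝ → ℝ} {K' : ℝ} (hε : ε ∈ chartLabels κ)
    (hx : x ∈ punctured n κ) (hK : HasDerivAt K K' (radius κ (param n κ ε x))) (j l : Fin n) :
    pd l (fun y => K (radius κ (param n κ ε y)) * lam κ y ^ 4
        * (y l * y j - ‖y‖ ^ 2 / n * if l = j then 1 else 0)) x
      = (K' * (ε * lam κ x ^ 2 * x l / sk κ (radius κ (param n κ ε x))) * lam κ x ^ 4
        + K (radius κ (param n κ ε x)) * (4 * dlog κ l x * lam κ x ^ 4))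
          * (x l * x j - ‖x‖ ^ 2 / n * if l = j then 1 else 0)
        + K (radius κ (param n κ ε x)) * lam κ x ^ 4
          * (x j + (if l = j then x l else 0) - 2 / n * if l = j then x l else 0) := by
  have hdl := differentiableAt_lam hx.1
  have hdx := fun j => differentiableAt_coord j x
  have hdK : DifferentiableAt ℝ (fun y => K (radius κ (param n κ ε y))) x :=
    DifferentiableAt.comp (g := K) x hK.differentiableAt (differentiableAt_radius hε hx)
  have hl2 := hdl.fun_mul hdl
  have hq : ∀ p, pd p (fun y : Coord n => ‖y‖ ^ 2) x = 2 * x p := fun p => by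
    have : (fun y : Coord n => ‖y‖ ^ 2) = fun y => ∑ j, y j * y j := by
      funext y; rw [norm_sq_eq]; simp only [sq]
    rw [this, pd_sum (fun j _ => (hdx j).fun_mul (hdx j))]
    simp only [fun j => pd_mul (hdx j) (hdx j) p, pd_coord]
    simp [Finset.sum_add_distrib]
    ring
  have hdq : DifferentiableAt ℝ (fun y : Coord n => ‖y‖ ^ 2) x :=
    (contDiff_norm_sq ℝ (n := 1)).differentiable one_ne_zero x
  have h1 : (fun y => K (radius κ (param n κ ε y)) * lam κ y ^ 4
        * (y l * y j - ‖y‖ ^ 2 / n * if l = j then 1 else 0))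
      = fun y => (K (radius κ (param n κ ε y)) * ((lam κ y * lam κ y) * (lam κ y * lam κ y)))
        * (y l * y j - ‖y‖ ^ 2 * (1 / n * if l = j then 1 else 0)) := by
    funext y; ring
  rw [h1, pd_mul (hdK.fun_mul (hl2.fun_mul hl2)) (((hdx l).fun_mul (hdx j)).fun_sub
    (hdq.mul_const _)), pd_mul hdK (hl2.fun_mul hl2), pd_mul hl2 hl2, pd_mul hdl hdl, pd_lam hx.1,
    pd_radial hε hx hK, pd_sub ((hdx l).fun_mul (hdx j)) (hdq.mul_const _),
    pd_mul (hdx l) (hdx j), pd_mul_const hdq, hq, pd_coord, pd_coord, if_pos rfl]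
  split_ifs <;> ring

/-- The divergence of the conformal Killing operator on the radial form `s_κ B dr`, where
`B' = k / 2`. -/
lemma div₂_confKilling_radial (hn : n ≠ 0) (hε : ε ∈ chartLabels κ) (hx : x ∈ punctured n κ)
    {W : Coord n → Fin n → ℝ} {k' : ℝ}
    (hB : ∀ r ∈ radii κ, HasDerivAt B (k r / 2) r)
    (hk : HasDerivAt k k' (radius κ (param n κ ε x)))
    (hW : ∀ y ∈ punctured n κ, ∀ i, W y i = ε * B (radius κ (param n κ ε y)) * lam κ y ^ 2 * y i)
    (j : Fin n) :
    div₂ (metric n κ ε) (confKilling (metric n κ ε) W) x j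
      = ε * lam κ x ^ 2 * x j * (((n : ℝ) - 1) / n) * (k' + (n + 1)
        * (ck κ (radius κ (param n κ ε x)) / sk κ (radius κ (param n κ ε x)))
          * k (radius κ (param n κ ε x))) := by
  have hn' : (n : ℝ) ≠ 0 := by exact_mod_cast hn
  have hl := lam_ne hx.1
  have hr := radius_mem hε hx.1 hx.2
  have hs := sk_ne hr
  have hK : HasDerivAt (fun r => k r / sk κ r) _ (radius κ (param n κ ε x)) :=
    hk.div (hasDerivAt_sk κ _) hs
  have hT : ∀ i j, EqOn (fun y => confKilling (metric n κ ε) W y i j)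
      (fun y => (fun r => k r / sk κ r) (radius κ (param n κ ε y)) * lam κ y ^ 4
        * (y i * y j - ‖y‖ ^ 2 / n * if i = j then 1 else 0)) (punctured n κ) := fun i j y hy =>
    confKilling_radial hn hε hy (hB _ (radius_mem hε hy.1 hy.2)) hW i j
  rw [div₂_eq hε hx.1 _ (confKilling_symm W hn hε hx.1) (confKilling_trace W hn hε hx.1)]
  have hp : ∀ i, pd i (fun y => confKilling (metric n κ ε) W y i j) x = _ := fun i => by
    rw [pd_congr_of_isOpen (isOpen_punctured n κ) (hT i j) hx,
      pd_radial_traceless hε hx hK j i]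
  simp only [hp, fun i => hT i j hx]
  have hsk := sk_radius hε hx.1
  have hck := ck_radius hε hx.1
  have hm := lam_mul hx.1
  have hε2 := label_sq hε
  set s := sk κ (radius κ (param n κ ε x))
  set c := ck κ (radius κ (param n κ ε x))
  set K := k (radius κ (param n κ ε x))
  simp only [dlog]
  set l := lam κ x
  have hs2 : l ^ 2 * ‖x‖ ^ 2 = s ^ 2 := by rw [hsk]; ring
  have hc2 : ε * (1 - (κ : ℝ) / 2 * l * ‖x‖ ^ 2) = c := by
    rw [hck]; linear_combination (-2 * ε) * hm
  have e1 : ∀ i, ((k' * s - K * c) / s ^ 2 * (ε * l ^ 2 * x i / s) * l ^ 4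
      + K / s * (4 * (-((κ : ℝ) / 2) * l * x i) * l ^ 4))
          * (x i * x j - ‖x‖ ^ 2 / n * if i = j then 1 else 0)
        + K / s * l ^ 4
          * (x j + (if i = j then x i else 0) - 2 / n * if i = j then x i else 0)
      = ((k' * s - K * c) / s ^ 2 * (ε * l ^ 2 / s) * l ^ 4
      + K / s * (4 * (-((κ : ℝ) / 2) * l) * l ^ 4)) * (x i ^ 2 * x j
          - ‖x‖ ^ 2 / n * if i = j then x i else 0)
        + K / s * l ^ 4
          * (x j + (if i = j then x i else 0) - 2 / n * if i = j then x i else 0) := fun i => by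
    split_ifs <;> ring
  have e2 : ∀ i, -((κ : ℝ) / 2) * l * x i * (K / s * l ^ 4
      * (x i * x j - ‖x‖ ^ 2 / n * if i = j then 1 else 0))
      = -((κ : ℝ) / 2) * l * (K / s * l ^ 4) * (x i ^ 2 * x j
          - ‖x‖ ^ 2 / n * if i = j then x i else 0) := fun i => by
    split_ifs <;> ring
  simp only [e1, e2, Finset.sum_add_distrib, Finset.sum_sub_distrib, ← Finset.mul_sum,
    ← Finset.sum_mul, ← norm_sq_eq, Finset.sum_const, Finset.sum_ite_eq', Finset.mem_univ, if_true,
    Finset.card_univ, Fintype.card_fin, nsmul_eq_mul]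
  rw [inv_mul_eq_iff_eq_mul₀ (pow_ne_zero 2 hl)]
  have hA : (k' * s - K * c) / s ^ 2 / s * s ^ 2 = k' - K * c / s := by field_simp
  have hN : ((n : ℝ) - 1) / n * n = n - 1 := by field_simp
  have hN' : ‖x‖ ^ 2 * x j - ‖x‖ ^ 2 / n * x j = ((n : ℝ) - 1) / n * ‖x‖ ^ 2 * x j := by
    field_simp
  have hN2 : (n : ℝ) * x j + x j - 2 / n * x j = ((n : ℝ) - 1) / n * (n + 2) * x j := by
    field_simp; ring
  rw [hN', hN2]
  set a := ((n : ℝ) - 1) / n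
  linear_combination ((k' * s - K * c) / s ^ 2 / s * ε * l ^ 4 * a * x j) * hs2
    + (l ^ 4 * ε * a * x j) * hA + (K / s * l ^ 4 * (n + 2) * a * x j * ε) * hc2
    - (K / s * l ^ 4 * (n + 2) * a * x j * (1 - (κ : ℝ) / 2 * l * ‖x‖ ^ 2)) * hε2

end RadialForms

/-! ### Regularity of radial 1-forms at the centres of the charts -/

section Regularity

variable {n : ℕ} {κ : SignType} {ε : ℝ} {x : Coord n} {B k : ℝ → ℝ}

lemma contDiffOn_succ_of_pd {F : Coord n → ℝ} {s : Set (Coord n)} (hs : IsOpen s) {m : ℕ}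
    (hF : DifferentiableOn ℝ F s) (hp : ∀ i, ContDiffOn ℝ m (pd i F) s) :
    ContDiffOn ℝ (m + 1) F s := by
  rw [contDiffOn_succ_iff_fderiv_of_isOpen hs]
  refine ⟨hF, by simp, ?_⟩
  have h : ContDiffOn ℝ m (fun x => ∑ i, pd i F x • (EuclideanSpace.proj i : Coord n →L[ℝ] ℝ)) s :=
    ContDiffOn.sum fun i _ => (hp i).smul contDiffOn_const
  exact h.congr fun x _ => fderiv_eq_sum_pd x

/-- A function that is `C¹` away from the origin, with partial derivatives that tend to `0` there,
is `C¹` if it is differentiable at the origin with derivative `0`. -/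
lemma contDiffOn_one_of_punctured {F : Coord n → ℝ}
    (hF : ContDiffOn ℝ 1 F (punctured n κ)) (h0 : HasFDerivAt F (0 : Coord n →L[ℝ] ℝ) 0)
    (hd : ∀ i, Tendsto (pd i F) (𝓝[≠] 0) (𝓝 0)) : ContDiffOn ℝ 1 F (chartDomain n κ) := by
  have hO := isOpen_punctured n κ
  have hdiff : DifferentiableOn ℝ F (chartDomain n κ) := fun x hx => by
    by_cases hx0 : x = 0
    · rw [hx0]; exact h0.differentiableAt.differentiableWithinAt
    · exact (ContDiffOn.differentiableAt' (k := 1) hO one_ne_zero hF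
        ⟨hx, hx0⟩).differentiableWithinAt
  have h := contDiffOn_succ_of_pd (m := 0) (isOpen_chartDomain n κ) hdiff fun i => by
    rw [Nat.cast_zero, contDiffOn_zero]
    intro x hx
    refine ContinuousAt.continuousWithinAt ?_
    by_cases hx0 : x = 0
    · rw [hx0, continuousAt_iff_punctured_nhds, pd_eq_of_hasFDerivAt h0]
      exact hd i
    · exact (continuousOn_pd hO hF i).continuousAt (hO.mem_nhds ⟨hx, hx0⟩)
  simpa using h

/-- The component `λ xᵢ / s_κ(r)` of a unit vector is bounded. -/
lemma abs_component_le (hε : ε ∈ chartLabels κ) (hx : x ∈ punctured n κ) (i : Fin n) :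
    |lam κ x * x i / sk κ (radius κ (param n κ ε x))| ≤ 1 := by
  have hl := lam_pos hx.1
  have hn : 0 < ‖x‖ := norm_pos_iff.2 hx.2
  rw [sk_radius hε hx.1, abs_div, abs_mul, abs_mul, abs_of_pos hl, abs_norm]
  refine div_le_one_of_le₀ ?_ (by positivity)
  have := PiLp.norm_apply_le x i
  rw [Real.norm_eq_abs] at this
  gcongr

lemma tendsto_lam_zero (n : ℕ) (κ : SignType) : Tendsto (lam (n := n) κ) (𝓝[≠] 0) (𝓝 1) := by
  have h := ((contDiffOn_lam (n := n) (κ := κ) (k := 0)).continuousOn.continuousAt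
    ((isOpen_chartDomain n κ).mem_nhds (zero_mem_chartDomain n κ))).tendsto
  have h0 : lam κ (0 : Coord n) = 1 := by simp [lam]
  rw [h0] at h
  exact h.mono_left nhdsWithin_le_nhds

lemma tendsto_mul_abs_le_one {ι : Type*} {l : Filter ι} {f g : ι → ℝ} (hf : Tendsto f l (𝓝 0))
    (hg : ∀ᶠ x in l, |g x| ≤ 1) : Tendsto (fun x => f x * g x) l (𝓝 0) := by
  refine squeeze_zero_norm' ?_ (tendsto_zero_iff_norm_tendsto_zero.1 hf)
  filter_upwards [hg] with x hx
  rw [norm_mul]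
  exact mul_le_of_le_one_right (norm_nonneg _) (by simpa using hx)

lemma contDiffOn_comp_radius (hε : ε ∈ chartLabels κ) {f : ℝ → ℝ} {m : ℕ∞ω}
    (hf : ContDiffOn ℝ m f (radii κ)) :
    ContDiffOn ℝ m (fun x => f (radius κ (param n κ ε x))) (punctured n κ) :=
  hf.comp (contDiffOn_radius hε) fun _ hx => radius_mem hε hx.1 hx.2

/-- The function `B(r)` is `C¹` if `B' = k / 2` tends to `0` at the centre of the chart. -/
lemma contDiffOn_one_radial (hε : ε ∈ chartLabels κ)
    (hB : ∀ r ∈ radii κ, HasDerivAt B (k r / 2) r)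
    (hB1 : ContDiffOn ℝ 1 B (radii κ)) (hk : Tendsto k (endFilter ε) (𝓝 0))
    (hB0 : Tendsto (fun r => (B r - B (endPoint ε)) / sk κ r) (endFilter ε) (𝓝 0)) :
    ContDiffOn ℝ 1 (fun x => B (radius κ (param n κ ε x))) (chartDomain n κ) := by
  refine contDiffOn_one_of_punctured (contDiffOn_comp_radius hε hB1) ?_ fun i => ?_
  · rw [hasFDerivAt_iff_isLittleO_nhds_zero, Asymptotics.isLittleO_iff]
    intro c hc
    have h1 := hB0.comp (tendsto_radius (n := n) hε)
    have h2 : ∀ᶠ x in 𝓝[≠] (0 : Coord n), ‖B (radius κ (param n κ ε x)) - B (endPoint ε)‖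
        ≤ c * ‖x‖ := by
      have h3 : ∀ᶠ x in 𝓝[≠] (0 : Coord n), lam κ x < 2 :=
        (tendsto_lam_zero n κ).eventually_lt_const (by norm_num)
      have h4 := (tendsto_zero_iff_norm_tendsto_zero.1 h1).eventually_lt_const (half_pos hc)
      filter_upwards [h3, h4, eventually_punctured n κ] with x h3 h4 hx
      have hs := sk_pos (radius_mem hε hx.1 hx.2)
      simp only [Function.comp, norm_div, Real.norm_of_nonneg hs.le] at h4
      rw [div_lt_iff₀ hs, sk_radius hε hx.1] at h4
      have : lam κ x * ‖x‖ ≤ 2 * ‖x‖ := by gcongr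
      nlinarith
    rw [eventually_nhdsWithin_iff] at h2
    filter_upwards [h2] with x hx
    by_cases hx0 : x = 0
    · simp [hx0]
    · have := hx hx0
      rw [zero_add, radius_param_zero hε]
      simpa using this
  · have h1 := (hk.comp (tendsto_radius (n := n) hε)).mul ((tendsto_lam_zero n κ).const_mul (ε / 2))
    rw [zero_mul] at h1
    refine (tendsto_mul_abs_le_one h1 (g := fun x => lam κ x * x i
      / sk κ (radius κ (param n κ ε x))) ?_).congr' ?_
    · filter_upwards [eventually_punctured n κ] with x hx using abs_component_le hε hx i
    · filter_upwards [eventually_punctured n κ] with x hx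
      rw [pd_radial hε hx (hB _ (radius_mem hε hx.1 hx.2))]
      simp only [Function.comp]
      ring

/-- The components `B(r) xᵢ` of a radial form are `C²` up to the centre of the chart, if
`B' = k / 2` with `k → 0` and `s_κ k' → 0` there. -/
lemma contDiffOn_two_radial (hε : ε ∈ chartLabels κ)
    (hB : ∀ r ∈ radii κ, HasDerivAt B (k r / 2) r) (hk1 : ContDiffOn ℝ 1 k (radii κ))
    (hk : Tendsto k (endFilter ε) (𝓝 0))
    (hk' : Tendsto (fun r => sk κ r * deriv k r) (endFilter ε) (𝓝 0))
    (hB0 : Tendsto (fun r => (B r - B (endPoint ε)) / sk κ r) (endFilter ε) (𝓝 0)) (i : Fin n) :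
    ContDiffOn ℝ 2 (fun x => B (radius κ (param n κ ε x)) * x i) (chartDomain n κ) := by
  have hO := isOpen_chartDomain n κ
  have hOp := isOpen_punctured n κ
  have hR := isOpen_radii κ
  have hB2 : ContDiffOn ℝ 2 B (radii κ) := by
    have h : ContDiffOn ℝ (1 + 1) B (radii κ) := by
      rw [contDiffOn_succ_iff_deriv_of_isOpen hR]
      refine ⟨fun r hr => (hB r hr).differentiableAt.differentiableWithinAt, by simp, ?_⟩
      exact (hk1.div_const 2).congr fun r hr => (hB r hr).deriv
    simpa [one_add_one_eq_two] using h
  set A : Coord n → ℝ := fun x => B (radius κ (param n κ ε x)) with hA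
  have hA1 : ContDiffOn ℝ 1 A (chartDomain n κ) :=
    contDiffOn_one_radial hε hB (hB2.of_le one_le_two) hk hB0
  have hA2 : ContDiffOn ℝ 2 A (punctured n κ) := contDiffOn_comp_radius hε hB2
  have hAd : ∀ x ∈ chartDomain n κ, DifferentiableAt ℝ A x := fun x hx =>
    ContDiffOn.differentiableAt' (k := 1) hO one_ne_zero hA1 hx
  have hdx := fun (x : Coord n) j => differentiableAt_coord j x
  have hA0 : ∀ j, Tendsto (pd j A) (𝓝[≠] 0) (𝓝 0) := fun j => by
    have h1 := (hk.comp (tendsto_radius (n := n) hε)).mul ((tendsto_lam_zero n κ).const_mul (ε / 2))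
    rw [zero_mul] at h1
    refine (tendsto_mul_abs_le_one h1 (g := fun x => lam κ x * x j
      / sk κ (radius κ (param n κ ε x))) ?_).congr' ?_
    · filter_upwards [eventually_punctured n κ] with x hx using abs_component_le hε hx j
    · filter_upwards [eventually_punctured n κ] with x hx
      rw [hA, pd_radial hε hx (hB _ (radius_mem hε hx.1 hx.2))]
      simp only [Function.comp]
      ring
  -- the only second derivatives that could be singular come from `xᵢ ∂ⱼ A`
  have hZ : ∀ j, ContDiffOn ℝ 1 (fun x => x i * pd j A x) (chartDomain n κ) := fun j => by
    have hp1 : ContDiffOn ℝ 1 (pd j A) (punctured n κ) :=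
      contDiffOn_pd (k := 1) hOp (by simpa using hA2) j
    refine contDiffOn_one_of_punctured ((contDiff_coord i).contDiffOn.mul hp1) ?_ fun l => ?_
    · rw [hasFDerivAt_iff_isLittleO_nhds_zero, Asymptotics.isLittleO_iff]
      intro c hc
      have h4 := (tendsto_zero_iff_norm_tendsto_zero.1 (hA0 j)).eventually_lt_const hc
      rw [eventually_nhdsWithin_iff] at h4
      filter_upwards [h4] with x hx
      by_cases hx0 : x = 0
      · simp [hx0]
      · have h5 := hx hx0
        have h6 := PiLp.norm_apply_le x i
        simp only [zero_add, zero_apply, sub_zero, norm_mul, PiLp.zero_apply, zero_mul]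
        calc ‖x i‖ * ‖pd j A x‖ ≤ ‖x‖ * c := by gcongr
          _ = c * ‖x‖ := mul_comm _ _
    · have hkr := hk.comp (tendsto_radius (n := n) hε)
      have hcr := (tendsto_ck_endFilter hε).comp (tendsto_radius (n := n) hε)
      have hkr' := hk'.comp (tendsto_radius (n := n) hε)
      have hl := tendsto_lam_zero n κ
      have hθ : ∀ j, ∀ᶠ x in 𝓝[≠] (0 : Coord n),
          |lam κ x * x j / sk κ (radius κ (param n κ ε x))| ≤ 1 := fun j => by
        filter_upwards [eventually_punctured n κ] with x hx using abs_component_le hε hx j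
      have hx0 : ∀ j, Tendsto (fun x : Coord n => x j) (𝓝[≠] 0) (𝓝 0) := fun j => by
        have := ((contDiff_coord (k := 0) j).continuous.tendsto (0 : Coord n)).mono_left
          (nhdsWithin_le_nhds (s := {0}ᶜ))
        simpa using this
      have t1 : Tendsto (fun x : Coord n => if l = i then pd j A x else 0) (𝓝[≠] 0) (𝓝 0) := by
        by_cases h : l = i
        · simpa [h] using hA0 j
        · simp [h, tendsto_const_nhds]
      have c2 := (((hkr'.sub (hkr.mul hcr)).div_const 2).mul hl)
      rw [zero_mul, sub_zero, zero_div, zero_mul] at c2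
      have t2 := tendsto_mul_abs_le_one (tendsto_mul_abs_le_one (tendsto_mul_abs_le_one
        c2 (hθ i)) (hθ j)) (hθ l)
      have c3 := (hkr.const_mul (ε / 2)).mul (hl.mul ((((hl.const_mul (-(κ : ℝ))).mul (hx0 l)).mul
        (hx0 j)).add_const (if l = j then 1 else 0)))
      rw [mul_zero, zero_mul] at c3
      have t3 := tendsto_mul_abs_le_one c3 (hθ i)
      have t := (t1.add t2).add t3
      rw [add_zero, add_zero] at t
      refine t.congr' ?_
      filter_upwards [eventually_punctured n κ] with x hx
      have hr := radius_mem hε hx.1 hx.2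
      have hs := sk_ne hr
      have hdl := differentiableAt_lam hx.1
      have hkd : HasDerivAt k (deriv k (radius κ (param n κ ε x))) (radius κ (param n κ ε x)) :=
        ((hk1.contDiffAt (hR.mem_nhds hr)).differentiableAt one_ne_zero).hasDerivAt
      have hK : HasDerivAt (fun r => k r / sk κ r) _ (radius κ (param n κ ε x)) :=
        hkd.div (hasDerivAt_sk κ _) hs
      have hdK : DifferentiableAt ℝ (fun y => k (radius κ (param n κ ε y))
          / sk κ (radius κ (param n κ ε y))) x :=
        DifferentiableAt.comp (g := fun r => k r / sk κ r) x hK.differentiableAt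
          (differentiableAt_radius hε hx)
      have hp : EqOn (pd j A) (fun y => (k (radius κ (param n κ ε y))
          / sk κ (radius κ (param n κ ε y))) * ((ε / 2 * (lam κ y * lam κ y)) * y j))
          (punctured n κ) := fun y hy => by
        rw [hA, pd_radial hε hy (hB _ (radius_mem hε hy.1 hy.2))]
        ring
      have hpd : DifferentiableAt ℝ (pd j A) x :=
        ContDiffOn.differentiableAt' (k := 1) hOp one_ne_zero hp1 hx
      rw [pd_mul (hdx x i) hpd, pd_coord, pd_congr_of_isOpen hOp hp hx, pd_mul hdK
        (((hdl.fun_mul hdl).const_mul _).fun_mul (hdx x j)),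
        pd_radial (f := fun r => k r / sk κ r) hε hx hK,
        pd_mul ((hdl.fun_mul hdl).const_mul _) (hdx x j), pd_const_mul (hdl.fun_mul hdl),
        pd_mul hdl hdl, pd_lam hx.1, pd_coord]
      simp only [Function.comp, dlog, ite_mul, one_mul, zero_mul]
      set s := sk κ (radius κ (param n κ ε x))
      have hε2 := label_sq hε
      field_simp
      linear_combination (-2 * (s * deriv k (radius κ (param n κ ε x)) - k (radius κ (param n κ ε x))
        * ck κ (radius κ (param n κ ε x))) * lam κ x ^ 4 * x i * x j * x l) * hε2
  have hd : DifferentiableOn ℝ (fun x => A x * x i) (chartDomain n κ) := fun x hx =>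
    ((hAd x hx).fun_mul (hdx x i)).differentiableWithinAt
  have h := contDiffOn_succ_of_pd (m := 1) hO hd fun j => by
    have h1 : ContDiffOn ℝ 1 (fun x => x i * pd j A x + A x * if j = i then 1 else 0)
        (chartDomain n κ) := (hZ j).add (hA1.mul contDiffOn_const)
    rw [Nat.cast_one]
    refine h1.congr fun x hx => ?_
    rw [pd_mul (hAd x hx) (hdx x i), pd_coord]
    ring
  simpa [one_add_one_eq_two] using h

end Regularity

/-! ### Functions of the radius and their behaviour at the poles -/

section OneDimensional

variable {κ : SignType} {ε : ℝ}

lemma one_mem_chartLabels (κ : SignType) : (1 : ℝ) ∈ chartLabels κ := Or.inl rfl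

lemma neg_one_mem_chartLabels : (-1 : ℝ) ∈ chartLabels 1 := Or.inr ⟨rfl, rfl⟩

/-- A continuous function on `radii κ` that tends to `0` at the poles extends by `0`. -/
lemma continuous_indicator_radii {g : ℝ → ℝ} (hg : ContinuousOn g (radii κ))
    (h : ∀ ε ∈ chartLabels κ, Tendsto g (endFilter ε) (𝓝 0)) :
    Continuous ((radii κ).indicator g) := by
  rw [continuous_iff_continuousAt]
  intro r
  by_cases hr : r ∈ radii κ
  · refine (hg.continuousAt ((isOpen_radii κ).mem_nhds hr)).congr ?_
    filter_upwards [(isOpen_radii κ).mem_nhds hr] with t ht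
    rw [indicator_of_mem ht]
  · rw [ContinuousAt, indicator_of_notMem hr, ← nhdsWithin_univ, ← union_compl_self (radii κ),
      nhdsWithin_union]
    refine Tendsto.sup ?_ ?_
    · suffices hs : 𝓝[radii κ] r = ⊥ ∨ ∃ ε ∈ chartLabels κ, 𝓝[radii κ] r ≤ endFilter ε by
        have he : (radii κ).indicator g =ᶠ[𝓝[radii κ] r] g :=
          eqOn_indicator.eventuallyEq_nhdsWithin
        refine Tendsto.congr' he.symm ?_
        rcases hs with hs | ⟨ε, hε, hs⟩
        · rw [hs]; exact tendsto_bot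
        · exact (h ε hε).mono_left hs
      have hsub : radii κ ⊆ Ioi 0 := fun t ht => ht.1
      rcases lt_trichotomy r 0 with h0 | rfl | h0
      · left
        rw [← mem_closure_iff_nhdsWithin_neBot.not.trans not_neBot]
        intro hc
        have := closure_mono hsub hc
        rw [closure_Ioi] at this
        exact absurd this (not_le.2 h0)
      · exact Or.inr ⟨1, one_mem_chartLabels κ, by
          rw [endFilter_one]; exact nhdsWithin_mono _ hsub⟩
      · have hκ : κ = 1 := by
          by_contra hκ
          exact hr ⟨h0, fun h => absurd h hκ⟩
        subst hκ
        have hsub' : radii 1 ⊆ Iio Real.pi := fun t ht => ht.2 rfl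
        have hπ : Real.pi ≤ r := not_lt.1 fun h => hr ⟨h0, fun _ => h⟩
        rcases hπ.eq_or_lt with rfl | hπ
        · exact Or.inr ⟨-1, neg_one_mem_chartLabels, by
            rw [endFilter_neg_one]; exact nhdsWithin_mono _ hsub'⟩
        · left
          rw [← mem_closure_iff_nhdsWithin_neBot.not.trans not_neBot]
          intro hc
          have := closure_mono hsub' hc
          rw [closure_Iio] at this
          exact absurd this (not_le.2 hπ)
    · exact (tendsto_const_nhds (x := (0 : ℝ))).congr' (eventually_nhdsWithin_of_forall
        fun t ht => (indicator_of_notMem ht g).symm)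

/-- L'Hôpital's rule for quotients by powers of `s_κ`. -/
lemma tendsto_div_sk_pow (hε : ε ∈ chartLabels κ) {f g : ℝ → ℝ} (p : ℕ)
    (hf : ∀ r ∈ radii κ, HasDerivAt f (g r * sk κ r ^ p) r)
    (hf0 : Tendsto f (endFilter ε) (𝓝 0)) (hg : Tendsto g (endFilter ε) (𝓝 0)) :
    Tendsto (fun r => f r / sk κ r ^ (p + 1)) (endFilter ε) (𝓝 0) := by
  have hε0 : ε ≠ 0 := fun h => by have := label_sq hε; rw [h] at this; norm_num at this
  have hR := radii_mem_endFilter hε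
  have hc := (tendsto_ck_endFilter hε).eventually_ne hε0
  have hs0 : Tendsto (fun r => sk κ r ^ (p + 1)) (endFilter ε) (𝓝 0) := by
    have := (tendsto_sk_endFilter hε).pow (p + 1)
    rwa [zero_pow (Nat.succ_ne_zero p)] at this
  have h1 : ∀ᶠ r in endFilter ε, HasDerivAt f (g r * sk κ r ^ p) r := by
    filter_upwards [hR] with r hr using hf r hr
  have h2 : ∀ᶠ r in endFilter ε, HasDerivAt (fun r => sk κ r ^ (p + 1))
      (((p + 1 : ℕ) : ℝ) * sk κ r ^ p * ck κ r) r := by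
    filter_upwards with r using (hasDerivAt_sk κ r).pow (p + 1)
  have h3 : ∀ᶠ r in endFilter ε, ((p + 1 : ℕ) : ℝ) * sk κ r ^ p * ck κ r ≠ 0 := by
    filter_upwards [hR, hc] with r hr hc
    exact mul_ne_zero (mul_ne_zero (by positivity) (pow_ne_zero _ (sk_ne hr))) hc
  have h4 : Tendsto (fun r => g r * sk κ r ^ p / (((p + 1 : ℕ) : ℝ) * sk κ r ^ p * ck κ r))
      (endFilter ε) (𝓝 0) := by
    have := hg.div ((tendsto_ck_endFilter hε).const_mul ((p + 1 : ℕ) : ℝ))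
      (mul_ne_zero (by positivity) hε0)
    rw [zero_div] at this
    refine this.congr' ?_
    filter_upwards [hR, hc] with r hr hc
    have := sk_ne hr
    have : ((p + 1 : ℕ) : ℝ) ≠ 0 := by positivity
    simp only [Pi.div_apply]
    field_simp
  rcases hε with rfl | ⟨-, rfl⟩
  · rw [endFilter_one] at *
    exact HasDerivAt.lhopital_zero_nhdsGT h1 h2 h3 hf0 hs0 h4
  · rw [endFilter_neg_one] at *
    exact HasDerivAt.lhopital_zero_nhdsLT h1 h2 h3 hf0 hs0 h4

lemma integral_eq_of_eqOn_radii {f g : ℝ → ℝ} (h : EqOn f g (radii κ)) {r : ℝ} (hr : r ∈ radii κ) :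
    ∫ t in (0 : ℝ)..r, f t = ∫ t in (0 : ℝ)..r, g t := by
  refine intervalIntegral.integral_congr_ae (Eventually.of_forall fun t ht => ?_)
  rw [uIoc_of_le hr.1.le] at ht
  exact h (Ioc_subset_radii hr ht)

lemma eq_of_deriv_eq_radii {f g f' : ℝ → ℝ} (hf : ∀ r ∈ radii κ, HasDerivAt f (f' r) r)
    (hg : ∀ r ∈ radii κ, HasDerivAt g (f' r) r)
    (h0 : Tendsto (fun r => f r - g r) (𝓝[>] 0) (𝓝 0)) : EqOn f g (radii κ) := by
  have hd : ∀ r ∈ radii κ, HasDerivAt (fun r => f r - g r) 0 r := fun r hr => by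
    simpa using (hf r hr).fun_sub (hg r hr)
  intro r hr
  have hc : ∀ t ∈ radii κ, f t - g t = f r - g r := fun t ht =>
    (isOpen_radii κ).is_const_of_deriv_eq_zero (ordConnected_radii κ).isPreconnected
      (fun t ht => (hd t ht).differentiableAt.differentiableWithinAt)
      (fun t ht => (hd t ht).deriv) ht hr
  have hR := radii_mem_endFilter (one_mem_chartLabels κ)
  rw [endFilter_one] at hR
  have h1 : Tendsto (fun r => f r - g r) (𝓝[>] 0) (𝓝 (f r - g r)) := by
    refine tendsto_const_nhds.congr' ?_
    filter_upwards [hR] with t ht using (hc t ht).symm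
  exact sub_eq_zero.1 (tendsto_nhds_unique h1 h0)

lemma hasDerivAt_integral {f : ℝ → ℝ} (hf : Continuous f) (r : ℝ) :
    HasDerivAt (fun r => ∫ t in (0 : ℝ)..r, f t) (f r) r :=
  intervalIntegral.integral_hasDerivAt_right (hf.intervalIntegrable _ _)
    hf.aestronglyMeasurable.stronglyMeasurableAtFilter hf.continuousAt

end OneDimensional

/-! ### The radial solution of the vector equation -/

section RadialSolution

variable {n : ℕ} {κ : SignType} {ε : ℝ} {m : ℝ → ℝ}

/-- The function `∫₀ʳ m s_κⁿ`. -/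
def moment (n : ℕ) (κ : SignType) (m : ℝ → ℝ) (r : ℝ) : ℝ :=
  ∫ t in (0 : ℝ)..r, m t * sk κ t ^ n

/-- The solution `s_κ^(-n-1) ∫₀ʳ m s_κⁿ` of `k' + (n + 1) (c_κ / s_κ) k = m / s_κ`, extended by
`0`. For the radial form `s_κ B dr` with `B' = k / 2`, the component `(LW)(∂ᵣ, ∂ᵣ)` is
`((n - 1) / n) s_κ k`. -/
def profileK (n : ℕ) (κ : SignType) (m : ℝ → ℝ) : ℝ → ℝ :=
  (radii κ).indicator fun r => moment n κ m r / sk κ r ^ (n + 1)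

/-- A primitive of `profileK / 2`. -/
def profileB (n : ℕ) (κ : SignType) (m : ℝ → ℝ) (r : ℝ) : ℝ :=
  ∫ t in (0 : ℝ)..r, profileK n κ m t / 2

lemma hasDerivAt_moment (hm : Continuous m) (r : ℝ) :
    HasDerivAt (moment n κ m) (m r * sk κ r ^ n) r :=
  hasDerivAt_integral (hm.mul ((continuous_sk κ).pow n)) r

lemma moment_zero : moment n κ m 0 = 0 := by simp [moment]

lemma continuous_moment (hm : Continuous m) : Continuous (moment n κ m) :=
  continuous_iff_continuousAt.2 fun r => (hasDerivAt_moment hm r).continuousAt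

lemma tendsto_moment (hm : Continuous m) (hY : moment n κ m (endPoint ε) = 0) :
    Tendsto (moment n κ m) (endFilter ε) (𝓝 0) := by
  rw [← hY]
  exact ((continuous_moment hm).tendsto _).mono_left (endFilter_le ε)

lemma profileK_of_mem {r : ℝ} (hr : r ∈ radii κ) :
    profileK n κ m r = moment n κ m r / sk κ r ^ (n + 1) := indicator_of_mem hr _

lemma hasDerivAt_profileK (hm : Continuous m) {r : ℝ} (hr : r ∈ radii κ) :
    HasDerivAt (profileK n κ m)
      (m r / sk κ r - (n + 1) * (ck κ r / sk κ r) * profileK n κ m r) r := by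
  have hs := sk_ne hr
  have h := (hasDerivAt_moment (n := n) (κ := κ) hm r).div
    ((hasDerivAt_sk κ r).pow (n + 1)) (pow_ne_zero _ hs)
  have h1 : HasDerivAt (profileK n κ m) _ r := h.congr_of_eventuallyEq (by
    filter_upwards [(isOpen_radii κ).mem_nhds hr] with t ht using profileK_of_mem ht)
  refine h1.congr_deriv ?_
  rw [profileK_of_mem hr]
  simp only [Pi.pow_apply, Nat.add_sub_cancel]
  push_cast
  field_simp
  ring

lemma continuousOn_profileK (hm : Continuous m) : ContinuousOn (profileK n κ m) (radii κ) :=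
  fun _ hr => (hasDerivAt_profileK hm hr).continuousAt.continuousWithinAt

lemma contDiffOn_profileK (hm : Continuous m) : ContDiffOn ℝ 1 (profileK n κ m) (radii κ) := by
  have h : ContDiffOn ℝ (0 + 1) (profileK n κ m) (radii κ) := by
    rw [contDiffOn_succ_iff_deriv_of_isOpen (isOpen_radii κ)]
    refine ⟨fun r hr => (hasDerivAt_profileK hm hr).differentiableAt.differentiableWithinAt,
      by simp, ?_⟩
    rw [contDiffOn_zero]
    have h1 : ContinuousOn (fun r => m r / sk κ r
        - (n + 1) * (ck κ r / sk κ r) * profileK n κ m r) (radii κ) := by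
      have hs0 : ∀ r ∈ radii κ, sk κ r ≠ 0 := fun r hr => sk_ne hr
      have hsc := (continuous_sk κ).continuousOn (s := radii κ)
      exact (hm.continuousOn.div hsc hs0).sub ((continuousOn_const.mul
        ((continuous_ck κ).continuousOn.div hsc hs0)).mul (continuousOn_profileK hm))
    exact h1.congr fun r hr => (hasDerivAt_profileK hm hr).deriv
  simpa using h

lemma tendsto_profileK (hm : Continuous m) (hε : ε ∈ chartLabels κ)
    (hm0 : Tendsto m (endFilter ε) (𝓝 0)) (hY : moment n κ m (endPoint ε) = 0) :
    Tendsto (profileK n κ m) (endFilter ε) (𝓝 0) := by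
  have h := tendsto_div_sk_pow hε n (fun r _ => hasDerivAt_moment (n := n) (κ := κ) hm r)
    (tendsto_moment hm hY) hm0
  refine h.congr' ?_
  filter_upwards [radii_mem_endFilter hε] with r hr using (profileK_of_mem hr).symm

lemma continuous_profileK (hm : Continuous m)
    (hm0 : ∀ ε ∈ chartLabels κ, Tendsto m (endFilter ε) (𝓝 0))
    (hY : ∀ ε ∈ chartLabels κ, moment n κ m (endPoint ε) = 0) :
    Continuous (profileK n κ m) := by
  refine continuous_indicator_radii ?_ fun ε hε => ?_
  · exact (continuousOn_profileK (n := n) hm).congr fun r hr => (profileK_of_mem hr).symm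
  · refine (tendsto_profileK hm hε (hm0 ε hε) (hY ε hε)).congr' ?_
    filter_upwards [radii_mem_endFilter hε] with r hr using profileK_of_mem hr

lemma hasDerivAt_profileB (hk : Continuous (profileK n κ m)) (r : ℝ) :
    HasDerivAt (profileB n κ m) (profileK n κ m r / 2) r :=
  hasDerivAt_integral (hk.div_const 2) r

/-- The radial form `s_κ (B + C) dr` with `B = profileB` is `C²` on the space form. -/
lemma isCkForm_radialForm (hm : Continuous m)
    (hm0 : ∀ ε ∈ chartLabels κ, Tendsto m (endFilter ε) (𝓝 0))
    (hY : ∀ ε ∈ chartLabels κ, moment n κ m (endPoint ε) = 0) (C : ℝ) :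
    IsCkForm κ 2 (radialForm n κ fun r => profileB n κ m r + C) := by
  have hk := continuous_profileK hm hm0 hY
  intro ε hε i
  have hB : ∀ r, HasDerivAt (fun r => profileB n κ m r + C) (profileK n κ m r / 2) r := fun r =>
    (hasDerivAt_profileB hk r).add_const C
  have hk0 := tendsto_profileK hm hε (hm0 ε hε) (hY ε hε)
  have h := contDiffOn_two_radial (n := n) (i := i) hε (fun r _ => hB r) (contDiffOn_profileK hm)
    hk0 ?_ ?_
  · have h2 : ContDiffOn ℝ 2 (fun x : Coord n => ε * lam κ x ^ 2
        * ((profileB n κ m (radius κ (param n κ ε x)) + C) * x i)) (chartDomain n κ) :=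
      (contDiffOn_const.mul (contDiffOn_lam.pow 2)).mul h
    refine ContDiffOn.congr (n := 2) h2 fun x hx => ?_
    rw [formComp_radialForm hx]
    ring
  · have h1 := (hm0 ε hε).sub (((tendsto_ck_endFilter hε).const_mul ((n : ℝ) + 1)).mul hk0)
    rw [mul_zero, sub_zero] at h1
    refine h1.congr' ?_
    filter_upwards [radii_mem_endFilter hε] with r hr
    have hs := sk_ne hr
    rw [(hasDerivAt_profileK hm hr).deriv]
    field_simp
  · have h0 : Tendsto (fun r => (profileB n κ m r + C) - (profileB n κ m (endPoint ε) + C))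
        (endFilter ε) (𝓝 0) := by
      have : Continuous fun r => (profileB n κ m r + C) - (profileB n κ m (endPoint ε) + C) :=
        continuous_iff_continuousAt.2 fun r => ((hB r).sub_const _).continuousAt
      have := (this.tendsto (endPoint ε)).mono_left (endFilter_le ε)
      simpa using this
    have h1 := hk0.div_const 2
    rw [zero_div] at h1
    have := tendsto_div_sk_pow hε 0 (f := fun r => (profileB n κ m r + C)
      - (profileB n κ m (endPoint ε) + C)) (g := fun r => profileK n κ m r / 2)
      (fun r _ => by simpa using hB r) h0 h1
    simpa using this

end RadialSolution

/-! ### Continuity of the terms of the equations -/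

section Continuity

variable {n : ℕ} {κ : SignType} {ε : ℝ} {x : Coord n}

lemma contDiffOn_confKilling (hn : n ≠ 0) (hε : ε ∈ chartLabels κ) {W : Coord n → Fin n → ℝ}
    (hW : ∀ i, ContDiffOn ℝ 2 (fun x => W x i) (chartDomain n κ)) (i j : Fin n) :
    ContDiffOn ℝ 1 (fun x => confKilling (metric n κ ε) W x i j) (chartDomain n κ) := by
  have hO := isOpen_chartDomain n κ
  have hp : ∀ i j, ContDiffOn ℝ 1 (pd i fun x => W x j) (chartDomain n κ) := fun i j =>
    contDiffOn_pd (k := 1) hO (by simpa using hW j) i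
  have h1 : ∀ i, ContDiffOn ℝ 1 (fun x => W x i) (chartDomain n κ) := fun i =>
    (hW i).of_le one_le_two
  have hd : ∀ i, ContDiffOn ℝ 1 (dlog (n := n) κ i) (chartDomain n κ) := contDiffOn_dlog
  have h : ContDiffOn ℝ 1 (fun x => pd i (fun y => W y j) x + pd j (fun y => W y i) x
      - 2 * (dlog κ j x * W x i + dlog κ i x * W x j)
      - 2 / (n : ℝ) * (if i = j then 1 else 0) * ((∑ k, pd k (fun y => W y k) x)
        - 2 * ∑ k, dlog κ k x * W x k)) (chartDomain n κ) :=
    (((hp i j).add (hp j i)).sub (contDiffOn_const.mul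
      (((hd j).mul (h1 i)).add ((hd i).mul (h1 j))))).sub (contDiffOn_const.mul
      ((ContDiffOn.sum fun k _ => hp k k).sub (contDiffOn_const.mul
        (ContDiffOn.sum fun k _ => (hd k).mul (h1 k)))))
  exact h.congr fun x hx => confKilling_eq hn hε hx W i j

lemma continuousOn_div₂_confKilling (hn : n ≠ 0) (hε : ε ∈ chartLabels κ)
    {W : Coord n → Fin n → ℝ} (hW : ∀ i, ContDiffOn ℝ 2 (fun x => W x i) (chartDomain n κ))
    (j : Fin n) :
    ContinuousOn (fun x => div₂ (metric n κ ε) (confKilling (metric n κ ε) W) x j)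
      (chartDomain n κ) := by
  have hO := isOpen_chartDomain n κ
  have hT := contDiffOn_confKilling hn hε hW
  have hl := (contDiffOn_lam (n := n) (κ := κ) (k := 0)).continuousOn
  have h : ContinuousOn (fun x => (lam κ x ^ 2)⁻¹
      * ((∑ k, pd k (fun y => confKilling (metric n κ ε) W y k j) x)
      + ((n : ℝ) - 2) * ∑ k, dlog κ k x * confKilling (metric n κ ε) W x k j))
      (chartDomain n κ) := by
    refine ContinuousOn.mul ((hl.pow 2).inv₀ fun x hx => pow_ne_zero _ (lam_ne hx))
      (ContinuousOn.add ?_ (continuousOn_const.mul ?_))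
    · exact continuousOn_finsetSum _ fun k _ => continuousOn_pd hO (hT k j) k
    · exact continuousOn_finsetSum _ fun k _ =>
        ((contDiffOn_dlog (k := 0) k).continuousOn).mul (hT k j).continuousOn
  exact h.congr fun x hx =>
    div₂_eq hε hx _ (confKilling_symm W hn hε hx) (confKilling_trace W hn hε hx) j

lemma continuousOn_normSq₁ (hε : ε ∈ chartLabels κ) {w : Coord n → Fin n → ℝ}
    (hw : ∀ i, ContinuousOn (fun x => w x i) (chartDomain n κ)) :
    ContinuousOn (fun x => normSq₁ (metric n κ ε) x (w x)) (chartDomain n κ) := by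
  have hl := (contDiffOn_lam (n := n) (κ := κ) (k := 0)).continuousOn
  have h : ContinuousOn (fun x => (lam κ x ^ 2)⁻¹ * ∑ i, w x i ^ 2) (chartDomain n κ) :=
    ((hl.pow 2).inv₀ fun x hx => pow_ne_zero _ (lam_ne hx)).mul
      (continuousOn_finsetSum _ fun i _ => (hw i).pow 2)
  exact h.congr fun x hx => normSq₁_eq hε hx _

lemma continuousOn_normSq₂ (hε : ε ∈ chartLabels κ) {T : Coord n → Fin n → Fin n → ℝ}
    (hT : ∀ i j, ContinuousOn (fun x => T x i j) (chartDomain n κ)) :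
    ContinuousOn (fun x => normSq₂ (metric n κ ε) x (T x)) (chartDomain n κ) := by
  have hl := (contDiffOn_lam (n := n) (κ := κ) (k := 0)).continuousOn
  have h : ContinuousOn (fun x => (lam κ x ^ 4)⁻¹ * ∑ i, ∑ j, T x i j ^ 2) (chartDomain n κ) :=
    ((hl.pow 4).inv₀ fun x hx => pow_ne_zero _ (lam_ne hx)).mul
      (continuousOn_finsetSum _ fun i _ => continuousOn_finsetSum _ fun j _ => (hT i j).pow 2)
  exact h.congr fun x hx => normSq₂_eq hε hx _

lemma neBot_punctured_nhds_zero (hn : n ≠ 0) : (𝓝[≠] (0 : Coord n)).NeBot := by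
  obtain ⟨e, he⟩ := exists_unit hn
  exact (tendsto_ray he (one_mem_chartLabels 0)).neBot

/-- An equation between continuous functions extends to the centre of the chart. -/
lemma eqOn_chartDomain_of_punctured (hn : n ≠ 0) {F G : Coord n → ℝ}
    (hF : ContinuousOn F (chartDomain n κ)) (hG : ContinuousOn G (chartDomain n κ))
    (h : EqOn F G (punctured n κ)) : EqOn F G (chartDomain n κ) := by
  intro x hx
  by_cases hx0 : x = 0
  · subst hx0
    have h0 := (isOpen_chartDomain n κ).mem_nhds (zero_mem_chartDomain n κ)
    have := neBot_punctured_nhds_zero (n := n) hn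
    have h1 : Tendsto F (𝓝[≠] 0) (𝓝 (F 0)) := (hF.continuousAt h0).mono_left nhdsWithin_le_nhds
    have h2 : Tendsto G (𝓝[≠] 0) (𝓝 (G 0)) := (hG.continuousAt h0).mono_left nhdsWithin_le_nhds
    refine tendsto_nhds_unique h1 (h2.congr' ?_)
    filter_upwards [eventually_punctured n κ] with y hy using (h hy).symm
  · exact h ⟨hx, hx0⟩

lemma param_mem_spaceForm (hε : ε ∈ chartLabels κ) (hx : x ∈ chartDomain n κ) :
    param n κ ε x ∈ spaceForm n κ := by
  refine ⟨?_, ?_⟩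
  · rw [param_fst hx, norm_param_snd hx, mul_pow, label_sq hε, one_mul, lam_sq_identity hx]
  · have h : (param n κ ε x).1 = ck κ (radius κ (param n κ ε x)) := by
      rw [param_fst hx, ck_radius hε hx]
    rw [h]
    rcases κ with _ | _ | _
    · exact Or.inr one_pos
    · exact Or.inr (Real.cosh_pos _)
    · exact Or.inl rfl

end Continuity

/-! ### Admissible data -/

/-- The hypotheses on the data `(V, ψ, ρ, τ)` and on the function `φ`. -/
structure Admissible (n : ℕ) (κ : SignType) (V ψ ρ τ φ : ℝ → ℝ) : Prop where
  three_le : 3 ≤ n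
  contV : Continuous V
  psi : IsCk κ 1 (radial n κ ψ)
  rho : IsCk κ 0 (radial n κ ρ)
  tau : IsCk κ 1 (radial n κ τ)
  phi : IsCk κ 3 (radial n κ φ)
  phi_pos : ∀ p ∈ spaceForm n κ, 0 < radial n κ φ p
  rho_psi : ∀ r ∈ radii κ, ρ r * deriv ψ r = 0

/-- The function `τ' φ^N`, extended by `0`. -/
def source (n : ℕ) (κ : SignType) (τ φ : ℝ → ℝ) : ℝ → ℝ :=
  (radii κ).indicator fun r => deriv τ r * φ r ^ critExp n

/-- The difference of the terms of the radial Lichnerowicz equation that do not involve `τ'`: the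
equation says that it is the square of `s_κ⁻ⁿ ∫₀ʳ τ' φ^N s_κⁿ`. -/
def lichDefect (n : ℕ) (κ : SignType) (V ψ ρ τ φ : ℝ → ℝ) (r : ℝ) : ℝ :=
  -(2 * critExp n) * φ r ^ (critExp n + 1) * (deriv (deriv φ) r + meanCurv n κ r * deriv φ r)
      + (κ : ℝ) * (n : ℝ) ^ 2 * φ r ^ (critExp n + 2) + τ r ^ 2 * φ r ^ (2 * critExp n)
    - Ifun n V ψ ρ φ r

namespace Admissible

variable {n : ℕ} {κ : SignType} {V ψ ρ τ φ : ℝ → ℝ} {ε : ℝ} {x : Coord n}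

lemma n_ne_zero (h : Admissible n κ V ψ ρ τ φ) : n ≠ 0 := by have := h.three_le; omega

lemma three_le_cast (h : Admissible n κ V ψ ρ τ φ) : (3 : ℝ) ≤ n := by exact_mod_cast h.three_le

lemma pos (h : Admissible n κ V ψ ρ τ φ) {r : ℝ} (hr : r ∈ radii κ) : 0 < φ r := by
  obtain ⟨e, he⟩ := exists_unit h.n_ne_zero
  have h1 := one_mem_chartLabels κ
  have := h.phi_pos _ (param_mem_spaceForm h1 (ray_mem he h1 hr).1)
  rwa [radial, radius_ray he h1 hr] at this

lemma pos_endPoint (h : Admissible n κ V ψ ρ τ φ) (hε : ε ∈ chartLabels κ) :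
    0 < φ (endPoint ε) := by
  have := h.phi_pos _ (param_mem_spaceForm hε (zero_mem_chartDomain n κ))
  rwa [radial, radius_param_zero hε] at this

lemma tendsto_rpow (h : Admissible n κ V ψ ρ τ φ) (hε : ε ∈ chartLabels κ) (p : ℝ) :
    Tendsto (fun r => φ r ^ p) (endFilter ε) (𝓝 (φ (endPoint ε) ^ p)) :=
  (tendsto_profile h.n_ne_zero hε h.phi).rpow_const (Or.inl (h.pos_endPoint hε).ne')

lemma continuousOn_rpow (h : Admissible n κ V ψ ρ τ φ) (p : ℝ) :
    ContinuousOn (fun r => φ r ^ p) (radii κ) :=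
  (contDiffOn_profile h.n_ne_zero h.phi).continuousOn.rpow_const fun _ hr =>
    Or.inl (h.pos hr).ne'

lemma continuousOn_deriv {f : ℝ → ℝ} (hn : n ≠ 0) (hf : IsCk κ 1 (radial n κ f)) :
    ContinuousOn (deriv f) (radii κ) :=
  (contDiffOn_profile hn hf).continuousOn_deriv_of_isOpen (isOpen_radii κ) le_rfl

lemma tendsto_source (h : Admissible n κ V ψ ρ τ φ) (hε : ε ∈ chartLabels κ) :
    Tendsto (source n κ τ φ) (endFilter ε) (𝓝 0) := by
  have h1 := (tendsto_deriv_profile h.n_ne_zero hε h.tau).mul (h.tendsto_rpow hε (critExp n))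
  rw [zero_mul] at h1
  refine h1.congr' ?_
  filter_upwards [radii_mem_endFilter hε] with r hr
  exact (indicator_of_mem hr (fun r => deriv τ r * φ r ^ critExp n)).symm

lemma continuous_source (h : Admissible n κ V ψ ρ τ φ) : Continuous (source n κ τ φ) := by
  refine continuous_indicator_radii
    ((continuousOn_deriv h.n_ne_zero h.tau).mul (h.continuousOn_rpow _)) fun ε hε => ?_
  have h1 := (tendsto_deriv_profile h.n_ne_zero hε h.tau).mul (h.tendsto_rpow hε (critExp n))
  rwa [zero_mul] at h1

lemma source_of_mem {r : ℝ} (hr : r ∈ radii κ) :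
    source n κ τ φ r = deriv τ r * φ r ^ critExp n := indicator_of_mem hr _

lemma moment_source {r : ℝ} (hr : r ∈ radii κ) :
    ∫ t in (0 : ℝ)..r, deriv τ t * φ t ^ critExp n * sk κ t ^ n
      = moment n κ (source n κ τ φ) r :=
  integral_eq_of_eqOn_radii (fun t ht => by simp only [source_of_mem ht]) hr

lemma radialLichnerowicz_iff {r : ℝ} (hr : r ∈ radii κ) :
    RadialLichnerowicz n κ V ψ ρ τ φ r ↔
      lichDefect n κ V ψ ρ τ φ r = (moment n κ (source n κ τ φ) r / sk κ r ^ n) ^ 2 := by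
  rw [RadialLichnerowicz, moment_source hr, lichDefect, sub_eq_iff_eq_add, one_div_mul_eq_div]

lemma normSq_pd_radial {f : ℝ → ℝ} (hn : n ≠ 0) (hf : IsCk κ 1 (radial n κ f))
    (hε : ε ∈ chartLabels κ) (hx : x ∈ punctured n κ) :
    normSq₁ (metric n κ ε) x (fun i => pd i (fun y => radial n κ f (param n κ ε y)) x)
      = deriv f (radius κ (param n κ ε x)) ^ 2 := by
  have hl := lam_ne hx.1
  have hd := hasDerivAt_profile hn one_ne_zero hf (radius_mem hε hx.1 hx.2)
  rw [normSq₁_eq hε hx.1]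
  have h1 : ∀ i, pd i (fun y => radial n κ f (param n κ ε y)) x ^ 2
      = deriv f (radius κ (param n κ ε x)) ^ 2 * _ := fun i => by
    simp only [radial]
    rw [pd_radial hε hx hd, mul_pow]
  simp only [h1, ← Finset.mul_sum, sum_sq_div_sk hε hx]
  field_simp

/-- The Lichnerowicz equation at a point other than the centres of the charts, in radial form. -/
lemma lichnerowicz_iff (h : Admissible n κ V ψ ρ τ φ) (hε : ε ∈ chartLabels κ)
    (hx : x ∈ punctured n κ) (Q : ℝ) :
    (-(4 * ((n : ℝ) - 1) / ((n : ℝ) - 2)) * laplacian (metric n κ ε)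
          (fun y => radial n κ φ (param n κ ε y)) x
        + (scal (metric n κ ε) x - normSq₁ (metric n κ ε) x
            (fun i => pd i (fun y => radial n κ ψ (param n κ ε y)) x))
          * radial n κ φ (param n κ ε x)
      = (-(((n : ℝ) - 1) / n) * radial n κ τ (param n κ ε x) ^ 2
          + 2 * V (radial n κ ψ (param n κ ε x)))
          * radial n κ φ (param n κ ε x) ^ (critExp n - 1)
        + (Q + radial n κ ρ (param n κ ε x) ^ 2)
          / radial n κ φ (param n κ ε x) ^ (critExp n + 1)) ↔
    lichDefect n κ V ψ ρ τ φ (radius κ (param n κ ε x)) = (n : ℝ) / ((n : ℝ) - 1) * Q := by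
  have hn3 := h.three_le_cast
  have hr := radius_mem hε hx.1 hx.2
  have hpos := h.pos hr
  rw [normSq_pd_radial h.n_ne_zero h.psi hε hx, scal_eq hε hx.1]
  simp only [radial]
  rw [laplacian_radial h.n_ne_zero hε hx (h.phi.of_le (by norm_num))]
  simp only [lichDefect, Ifun, sq_abs]
  set r := radius κ (param n κ ε x)
  have e1 : φ r ^ (critExp n + 1) = φ r ^ critExp n * φ r := by
    rw [Real.rpow_add hpos, Real.rpow_one]
  have e2 : φ r ^ (critExp n + 2) = φ r ^ critExp n * φ r ^ 2 := by
    rw [Real.rpow_add hpos, Real.rpow_two]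
  have e3 : φ r ^ (critExp n - 1) = φ r ^ critExp n / φ r := by
    rw [Real.rpow_sub hpos, Real.rpow_one]
  have e4 : φ r ^ (2 * critExp n) = (φ r ^ critExp n) ^ 2 := by
    rw [mul_comm, Real.rpow_mul hpos.le, Real.rpow_two]
  have hb : 0 < φ r ^ critExp n := Real.rpow_pos_of_pos hpos _
  rw [e1, e2, e3, e4]
  have hN : critExp n = 2 * (n : ℝ) / ((n : ℝ) - 2) := rfl
  generalize φ r ^ critExp n = b at hb ⊢
  rw [hN]
  generalize φ r = a at hpos ⊢
  have h1 : (n : ℝ) - 1 ≠ 0 := by linarith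
  have h2 : (n : ℝ) - 2 ≠ 0 := by linarith
  have h3 : (n : ℝ) ≠ 0 := by linarith
  have hc : (n : ℝ) / ((n : ℝ) - 1) * b * a ≠ 0 := by positivity
  rw [← sub_eq_zero, ← mul_right_inj' hc, mul_zero, ← sub_eq_zero (b := _ * Q)]
  refine Eq.congr ?_ rfl
  field_simp
  ring

/-- The right-hand side of the vector equation away from the centres of the charts. -/
lemma vector_rhs_eq (h : Admissible n κ V ψ ρ τ φ) (hε : ε ∈ chartLabels κ)
    (hx : x ∈ punctured n κ) (j : Fin n) :
    ((n : ℝ) - 1) / n * radial n κ φ (param n κ ε x) ^ critExp n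
        * pd j (fun y => radial n κ τ (param n κ ε y)) x
      - radial n κ ρ (param n κ ε x) * pd j (fun y => radial n κ ψ (param n κ ε y)) x
      = ε * lam κ x ^ 2 * x j * (((n : ℝ) - 1) / n)
        * (source n κ τ φ (radius κ (param n κ ε x)) / sk κ (radius κ (param n κ ε x))) := by
  have hr := radius_mem hε hx.1 hx.2
  have hs := sk_ne hr
  simp only [radial]
  rw [pd_radial hε hx (hasDerivAt_profile h.n_ne_zero one_ne_zero h.tau hr),
    pd_radial hε hx (hasDerivAt_profile h.n_ne_zero one_ne_zero h.psi hr), source_of_mem hr,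
    ← mul_assoc (ρ _), h.rho_psi _ hr]
  ring

lemma tendsto_Ifun (h : Admissible n κ V ψ ρ τ φ) (hε : ε ∈ chartLabels κ) :
    ∃ c, Tendsto (Ifun n V ψ ρ φ) (endFilter ε) (𝓝 c) := by
  have hn := h.n_ne_zero
  have hψ := tendsto_profile hn hε h.psi
  exact ⟨_, (((((h.contV.tendsto _).comp hψ).const_mul 2).mul (h.tendsto_rpow hε _)).add
    (((tendsto_deriv_profile hn hε h.psi).abs.pow 2).mul (h.tendsto_rpow hε _))).add
    ((tendsto_profile hn hε h.rho).pow 2) |>.const_mul _⟩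

lemma tendsto_lichDefect (h : Admissible n κ V ψ ρ τ φ) (hε : ε ∈ chartLabels κ) :
    ∃ c, Tendsto (lichDefect n κ V ψ ρ τ φ) (endFilter ε) (𝓝 c) := by
  have hn := h.n_ne_zero
  obtain ⟨d, hd⟩ := tendsto_laplacian_profile hn hε (h.phi.of_le (by norm_num : 2 ≤ 3))
  obtain ⟨i, hi⟩ := h.tendsto_Ifun hε
  exact ⟨_, ((((h.tendsto_rpow hε _).const_mul _).mul hd).add
    ((h.tendsto_rpow hε _).const_mul _)).add
      (((tendsto_profile hn hε h.tau).pow 2).mul (h.tendsto_rpow hε _)) |>.sub hi⟩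

lemma continuousOn_Ifun (h : Admissible n κ V ψ ρ τ φ) :
    ContinuousOn (Ifun n V ψ ρ φ) (radii κ) := by
  have hn := h.n_ne_zero
  exact continuousOn_const.mul (((continuousOn_const.mul
    (h.contV.comp_continuousOn (contDiffOn_profile hn h.psi).continuousOn)).mul
      (h.continuousOn_rpow _)).add (((continuousOn_deriv hn h.psi).abs.pow 2).mul
      (h.continuousOn_rpow _)) |>.add ((contDiffOn_profile hn h.rho).continuousOn.pow 2))

lemma continuousOn_lichDefect (h : Admissible n κ V ψ ρ τ φ) :
    ContinuousOn (lichDefect n κ V ψ ρ τ φ) (radii κ) := by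
  have hn := h.n_ne_zero
  have hd1 : ContDiffOn ℝ 1 (deriv φ) (radii κ) :=
    (contDiffOn_profile hn h.phi).deriv_of_isOpen (isOpen_radii κ) (by norm_num)
  have hd2 : ContinuousOn (deriv (deriv φ)) (radii κ) :=
    hd1.continuousOn_deriv_of_isOpen (isOpen_radii κ) le_rfl
  have hh : ContinuousOn (meanCurv n κ) (radii κ) :=
    continuousOn_const.mul ((continuous_ck κ).continuousOn.div (continuous_sk κ).continuousOn
      fun r hr => sk_ne hr)
  exact ((((continuousOn_const.mul (h.continuousOn_rpow _)).mul
    (hd2.add (hh.mul hd1.continuousOn))).add (continuousOn_const.mul (h.continuousOn_rpow _))).add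
      (((contDiffOn_profile hn h.tau).continuousOn.pow 2).mul (h.continuousOn_rpow _))).sub
        h.continuousOn_Ifun

/-- The radial equation bounds `s_κ⁻ⁿ ∫₀ʳ τ' φ^N s_κⁿ`, so that the integral vanishes at the poles.
On the sphere this is the integrability condition of the vector equation. -/
lemma moment_endPoint (h : Admissible n κ V ψ ρ τ φ)
    (hL : ∀ r ∈ radii κ, RadialLichnerowicz n κ V ψ ρ τ φ r) (hε : ε ∈ chartLabels κ) :
    moment n κ (source n κ τ φ) (endPoint ε) = 0 := by
  obtain ⟨c, hc⟩ := h.tendsto_lichDefect hε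
  have h1 := hc.mul ((tendsto_sk_endFilter hε).pow (2 * n))
  rw [zero_pow (by have := h.n_ne_zero; omega), mul_zero] at h1
  have h2 := ((((continuous_moment (n := n) (κ := κ) h.continuous_source).tendsto
    (endPoint ε)).mono_left (endFilter_le ε)).pow 2)
  refine pow_eq_zero_iff two_ne_zero |>.1 (tendsto_nhds_unique (h2.congr' ?_) h1)
  filter_upwards [radii_mem_endFilter hε] with r hr
  have hs := sk_ne hr
  rw [(radialLichnerowicz_iff hr).1 (hL r hr), div_pow, ← pow_mul, mul_comm n 2,
    div_mul_cancel₀ _ (pow_ne_zero _ hs)]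

/-- If the radial equation holds, then the radial form `s_κ (B + C) dr` solves the conformal
equations together with `φ`. -/
lemma solvesWith_radialForm (h : Admissible n κ V ψ ρ τ φ)
    (hL : ∀ r ∈ radii κ, RadialLichnerowicz n κ V ψ ρ τ φ r) (C : ℝ) :
    SolvesWith κ V (radial n κ ψ) (radial n κ ρ) (radial n κ τ) (fun _ => 0) (radial n κ φ)
      (radialForm n κ fun r => profileB n κ (source n κ τ φ) r + C) := by
  have hn := h.n_ne_zero
  have hn3 := h.three_le_cast
  have hm := h.continuous_source
  have hm0 := fun ε (hε : ε ∈ chartLabels κ) => h.tendsto_source hε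
  have hY := fun ε (hε : ε ∈ chartLabels κ) => h.moment_endPoint hL hε
  have hk := continuous_profileK hm hm0 hY
  have hB : ∀ r, HasDerivAt (fun r => profileB n κ (source n κ τ φ) r + C)
      (profileK n κ (source n κ τ φ) r / 2) r := fun r => (hasDerivAt_profileB hk r).add_const C
  intro ε hε
  have hO := isOpen_chartDomain n κ
  set W := formComp κ ε (radialForm n κ fun r => profileB n κ (source n κ τ φ) r + C)
  have hW2 : ∀ i, ContDiffOn ℝ 2 (fun x => W x i) (chartDomain n κ) := fun i =>
    isCkForm_radialForm hm hm0 hY C ε hε i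
  have hWr : ∀ y ∈ punctured n κ, ∀ i, W y i = ε * (fun r => profileB n κ (source n κ τ φ) r + C)
      (radius κ (param n κ ε y)) * lam κ y ^ 2 * y i := fun y hy i => formComp_radialForm hy.1 i
  have hφ := h.phi ε hε
  have hφp : ∀ p : ℝ, ContinuousOn (fun x => radial n κ φ (param n κ ε x) ^ p)
      (chartDomain n κ) := fun p => hφ.continuousOn.rpow_const fun x hx =>
    Or.inl (h.phi_pos _ (param_mem_spaceForm hε hx)).ne'
  have hψ := h.psi ε hε
  have hτ := h.tau ε hε
  have hρ := (h.rho ε hε).continuousOn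
  have hψd := fun i => continuousOn_pd hO (by exact_mod_cast hψ) i
  have hτd := fun i => continuousOn_pd hO (by exact_mod_cast hτ) i
  intro x hx
  refine ⟨?_, fun j => ?_⟩
  · have hE := eqOn_chartDomain_of_punctured hn
      (F := fun x => -(4 * ((n : ℝ) - 1) / ((n : ℝ) - 2)) * laplacian (metric n κ ε)
          (fun y => radial n κ φ (param n κ ε y)) x
        + (scal (metric n κ ε) x - normSq₁ (metric n κ ε) x
            (fun i => pd i (fun y => radial n κ ψ (param n κ ε y)) x))
          * radial n κ φ (param n κ ε x))
      (G := fun x => (-(((n : ℝ) - 1) / n) * radial n κ τ (param n κ ε x) ^ 2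
          + 2 * V (radial n κ ψ (param n κ ε x)))
          * radial n κ φ (param n κ ε x) ^ (critExp n - 1)
        + (normSq₂ (metric n κ ε) x (confKilling (metric n κ ε) W x)
            + radial n κ ρ (param n κ ε x) ^ 2)
          / radial n κ φ (param n κ ε x) ^ (critExp n + 1)) ?_ ?_ ?_ hx
    · simpa [tensorComp] using hE
    · refine ContinuousOn.add (continuousOn_const.mul (continuousOn_laplacian hε
        (hφ.of_le (by norm_num)))) (ContinuousOn.mul (ContinuousOn.sub ?_
          (continuousOn_normSq₁ hε hψd)) hφ.continuousOn)
      exact continuousOn_const.congr fun x hx => scal_eq hε hx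
    · refine ContinuousOn.add (ContinuousOn.mul ((continuousOn_const.mul
        (hτ.continuousOn.pow 2)).add (continuousOn_const.mul
          (h.contV.comp_continuousOn hψ.continuousOn))) (hφp _)) (ContinuousOn.div
          (ContinuousOn.add (continuousOn_normSq₂ hε fun i j =>
            (contDiffOn_confKilling hn hε hW2 i j).continuousOn) (hρ.pow 2)) (hφp _) ?_)
      exact fun x hx => (Real.rpow_pos_of_pos (h.phi_pos _ (param_mem_spaceForm hε hx)) _).ne'
    · intro y hy
      have hr := radius_mem hε hy.1 hy.2
      have hs := sk_ne hr
      refine (h.lichnerowicz_iff hε hy _).2 ?_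
      rw [(radialLichnerowicz_iff hr).1 (hL _ hr), normSq_confKilling_radial hn hε hy (hB _) hWr,
        profileK_of_mem hr]
      have h1 : (n : ℝ) - 1 ≠ 0 := by linarith
      have h3 : (n : ℝ) ≠ 0 := by linarith
      field_simp
      ring
  · have hE := eqOn_chartDomain_of_punctured hn
      (F := fun x => div₂ (metric n κ ε) (confKilling (metric n κ ε) W) x j)
      (G := fun x => ((n : ℝ) - 1) / n * radial n κ φ (param n κ ε x) ^ critExp n
        * pd j (fun y => radial n κ τ (param n κ ε y)) x
      - radial n κ ρ (param n κ ε x) * pd j (fun y => radial n κ ψ (param n κ ε y)) x) ?_ ?_ ?_ hx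
    · exact hE
    · exact continuousOn_div₂_confKilling hn hε hW2 j
    · exact ((continuousOn_const.mul (hφp _)).mul (hτd j)).sub (hρ.mul (hψd j))
    · intro y hy
      have hr := radius_mem hε hy.1 hy.2
      simp only
      rw [h.vector_rhs_eq hε hy, div₂_confKilling_radial hn hε hy (fun r _ => hB r)
        (hasDerivAt_profileK hm hr) hWr]
      ring

lemma isSolution_of_radial (h : Admissible n κ V ψ ρ τ φ)
    (hL : ∀ r ∈ radii κ, RadialLichnerowicz n κ V ψ ρ τ φ r) : IsSolution n κ V ψ ρ τ φ :=
  ⟨_, isCkForm_radialForm h.continuous_source (fun _ hε => h.tendsto_source hε)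
    (fun _ hε => h.moment_endPoint hL hε) 0, Or.inr ⟨_, isRadialForm_radialForm fun _ _ => rfl⟩,
    h.solvesWith_radialForm hL 0⟩

end Admissible

/-! ### Solutions with a radial 1-form -/

namespace Admissible

variable {n : ℕ} {κ : SignType} {V ψ ρ τ φ : ℝ → ℝ} {ε : ℝ} {x : Coord n}
  {W : Ambient n → (Ambient n →L[ℝ] ℝ)}

lemma lichDefect_of_solvesWith (h : Admissible n κ V ψ ρ τ φ)
    (hS : SolvesWith κ V (radial n κ ψ) (radial n κ ρ) (radial n κ τ) (fun _ => 0) (radial n κ φ) W)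
    (hε : ε ∈ chartLabels κ) (hx : x ∈ punctured n κ) :
    lichDefect n κ V ψ ρ τ φ (radius κ (param n κ ε x)) = (n : ℝ) / ((n : ℝ) - 1)
      * normSq₂ (metric n κ ε) x (confKilling (metric n κ ε) (formComp κ ε W) x) := by
  refine (h.lichnerowicz_iff hε hx _).1 ?_
  have := (hS ε hε x hx.1).1
  simpa [tensorComp] using this

lemma div₂_of_solvesWith (h : Admissible n κ V ψ ρ τ φ)
    (hS : SolvesWith κ V (radial n κ ψ) (radial n κ ρ) (radial n κ τ) (fun _ => 0) (radial n κ φ) W)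
    (hε : ε ∈ chartLabels κ) (hx : x ∈ punctured n κ) (j : Fin n) :
    div₂ (metric n κ ε) (confKilling (metric n κ ε) (formComp κ ε W)) x j
      = ε * lam κ x ^ 2 * x j * (((n : ℝ) - 1) / n)
        * (source n κ τ φ (radius κ (param n κ ε x)) / sk κ (radius κ (param n κ ε x))) := by
  rw [← h.vector_rhs_eq hε hx]
  exact (hS ε hε x hx.1).2 j

/-- For a radial form the vector equation is a first-order linear equation in `r`; integrating it
from the pole expresses `|LW|²` through the integral of `τ' φ^N s^n`. -/
lemma radialLichnerowicz_of_isRadialForm (h : Admissible n κ V ψ ρ τ φ)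
    (hS : SolvesWith κ V (radial n κ ψ) (radial n κ ρ) (radial n κ τ) (fun _ => 0) (radial n κ φ) W)
    (hW : IsCkForm κ 2 W) {u : ℝ → ℝ} (hu : IsRadialForm κ u W) :
    ∀ r ∈ radii κ, RadialLichnerowicz n κ V ψ ρ τ φ r := by
  have hn := h.n_ne_zero
  have hn3 := h.three_le_cast
  have hR := isOpen_radii κ
  have hε := one_mem_chartLabels κ
  set B : ℝ → ℝ := fun r => u r / sk κ r with hBdef
  set a : Coord n → Fin n → ℝ := formComp κ 1 W
  have ha : ∀ y ∈ punctured n κ, ∀ i,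
      a y i = 1 * B (radius κ (param n κ 1 y)) * lam κ y ^ 2 * y i := fun y hy i => by
    have hs := sk_ne (radius_mem hε hy.1 hy.2)
    rw [show a y i = _ from hu 1 hε y hy.1 hy.2 i, pd_radius hε hy]
    simp only [hBdef]
    field_simp
  -- regularity of `B`, along a coordinate axis
  let i₀ : Fin n := ⟨0, Nat.pos_of_ne_zero hn⟩
  set e : Coord n := EuclideanSpace.single i₀ 1 with he_def
  have he : ‖e‖ = 1 := by simp [he_def]
  have hray : ∀ r, ray κ 1 e r i₀ = 2 * sk κ r / (1 + 1 * ck κ r) := fun r => by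
    simp [ray, he_def]
  have hB2 : ContDiffOn ℝ 2 B (radii κ) := by
    have h1 : ContDiffOn ℝ 2 (fun r => a (ray κ 1 e r) i₀) (radii κ) :=
      (hW 1 hε i₀).comp (contDiffOn_ray hε) fun r hr => (ray_mem he hε hr).1
    have h2 : ContDiff ℝ 2 fun r => (1 + 1 * ck κ r) * sk κ r / 2 :=
      ((contDiff_const.add (contDiff_const.mul (contDiff_ck κ))).mul (contDiff_sk κ)).div_const 2
    have h3 : ∀ r ∈ radii κ, (1 + 1 * ck κ r) * sk κ r / 2 ≠ 0 := fun r hr => by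
      have := one_add_label_mul_ck_pos hε hr
      have := sk_pos hr
      positivity
    refine (h1.div h2.contDiffOn h3).congr fun r hr => ?_
    have h4 := (one_add_label_mul_ck_pos hε hr).ne'
    rw [one_mul] at h4
    have hs := sk_ne hr
    rw [Pi.div_apply, ha _ (ray_mem he hε hr), radius_ray he hε hr, lam_ray he hε hr, hray]
    field_simp
  set k : ℝ → ℝ := fun r => 2 * deriv B r with hkdef
  have hB : ∀ r ∈ radii κ, HasDerivAt B (k r / 2) r := fun r hr => by
    have : k r / 2 = deriv B r := by simp only [hkdef]; ring
    rw [this]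
    exact ((hB2.contDiffAt (hR.mem_nhds hr)).differentiableAt two_ne_zero).hasDerivAt
  have hk : ∀ r ∈ radii κ, HasDerivAt k (deriv k r) r := fun r hr => by
    have h1 : ContDiffOn ℝ 1 (deriv B) (radii κ) :=
      hB2.deriv_of_isOpen hR (by norm_num)
    exact (((h1.contDiffAt (hR.mem_nhds hr)).differentiableAt one_ne_zero).const_mul 2).hasDerivAt
  have hsq : ∀ r ∈ radii κ, normSq₂ (metric n κ 1) (ray κ 1 e r)
      (confKilling (metric n κ 1) a (ray κ 1 e r)) = ((n : ℝ) - 1) / n * (k r * sk κ r) ^ 2 :=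
    fun r hr => by
      have hx := ray_mem he hε hr
      have h1 := normSq_confKilling_radial hn hε hx (B := B) (k := k) (W := a)
        (by rw [radius_ray he hε hr]; exact hB r hr) ha
      rwa [radius_ray he hε hr] at h1
  have h1n : (n : ℝ) - 1 ≠ 0 := by linarith
  have h3n : (n : ℝ) ≠ 0 := by linarith
  -- the vector equation is an ordinary differential equation for `k`
  have hode : ∀ r ∈ radii κ, HasDerivAt (fun r => k r * sk κ r ^ (n + 1))
      (source n κ τ φ r * sk κ r ^ n) r := fun r hr => by
    have hx := ray_mem he hε hr
    have hs := sk_ne hr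
    have h1 := div₂_confKilling_radial hn hε hx (B := B) (k := k) (W := a) hB
      (by rw [radius_ray he hε hr]; exact hk r hr) ha i₀
    rw [h.div₂_of_solvesWith hS hε hx] at h1
    rw [radius_ray he hε hr, hray] at h1
    have h4 := (one_add_label_mul_ck_pos hε hr).ne'
    have hl := lam_ne hx.1
    have h5 : source n κ τ φ r / sk κ r
        = deriv k r + (n + 1) * (ck κ r / sk κ r) * k r := by
      refine mul_left_cancel₀ ?_ h1
      refine mul_ne_zero (mul_ne_zero (mul_ne_zero one_ne_zero (pow_ne_zero _ hl)) ?_) ?_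
      · exact div_ne_zero (mul_ne_zero two_ne_zero hs) h4
      · exact div_ne_zero h1n h3n
    refine ((hk r hr).mul ((hasDerivAt_sk κ r).pow (n + 1))).congr_deriv ?_
    have h6 : deriv k r = source n κ τ φ r / sk κ r - (n + 1) * (ck κ r / sk κ r) * k r := by
      rw [h5]; ring
    simp only [Pi.pow_apply, Nat.add_sub_cancel]
    rw [h6]
    push_cast
    field_simp
    ring
  have h0 : Tendsto (fun r => k r * sk κ r ^ (n + 1)) (endFilter 1) (𝓝 0) := by
    have h1 := ((continuousOn_normSq₂ hε fun i j =>
      (contDiffOn_confKilling hn hε (hW 1 hε) i j).continuousOn).continuousAt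
      ((isOpen_chartDomain n κ).mem_nhds (zero_mem_chartDomain n κ))).tendsto.comp
      ((tendsto_ray he hε).mono_right nhdsWithin_le_nhds)
    have h2 := (h1.const_mul ((n : ℝ) / (n - 1))).mul ((tendsto_sk_endFilter hε).pow (2 * n))
    rw [zero_pow (by omega), mul_zero] at h2
    have h3 : Tendsto (fun r => (k r * sk κ r ^ (n + 1)) ^ 2) (endFilter 1) (𝓝 0) := by
      refine h2.congr' ?_
      filter_upwards [radii_mem_endFilter hε] with r hr
      simp only [Function.comp]
      rw [hsq r hr]
      field_simp
      ring
    have h4 := (Real.continuous_sqrt.tendsto 0).comp h3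
    rw [Real.sqrt_zero] at h4
    refine (tendsto_zero_iff_abs_tendsto_zero _).2 (h4.congr fun r => ?_)
    simp only [Function.comp, Real.sqrt_sq_eq_abs]
  have hY : EqOn (fun r => k r * sk κ r ^ (n + 1)) (moment n κ (source n κ τ φ)) (radii κ) := by
    refine eq_of_deriv_eq_radii hode (fun r _ => hasDerivAt_moment h.continuous_source r) ?_
    have h1 := h0.sub (tendsto_moment (n := n) (κ := κ) (ε := 1) h.continuous_source
      (by rw [endPoint_one, moment_zero]))
    rwa [sub_zero, endFilter_one] at h1
  intro r hr
  have hx := ray_mem he hε hr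
  have hs := sk_ne hr
  have h1 := h.lichDefect_of_solvesWith hS hε hx
  rw [radialLichnerowicz_iff hr]
  rw [radius_ray he hε hr] at h1
  rw [h1, hsq r hr, ← hY hr]
  field_simp
  ring

end Admissible

/-! ### The divergence theorem for decaying vector fields on `ℝⁿ` -/

section DivergenceTheorem

variable {n : ℕ}

/-- Integration by parts against a compactly supported function. -/
lemma integral_mul_divergence {η : Coord n → ℝ} (hη : ContDiff ℝ 1 η) (hc : HasCompactSupport η)
    {F : Fin n → Coord n → ℝ} (hF : ∀ k, ContDiff ℝ 1 (F k)) :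
    ∫ x, η x * ∑ k, pd k (F k) x = -∫ x, ∑ k, pd k η x * F k x := by
  have hpη : ∀ k, Continuous (pd k η) := fun k =>
    (hη.continuous_fderiv one_ne_zero).clm_apply continuous_const
  have hpF : ∀ k, Continuous (pd k (F k)) := fun k =>
    ((hF k).continuous_fderiv one_ne_zero).clm_apply continuous_const
  have hcp : ∀ k, HasCompactSupport (pd k η) := fun k =>
    hc.fderiv_apply (𝕜 := ℝ) (EuclideanSpace.single k 1)
  have h1 : ∀ k, Integrable (fun x => η x * pd k (F k) x) := fun k =>
    (hη.continuous.mul (hpF k)).integrable_of_hasCompactSupport hc.mul_right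
  have h2 : ∀ k, Integrable (fun x => pd k η x * F k x) := fun k =>
    ((hpη k).mul (hF k).continuous).integrable_of_hasCompactSupport (hcp k).mul_right
  have h3 : ∀ k, Integrable (fun x => η x * F k x) := fun k =>
    (hη.continuous.mul (hF k).continuous).integrable_of_hasCompactSupport hc.mul_right
  simp only [Finset.mul_sum]
  rw [integral_finsetSum _ fun k _ => h1 k, integral_finsetSum _ fun k _ => h2 k,
    ← Finset.sum_neg_distrib]
  exact Finset.sum_congr rfl fun k _ => integral_mul_fderiv_eq_neg_fderiv_mul_of_integrable
    (h2 k) (h1 k) (h3 k) (fun x _ => hη.differentiable one_ne_zero x)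
    (fun x _ => (hF k).differentiable one_ne_zero x)

/-- If a `C¹` vector field on `ℝⁿ` is `O(|x|⁻ⁿ)` and its divergence is integrable, then the
integral of the divergence vanishes. -/
lemma integral_divergence_eq_zero {F : Fin n → Coord n → ℝ} (hF : ∀ k, ContDiff ℝ 1 (F k))
    {C : ℝ} (hC : ∀ k x, 1 ≤ ‖x‖ → |F k x| * ‖x‖ ^ n ≤ C)
    (hint : Integrable fun x => ∑ k, pd k (F k) x) : ∫ x, ∑ k, pd k (F k) x = 0 := by
  let χ : ContDiffBump (0 : Coord n) := ⟨1, 2, one_pos, one_lt_two⟩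
  have hχ : ContDiff ℝ 1 χ := χ.contDiff
  obtain ⟨M, hM⟩ := (hχ.continuous_fderiv one_ne_zero).bounded_above_of_compact_support
    (χ.hasCompactSupport.fderiv (𝕜 := ℝ))
  have hM0 : 0 ≤ M := (norm_nonneg _).trans (hM 0)
  set R : ℕ → ℝ := fun m => m + 1 with hR
  have hR1 : ∀ m, 1 ≤ R m := fun m => by simp [hR]
  have hR0 : ∀ m, 0 < R m := fun m => one_pos.trans_le (hR1 m)
  set η : ℕ → Coord n → ℝ := fun m x => χ ((R m)⁻¹ • x) with hη
  have hηd : ∀ m, ContDiff ℝ 1 (η m) := fun m => hχ.comp (contDiff_const_smul _)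
  have hηc : ∀ m, HasCompactSupport (η m) := fun m =>
    χ.hasCompactSupport.comp_smul (inv_ne_zero (hR0 m).ne')
  have hRt : Tendsto R atTop atTop := tendsto_atTop_add_const_right _ _ tendsto_natCast_atTop_atTop
  -- the cutoff integrals converge to the integral of the divergence
  have hlim : Tendsto (fun m => ∫ x, η m x * ∑ k, pd k (F k) x) atTop
      (𝓝 (∫ x, ∑ k, pd k (F k) x)) := by
    refine tendsto_integral_of_dominated_convergence (fun x => ‖∑ k, pd k (F k) x‖) (fun m => ?_)
      hint.norm (fun m => Eventually.of_forall fun x => ?_) (Eventually.of_forall fun x => ?_)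
    · exact (hηd m).continuous.aestronglyMeasurable.mul hint.aestronglyMeasurable
    · rw [norm_mul]
      refine mul_le_of_le_one_left (norm_nonneg _) ?_
      rw [Real.norm_of_nonneg χ.nonneg]
      exact χ.le_one
    · refine tendsto_const_nhds.congr' ?_
      filter_upwards [hRt.eventually_ge_atTop ‖x‖] with m hm
      have : η m x = 1 := χ.one_of_mem_closedBall (by
        rw [mem_closedBall_zero_iff, norm_smul, norm_inv, Real.norm_of_nonneg (hR0 m).le]
        exact inv_mul_le_one_of_le₀ hm (hR0 m).le)
      rw [this, one_mul]
  -- they are integrals over the annulus `R ≤ |x| ≤ 2R` and tend to `0`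
  have hpd : ∀ m k x, pd k (η m) x = (R m)⁻¹ * pd k χ ((R m)⁻¹ • x) := fun m k x => by
    have h1 : HasFDerivAt (η m) ((fderiv ℝ χ ((R m)⁻¹ • x)).comp
        ((R m)⁻¹ • ContinuousLinearMap.id ℝ (Coord n))) x :=
      (hχ.differentiable one_ne_zero _).hasFDerivAt.comp x
        ((hasFDerivAt_id x).const_smul (R m)⁻¹)
    rw [pd_eq_of_hasFDerivAt h1]
    simp [pd]
  have hsmall : ∀ m k x, ‖x‖ < R m → pd k (η m) x = 0 := fun m k x hx => by
    have h1 : η m =ᶠ[𝓝 x] fun _ => 1 := by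
      filter_upwards [(isOpen_lt continuous_norm continuous_const).mem_nhds hx] with y hy
      refine χ.one_of_mem_closedBall ?_
      rw [mem_closedBall_zero_iff, norm_smul, norm_inv, Real.norm_of_nonneg (hR0 m).le]
      exact inv_mul_le_one_of_le₀ (le_of_lt hy) (hR0 m).le
    rw [pd_congr h1, pd_const]
  have hlarge : ∀ m k x, 2 * R m < ‖x‖ → pd k (η m) x = 0 := fun m k x hx => by
    have h1 : η m =ᶠ[𝓝 x] fun _ => 0 := by
      filter_upwards [(isOpen_lt continuous_const continuous_norm).mem_nhds hx] with y hy
      refine χ.zero_of_le_dist ?_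
      rw [dist_zero_right, norm_smul, norm_inv, Real.norm_of_nonneg (hR0 m).le]
      change 2 ≤ _
      rw [le_inv_mul_iff₀ (hR0 m), mul_comm]
      exact le_of_lt hy
    rw [pd_congr h1, pd_const]
  have hC0 : 0 ≤ max C 0 := le_max_right _ _
  have hbound : ∀ m x, ‖∑ k, pd k (η m) x * F k x‖
      ≤ n * ((R m)⁻¹ * M * (max C 0 * ((R m) ^ n)⁻¹)) := fun m x => by
    refine (norm_sum_le_of_le _ (fun k _ => ?_)).trans_eq
      (by rw [Finset.sum_const, Finset.card_univ, Fintype.card_fin, nsmul_eq_mul])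
    have hRm := hR0 m
    rcases lt_or_ge ‖x‖ (R m) with hx | hx
    · rw [hsmall m k x hx, zero_mul, norm_zero]
      positivity
    · rw [norm_mul]
      have h1 : ‖pd k (η m) x‖ ≤ (R m)⁻¹ * M := by
        rw [hpd, norm_mul, norm_inv, Real.norm_of_nonneg (hR0 m).le]
        gcongr
        refine (ContinuousLinearMap.le_opNorm _ _).trans ?_
        simpa using hM _
      have h2 : ‖F k x‖ ≤ max C 0 * ((R m) ^ n)⁻¹ := by
        rw [← div_eq_mul_inv, le_div_iff₀ (by positivity), Real.norm_eq_abs]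
        calc |F k x| * R m ^ n ≤ |F k x| * ‖x‖ ^ n := by gcongr
          _ ≤ C := hC k x ((hR1 m).trans hx)
          _ ≤ max C 0 := le_max_left _ _
      gcongr
  have hzero : Tendsto (fun m => -∫ x, ∑ k, pd k (η m) x * F k x) atTop (𝓝 0) := by
    rw [← neg_zero]
    refine Tendsto.neg ?_
    set K : ℝ := n * (M * max C 0) * (2 ^ n * (volume : Measure (Coord n)).real (Metric.closedBall 0 1))
    have hK : Tendsto (fun m => K * (R m)⁻¹) atTop (𝓝 0) := by
      have := (tendsto_inv_atTop_zero.comp hRt).const_mul K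
      rwa [mul_zero] at this
    refine squeeze_zero_norm (fun m => ?_) hK
    have hRm := hR0 m
    rw [← setIntegral_eq_integral_of_forall_compl_eq_zero (s := Metric.closedBall 0 (2 * R m))]
    · refine (norm_setIntegral_le_of_norm_le_const
        (measure_closedBall_lt_top) (fun x _ => hbound m x)).trans_eq ?_
      have hv : (volume : Measure (Coord n)).real (Metric.closedBall 0 (2 * R m))
          = (2 * R m) ^ n * (volume : Measure (Coord n)).real (Metric.closedBall 0 1) := by
        rw [Measure.real, Measure.addHaar_closedBall' _ _ (by positivity), ENNReal.toReal_mul,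
          ENNReal.toReal_ofReal (by positivity), Measure.real, finrank_euclideanSpace_fin]
      rw [hv]
      simp only [K]
      field_simp
      ring_nf
    · intro x hx
      rw [mem_closedBall_zero_iff, not_le] at hx
      simp [hlarge m _ x hx]
  have heq : ∀ m, ∫ x, η m x * ∑ k, pd k (F k) x = -∫ x, ∑ k, pd k (η m) x * F k x := fun m =>
    integral_mul_divergence (hηd m) (hηc m) hF
  simp only [heq] at hlim
  exact tendsto_nhds_unique hlim hzero

end DivergenceTheorem

/-! ### Decay in the stereographic chart of the sphere -/

section Decay

variable {n : ℕ} {x : Coord n}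

lemma chartDomain_one (x : Coord n) : x ∈ chartDomain n 1 := by
  simp only [chartDomain, mem_ofPred_eq, SignType.coe_one]
  positivity

lemma lam_one (x : Coord n) : lam 1 x = (1 + ‖x‖ ^ 2 / 4)⁻¹ := by
  simp only [lam, SignType.coe_one]
  ring_nf

lemma lam_mul_norm_sq_le (x : Coord n) : lam 1 x * ‖x‖ ^ 2 ≤ 4 := by
  rw [lam_one, inv_mul_le_iff₀ (by positivity)]
  nlinarith

lemma contDiff_lam_one {k : ℕ∞ω} : ContDiff ℝ k (lam (n := n) 1) :=
  contDiffOn_univ.1 (contDiffOn_lam.mono fun x _ => chartDomain_one x)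

/-- The volume of the sphere is finite. -/
lemma integrable_lam_pow (hn : n ≠ 0) : Integrable fun x : Coord n => lam 1 x ^ n := by
  have h1 : Integrable fun x : Coord n => (8 : ℝ) ^ n * (1 + ‖x‖) ^ (-(2 * n : ℝ)) := by
    refine (integrable_one_add_norm ?_).const_mul _
    rw [finrank_euclideanSpace_fin]
    have : (0 : ℝ) < n := by positivity
    linarith
  refine h1.mono' ((contDiff_lam_one (k := 0)).continuous.pow n).aestronglyMeasurable
    (Eventually.of_forall fun x => ?_)
  have hp := lam_pos (chartDomain_one x)
  rw [Real.norm_of_nonneg (by positivity), Real.rpow_neg (by positivity),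
    show (2 * n : ℝ) = ((2 * n : ℕ) : ℝ) by push_cast; ring, Real.rpow_natCast, pow_mul, ← inv_pow,
    ← mul_pow]
  gcongr
  rw [lam_one, ← div_eq_mul_inv, le_div_iff₀ (by positivity), inv_mul_le_iff₀ (by positivity)]
  nlinarith [sq_nonneg (‖x‖ - 1), norm_nonneg x]

lemma lam_pow_mul_norm_pow_le {p q : ℕ} (hpq : q ≤ 2 * p) (hx : 1 ≤ ‖x‖) :
    lam 1 x ^ p * ‖x‖ ^ q ≤ 4 ^ p := by
  have hp := lam_pos (chartDomain_one x)
  calc lam 1 x ^ p * ‖x‖ ^ q ≤ lam 1 x ^ p * ‖x‖ ^ (2 * p) := by gcongr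
    _ = (lam 1 x * ‖x‖ ^ 2) ^ p := by rw [mul_pow, pow_mul]
    _ ≤ 4 ^ p := by gcongr; exact lam_mul_norm_sq_le x

/-- The stereographic charts are exchanged by the inversion in the sphere of radius `2`. -/
lemma param_inversion (hx : x ≠ 0) :
    param n 1 (-1) (EuclideanGeometry.inversion 0 2 x) = param n 1 1 x := by
  have hn : ‖x‖ ≠ 0 := norm_ne_zero_iff.2 hx
  have h1 : EuclideanGeometry.inversion 0 2 x = (4 / ‖x‖ ^ 2) • x := by
    rw [EuclideanGeometry.inversion]
    simp only [dist_zero_right, vsub_eq_sub, sub_zero, vadd_eq_add, add_zero, div_pow]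
    norm_num
  have h2 : ‖(4 / ‖x‖ ^ 2) • x‖ ^ 2 = 16 / ‖x‖ ^ 2 := by
    rw [norm_smul, mul_pow, Real.norm_of_nonneg (by positivity)]
    field_simp
    norm_num
  have h3 : 1 + ‖x‖ ^ 2 / 4 ≠ 0 := by positivity
  have h4 : 1 + 16 / ‖x‖ ^ 2 / 4 ≠ 0 := by positivity
  rw [h1]
  refine Prod.ext ?_ ?_
  · rw [param_fst (chartDomain_one _), param_fst (chartDomain_one _), lam_one, lam_one, h2]
    field_simp
    ring
  · rw [param_snd, param_snd, lam_one, lam_one, h2, smul_smul]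
    congr 1
    field_simp
    ring

/-- A continuous 1-form on the sphere has bounded length. -/
lemma exists_bound_formComp {W : Ambient n → (Ambient n →L[ℝ] ℝ)} (hW : IsCkForm 1 2 W) :
    ∃ C, ∀ x i, |formComp 1 1 W x i| ≤ C * lam 1 x := by
  have hcont : ∀ ε ∈ chartLabels 1, ∀ i, Continuous fun x => formComp 1 ε W x i := fun ε hε i =>
    continuousOn_univ.1 ((hW ε hε i).continuousOn.mono fun x _ => chartDomain_one x)
  have hb : ∀ ε ∈ chartLabels 1, ∃ C, 0 ≤ C ∧ ∀ x : Coord n, ‖x‖ ≤ 2 → ∀ i,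
      |formComp 1 ε W x i| ≤ C := fun ε hε => by
    have hc : Continuous fun x => ∑ i, |formComp 1 ε W x i| :=
      continuous_finsetSum _ fun i _ => (hcont ε hε i).abs
    obtain ⟨C, hC⟩ := (isCompact_closedBall (0 : Coord n) 2).exists_bound_of_continuousOn
      hc.continuousOn
    refine ⟨max C 0, le_max_right _ _, fun x hx i => ?_⟩
    refine le_trans ?_ ((le_abs_self _).trans ((hC x (by simpa using hx)).trans (le_max_left _ _)))
    exact Finset.single_le_sum (f := fun i => |formComp 1 ε W x i|)
      (fun i _ => abs_nonneg _) (Finset.mem_univ i)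
  obtain ⟨C₁, hC₁0, hC₁⟩ := hb 1 (one_mem_chartLabels 1)
  obtain ⟨C₂, hC₂0, hC₂⟩ := hb (-1) neg_one_mem_chartLabels
  refine ⟨2 * C₁ + 2 * (n * C₂), fun x i => ?_⟩
  have hl := lam_pos (chartDomain_one x)
  have hlam : lam 1 x * (1 + ‖x‖ ^ 2 / 4) = 1 := by
    rw [lam_one]; exact inv_mul_cancel₀ (by positivity)
  rcases le_total ‖x‖ 2 with hx | hx
  · have h1 := hC₁ x hx i
    have h2 : 1 ≤ 2 * lam 1 x := by nlinarith [norm_nonneg x]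
    have h3 : 0 ≤ n * C₂ := by positivity
    nlinarith
  · have hx0 : x ≠ 0 := fun h => by rw [h, norm_zero] at hx; norm_num at hx
    have hxp : 0 < ‖x‖ := norm_pos_iff.2 hx0
    set y := EuclideanGeometry.inversion (0 : Coord n) 2 x with hy
    set v : Coord n := fderiv ℝ (EuclideanGeometry.inversion (0 : Coord n) 2) x
      (EuclideanSpace.single i 1) with hv
    have hι := EuclideanGeometry.hasFDerivAt_inversion (c := (0 : Coord n)) (R := 2) hx0
    have hvn : ‖v‖ ≤ 4 / ‖x‖ ^ 2 := by
      rw [hv, hι.fderiv]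
      simp only [smul_apply, norm_smul, dist_zero_right]
      simp [div_pow]
      norm_num
    have hyn : ‖y‖ ≤ 2 := by
      have h1 : dist y 0 = 2 ^ 2 / dist x 0 :=
        EuclideanGeometry.dist_inversion_center (0 : Coord n) x 2
      rw [dist_zero_right, dist_zero_right] at h1
      rw [h1, div_le_iff₀ hxp]
      linarith
    have hcoord : coordVec n 1 1 x i = ∑ j, v j • coordVec n 1 (-1) y j := by
      have h1 : HasFDerivAt (fun z => param n 1 (-1) (EuclideanGeometry.inversion 0 2 z))
          ((fderiv ℝ (param n 1 (-1)) y).comp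
            (fderiv ℝ (EuclideanGeometry.inversion (0 : Coord n) 2) x)) x :=
        HasFDerivAt.comp (g := param n 1 (-1)) x (hasFDerivAt_param (chartDomain_one y)).differentiableAt.hasFDerivAt
          hι.differentiableAt.hasFDerivAt
      have h2 : param n 1 1 =ᶠ[𝓝 x] fun z => param n 1 (-1) (EuclideanGeometry.inversion 0 2 z) := by
        filter_upwards [isOpen_ne.mem_nhds hx0] with z hz using (param_inversion hz).symm
      rw [coordVec, h2.fderiv_eq, h1.fderiv, ContinuousLinearMap.comp_apply, ← hv]
      have h3 : v = ∑ j, v j • EuclideanSpace.single j (1 : ℝ) := by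
        ext j; simp [Finset.sum_apply, Pi.single_apply]
      conv_lhs => rw [h3, map_sum]
      simp only [map_smul, coordVec]
    have h4 : formComp 1 1 W x i = ∑ j, v j * formComp 1 (-1) W y j := by
      rw [formComp, hcoord, map_sum, ← param_inversion hx0]
      simp only [map_smul, smul_eq_mul, formComp, ← hy]
    rw [h4]
    have h5 : |∑ j, v j * formComp 1 (-1) W y j| ≤ n * (4 / ‖x‖ ^ 2 * C₂) := by
      refine (Finset.abs_sum_le_sum_abs _ _).trans ((Finset.sum_le_sum fun j _ => ?_).trans_eq
        (by rw [Finset.sum_const, Finset.card_univ, Fintype.card_fin, nsmul_eq_mul]))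
      rw [abs_mul]
      have h6 := (PiLp.norm_apply_le v j).trans hvn
      rw [Real.norm_eq_abs] at h6
      have := hC₂ y hyn j
      gcongr
    refine h5.trans ?_
    have h7 : 4 / ‖x‖ ^ 2 ≤ 2 * lam 1 x := by
      rw [div_le_iff₀ (by positivity)]
      nlinarith
    have h8 : n * (4 / ‖x‖ ^ 2 * C₂) ≤ n * (2 * lam 1 x * C₂) := by gcongr
    have h9 : 0 ≤ C₁ * lam 1 x := by positivity
    linarith

end Decay

/-! ### Integrals over the sphere -/

section SphereIntegrals

variable {n : ℕ} {κ : SignType} {ε : ℝ} {x : Coord n}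

lemma radius_one_eq (x : Coord n) :
    radius 1 (param n 1 1 x) = 2 * Real.arctan (‖x‖ / 2) := by
  have h0 : 0 ≤ Real.arctan (‖x‖ / 2) := Real.arctan_nonneg.2 (by positivity)
  have h1 := Real.arctan_lt_pi_div_two (‖x‖ / 2)
  have h2 : (param n 1 1 x).1 = Real.cos (2 * Real.arctan (‖x‖ / 2)) := by
    rw [param_fst (chartDomain_one x), Real.cos_two_mul, Real.cos_sq_arctan, lam_one]
    ring
  change Real.arccos (param n 1 1 x).1 = _
  rw [h2, Real.arccos_cos (by linarith) (by linarith)]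

lemma exists_bound_Icc {f : ℝ → ℝ} (hf : Continuous f) (a b : ℝ) :
    ∃ C, 0 ≤ C ∧ ∀ r ∈ Icc a b, |f r| ≤ C := by
  obtain ⟨C, hC⟩ := isCompact_Icc.exists_bound_of_continuousOn (s := Icc a b) hf.continuousOn
  exact ⟨max C 0, le_max_right _ _, fun r hr => (hC r hr).trans (le_max_left _ _)⟩

lemma radius_one_mem_Icc (x : Coord n) : radius 1 (param n 1 1 x) ∈ Icc 0 Real.pi :=
  ⟨Real.arccos_nonneg _, Real.arccos_le_pi _⟩

/-- Integration in polar coordinates: up to the volume of the unit sphere, `∫₀^π m sinⁿ` is the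
integral of `m(r) sin(r)` over the sphere, here expressed in the stereographic chart. -/
lemma moment_pi_eq_zero {m : ℝ → ℝ} (hn : n ≠ 0) (hm : Continuous m)
    (h : ∫ x : Coord n, lam 1 x ^ n
      * (m (radius 1 (param n 1 1 x)) * sk 1 (radius 1 (param n 1 1 x))) = 0) :
    moment n 1 m Real.pi = 0 := by
  have : Nonempty (Fin n) := ⟨⟨0, Nat.pos_of_ne_zero hn⟩⟩
  set R : ℝ → ℝ := fun t => 2 * Real.arctan (t / 2) with hR
  set l : ℝ → ℝ := fun t => (1 + (t / 2) ^ 2)⁻¹ with hl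
  have hlp : ∀ t, 0 < l t := fun t => by simp only [hl]; positivity
  have hsR : ∀ t, sk 1 (R t) = l t * t := fun t => by
    change Real.sin (2 * Real.arctan (t / 2)) = _
    rw [Real.sin_two_mul, Real.sin_arctan, Real.cos_arctan]
    have h1 : √(1 + (t / 2) ^ 2) ≠ 0 := by positivity
    have h2 : √(1 + (t / 2) ^ 2) ^ 2 = 1 + (t / 2) ^ 2 := Real.sq_sqrt (by positivity)
    change _ = (1 + (t / 2) ^ 2)⁻¹ * t
    generalize √(1 + (t / 2) ^ 2) = q at h1 h2 ⊢
    rw [← h2]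
    field_simp
  have hfun : ∀ x : Coord n, lam 1 x ^ n
      * (m (radius 1 (param n 1 1 x)) * sk 1 (radius 1 (param n 1 1 x)))
      = (fun t => l t ^ n * (m (R t) * (l t * t))) ‖x‖ := fun x => by
    have h1 : lam 1 x = l ‖x‖ := by rw [lam_one]; simp only [hl]; ring_nf
    rw [radius_one_eq, h1]
    change l ‖x‖ ^ n * (m (R ‖x‖) * sk 1 (R ‖x‖)) = _
    rw [hsR]
  simp_rw [hfun] at h
  rw [integral_fun_norm_addHaar volume fun t => l t ^ n * (m (R t) * (l t * t)), finrank_euclideanSpace_fin] at h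
  have hvol : (volume : Measure (Coord n)).real (Metric.ball 0 1) ≠ 0 :=
    (ENNReal.toReal_pos (Metric.measure_ball_pos _ _ one_pos).ne' measure_ball_lt_top.ne).ne'
  replace h := (smul_eq_zero.1 ((smul_eq_zero.1 h).resolve_left hn)).resolve_left hvol
  have hRd : ∀ t, HasDerivAt R (l t) t := fun t => by
    have := ((hasDerivAt_id t).div_const 2).arctan.const_mul 2
    refine this.congr_deriv ?_
    simp only [hl, id]
    field_simp
  have hRt : Tendsto R atTop (𝓝 Real.pi) := by
    have h1 := ((tendsto_nhdsWithin_iff.1 Real.tendsto_arctan_atTop).1.comp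
      (tendsto_id.atTop_div_const (two_pos : (0 : ℝ) < 2))).const_mul 2
    rwa [mul_div_cancel₀ Real.pi two_ne_zero] at h1
  have hint : IntegrableOn (fun t => m (R t) * sk 1 (R t) ^ n * l t) (Ioi 0) := by
    obtain ⟨C, -, hC⟩ := exists_bound_Icc hm 0 Real.pi
    have h1 : Integrable fun t : ℝ => C * l t :=
      ((integrable_inv_one_add_sq.comp_div (two_ne_zero)).const_mul C)
    have hRc : Continuous R := continuous_iff_continuousAt.2 fun t => (hRd t).continuousAt
    have hlc : Continuous l := by
      refine Continuous.inv₀ (by fun_prop) fun t => ?_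
      positivity
    refine h1.integrableOn.mono' (((hm.comp hRc).mul
      (((continuous_sk 1).comp hRc).pow n)).mul hlc).aestronglyMeasurable ?_
    refine (ae_restrict_mem measurableSet_Ioi).mono fun t ht => ?_
    have ht0 : (0 : ℝ) < t := ht
    rw [norm_mul, norm_mul, norm_pow, Real.norm_of_nonneg (hlp t).le, Real.norm_eq_abs,
      Real.norm_eq_abs]
    have h2 : |m (R t)| ≤ C := by
      refine hC _ ⟨?_, ?_⟩
      · have : 0 ≤ Real.arctan (t / 2) := Real.arctan_nonneg.2 (by positivity)
        simp only [hR]; linarith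
      · have := Real.arctan_lt_pi_div_two (t / 2)
        simp only [hR]; linarith
    have h3 : |sk 1 (R t)| ^ n ≤ 1 :=
      pow_le_one₀ (abs_nonneg _) (Real.abs_sin_le_one _)
    have h4 : |m (R t)| * |sk 1 (R t)| ^ n ≤ C * 1 :=
      mul_le_mul h2 h3 (by positivity) ((abs_nonneg _).trans h2)
    rw [mul_one] at h4
    exact mul_le_mul_of_nonneg_right h4 (hlp t).le
  have h1 := integral_Ioi_of_hasDerivAt_of_tendsto' (a := 0)
    (fun t _ => (hasDerivAt_moment (n := n) (κ := 1) hm (R t)).comp t (hRd t)) hint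
    (((continuous_moment (n := n) (κ := 1) hm).tendsto _).comp hRt)
  have h2 : moment n 1 m (R 0) = 0 := by simp [hR, moment_zero]
  simp only [Function.comp, h2, sub_zero] at h1
  rw [← h1]
  refine Eq.trans ?_ h
  refine setIntegral_congr_fun measurableSet_Ioi fun t _ => ?_
  obtain ⟨p, rfl⟩ := Nat.exists_eq_succ_of_ne_zero hn
  simp only [smul_eq_mul, hsR, Nat.succ_eq_add_one, Nat.add_sub_cancel]
  ring

lemma pd_lam_pow (hx : x ∈ chartDomain n κ) (p : ℕ) (i : Fin n) :
    pd i (fun y => lam κ y ^ p) x = p * dlog κ i x * lam κ x ^ p := by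
  induction p with
  | zero => simp [pd_const]
  | succ p ih =>
    simp only [pow_succ]
    rw [pd_mul ((differentiableAt_lam hx).fun_pow p) (differentiableAt_lam hx), ih, pd_lam hx]
    push_cast
    ring

/-- The divergence of the 1-form `T(X, ·)`, for a symmetric trace-free tensor `T` and a vector
field `X`, multiplied by the volume density. -/
lemma sum_pd_contraction (hn : 2 ≤ n) (hε : ε ∈ chartLabels κ) (hx : x ∈ chartDomain n κ)
    {T : Coord n → Fin n → Fin n → ℝ} {X : Coord n → Fin n → ℝ}
    (hTd : ∀ i j, DifferentiableAt ℝ (fun y => T y i j) x)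
    (hXd : ∀ j, DifferentiableAt ℝ (fun y => X y j) x)
    (hT : ∀ i j, T x i j = T x j i) (hT' : ∑ i, T x i i = 0) :
    ∑ k, pd k (fun y => lam κ y ^ (n - 2) * ∑ j, T y k j * X y j) x
      = lam κ x ^ n * ∑ j, div₂ (metric n κ ε) T x j * X x j
        + lam κ x ^ (n - 2) * ∑ k, ∑ j, T x k j * pd k (fun y => X y j) x := by
  obtain ⟨p, rfl⟩ := Nat.exists_eq_add_of_le' hn
  have hl := lam_ne hx
  have h1 : ∀ k, pd k (fun y => lam κ y ^ p * ∑ j, T y k j * X y j) x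
      = ∑ j, (lam κ x ^ p * (pd k (fun y => T y k j) x + p * (dlog κ k x * T x k j)) * X x j
        + lam κ x ^ p * (T x k j * pd k (fun y => X y j) x)) := fun k => by
    rw [pd_mul ((differentiableAt_lam hx).fun_pow p)
      (DifferentiableAt.fun_sum fun j _ => (hTd k j).fun_mul (hXd j)), pd_lam_pow hx,
      pd_sum fun j _ => (hTd k j).fun_mul (hXd j), Finset.mul_sum, Finset.mul_sum,
      ← Finset.sum_add_distrib]
    refine Finset.sum_congr rfl fun j _ => ?_
    rw [pd_mul (hTd k j) (hXd j)]
    ring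
  simp only [Nat.add_sub_cancel]
  rw [Finset.sum_congr rfl fun k _ => h1 k]
  simp only [Finset.sum_add_distrib, Finset.mul_sum]
  congr 1
  rw [Finset.sum_comm]
  refine Finset.sum_congr rfl fun j _ => ?_
  simp only [mul_add, add_mul]
  rw [div₂_eq hε hx T hT hT', Finset.sum_add_distrib, ← Finset.sum_mul, ← Finset.sum_mul,
    ← Finset.mul_sum, ← Finset.mul_sum,
    ← Finset.mul_sum]
  push_cast
  field_simp
  ring

/-- Polarized form of the identity `2 T(·, ∇u) = T(·, Lu)` for symmetric trace-free `T`. -/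
lemma sum_contraction_pd (hn : n ≠ 0) (hε : ε ∈ chartLabels κ) (hx : x ∈ chartDomain n κ)
    {T : Fin n → Fin n → ℝ} {u : Coord n → Fin n → ℝ}
    (hu : ∀ j, DifferentiableAt ℝ (fun y => u y j) x)
    (hT : ∀ i j, T i j = T j i) (hT' : ∑ i, T i i = 0) :
    ∑ k, ∑ j, T k j * pd k (fun y => u y j * (lam κ y ^ 2)⁻¹) x
      = (lam κ x ^ 2)⁻¹ * (1 / 2)
        * ∑ k, ∑ j, T k j * confKilling (metric n κ ε) u x k j := by
  have hl := lam_ne hx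
  have hinv : ∀ k, pd k (fun y => (lam κ y ^ 2)⁻¹) x = -2 * dlog κ k x * (lam κ x ^ 2)⁻¹ :=
    fun k => by
      rw [pd_comp (f := fun t => t⁻¹) (hasDerivAt_inv (pow_ne_zero 2 hl))
        ((differentiableAt_lam hx).fun_pow 2), pd_lam_pow hx]
      push_cast
      field_simp
  have h1 : ∀ k j, pd k (fun y => u y j * (lam κ y ^ 2)⁻¹) x
      = (lam κ x ^ 2)⁻¹ * (pd k (fun y => u y j) x - 2 * dlog κ k x * u x j) := fun k j => by
    rw [pd_mul (hu j) (((differentiableAt_lam hx).fun_pow 2).fun_inv (pow_ne_zero 2 hl)), hinv]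
    ring
  set A : Fin n → Fin n → ℝ := fun k j => pd k (fun y => u y j) x - 2 * dlog κ k x * u x j
  have hA : ∑ k, ∑ j, T k j * A j k = ∑ k, ∑ j, T k j * A k j := by
    rw [Finset.sum_comm]
    simp only [hT]
  have h2 : ∀ k j, T k j * confKilling (metric n κ ε) u x k j = T k j * A k j + T k j * A j k
      - (2 / (n : ℝ) * ((∑ k, pd k (fun y => u y k) x) - 2 * ∑ k, dlog κ k x * u x k))
        * (if k = j then T k j else 0) := fun k j => by
    rw [confKilling_eq hn hε hx]
    simp only [A]
    split_ifs <;> ring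
  simp only [h1, h2, Finset.sum_sub_distrib, Finset.sum_add_distrib, ← Finset.mul_sum, hA,
    Finset.sum_ite_eq, Finset.mem_univ, if_true, hT']
  have h3 : ∑ k, ∑ j, T k j * ((lam κ x ^ 2)⁻¹ * (pd k (fun y => u y j) x
      - 2 * dlog κ k x * u x j)) = (lam κ x ^ 2)⁻¹ * ∑ k, ∑ j, T k j * A k j := by
    simp only [Finset.mul_sum, A]
    exact Finset.sum_congr rfl fun _ _ => Finset.sum_congr rfl fun _ _ => by ring
  rw [h3]
  ring

lemma confKilling_sub (hn : n ≠ 0) (hε : ε ∈ chartLabels κ) (hx : x ∈ chartDomain n κ)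
    {a b : Coord n → Fin n → ℝ} (ha : ∀ j, DifferentiableAt ℝ (fun y => a y j) x)
    (hb : ∀ j, DifferentiableAt ℝ (fun y => b y j) x) (i j : Fin n) :
    confKilling (metric n κ ε) (fun y k => a y k - b y k) x i j
      = confKilling (metric n κ ε) a x i j - confKilling (metric n κ ε) b x i j := by
  rw [confKilling_eq hn hε hx, confKilling_eq hn hε hx, confKilling_eq hn hε hx]
  simp only [pd_sub (ha _) (hb _), mul_sub, Finset.sum_sub_distrib]
  ring

lemma div₂_sub (hε : ε ∈ chartLabels κ) (hx : x ∈ chartDomain n κ)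
    {S T : Coord n → Fin n → Fin n → ℝ} (hS : ∀ i j, S x i j = S x j i)
    (hS' : ∑ i, S x i i = 0) (hT : ∀ i j, T x i j = T x j i) (hT' : ∑ i, T x i i = 0)
    (hSd : ∀ i j, DifferentiableAt ℝ (fun y => S y i j) x)
    (hTd : ∀ i j, DifferentiableAt ℝ (fun y => T y i j) x) (j : Fin n) :
    div₂ (metric n κ ε) (fun y k l => S y k l - T y k l) x j
      = div₂ (metric n κ ε) S x j - div₂ (metric n κ ε) T x j := by
  rw [div₂_eq hε hx S hS hS', div₂_eq hε hx T hT hT', div₂_eq hε hx _ (fun i j => by rw [hS, hT])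
    (by rw [Finset.sum_sub_distrib, hS', hT', sub_zero])]
  simp only [pd_sub (hSd _ _) (hTd _ _), mul_sub, Finset.sum_sub_distrib]
  ring

lemma abs_le_of_normSq₂_le {C : ℝ} (hε : ε ∈ chartLabels κ) (hx : x ∈ chartDomain n κ)
    {T : Fin n → Fin n → ℝ} (h : normSq₂ (metric n κ ε) x T ≤ C) (i j : Fin n) :
    |T i j| ≤ √C * lam κ x ^ 2 := by
  have hl := lam_pos hx
  rw [normSq₂_eq hε hx, inv_mul_le_iff₀ (by positivity)] at h
  have h1 : T i j ^ 2 ≤ ∑ i, ∑ j, T i j ^ 2 :=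
    (Finset.single_le_sum (f := fun j => T i j ^ 2) (fun _ _ => sq_nonneg _)
      (Finset.mem_univ j)).trans (Finset.single_le_sum (f := fun i => ∑ j, T i j ^ 2)
        (fun _ _ => Finset.sum_nonneg fun _ _ => sq_nonneg _) (Finset.mem_univ i))
  have h2 := Real.abs_le_sqrt (h1.trans h)
  rwa [Real.sqrt_mul (by positivity), show lam κ x ^ 4 = (lam κ x ^ 2) ^ 2 by ring,
    Real.sqrt_sq (by positivity), mul_comm] at h2

end SphereIntegrals

/-! ### Solutions on the sphere -/

namespace Admissible

variable {n : ℕ} {V ψ ρ τ φ : ℝ → ℝ} {W : Ambient n → (Ambient n →L[ℝ] ℝ)}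

lemma exists_bound_lichDefect (h : Admissible n 1 V ψ ρ τ φ) :
    ∃ C, ∀ r ∈ radii 1, |lichDefect n 1 V ψ ρ τ φ r| ≤ C := by
  obtain ⟨a, ha⟩ := h.tendsto_lichDefect (one_mem_chartLabels 1)
  obtain ⟨b, hb⟩ := h.tendsto_lichDefect neg_one_mem_chartLabels
  rw [endFilter_one] at ha
  rw [endFilter_neg_one] at hb
  have hc := h.continuousOn_lichDefect
  rw [radii_one] at hc ⊢
  obtain ⟨C, hC⟩ := isCompact_Icc.exists_bound_of_continuousOn
    (continuousOn_Icc_extendFrom_Ioo hc ha hb)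
  refine ⟨C, fun r hr => ?_⟩
  have h1 := hC r (Ioo_subset_Icc_self hr)
  rwa [extendFrom_eq (subset_closure hr) (hc r hr).tendsto, Real.norm_eq_abs] at h1

/-- On the sphere, the Lichnerowicz equation bounds `|LW|`. -/
lemma exists_bound_confKilling (h : Admissible n 1 V ψ ρ τ φ)
    (hS : SolvesWith 1 V (radial n 1 ψ) (radial n 1 ρ) (radial n 1 τ) (fun _ => 0) (radial n 1 φ) W)
    (hW : IsCkForm 1 2 W) :
    ∃ C, 0 ≤ C ∧ ∀ x i j, |confKilling (metric n 1 1) (formComp 1 1 W) x i j|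
      ≤ C * lam 1 x ^ 2 := by
  have hn := h.n_ne_zero
  have hε := one_mem_chartLabels 1
  obtain ⟨C, hC⟩ := h.exists_bound_lichDefect
  refine ⟨√C, Real.sqrt_nonneg _, ?_⟩
  have hp : ∀ x ∈ punctured n 1, ∀ i j, |confKilling (metric n 1 1) (formComp 1 1 W) x i j|
      ≤ √C * lam 1 x ^ 2 := fun x hx => by
    refine abs_le_of_normSq₂_le hε hx.1 ?_
    have h1 := (le_abs_self _).trans (hC _ (radius_mem hε hx.1 hx.2))
    rw [h.lichDefect_of_solvesWith hS hε hx] at h1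
    refine le_trans ?_ h1
    have h2 : 0 ≤ normSq₂ (metric n 1 1) x (confKilling (metric n 1 1) (formComp 1 1 W) x) := by
      have := lam_pos hx.1
      rw [normSq₂_eq hε hx.1]
      positivity
    have h3 := h.three_le_cast
    refine le_mul_of_one_le_left h2 ?_
    rw [one_le_div (by linarith)]
    linarith
  intro x i j
  by_cases hx : x = 0
  · subst hx
    -- the bound extends to the centre of the chart by continuity
    have hne := neBot_punctured_nhds_zero hn
    have hc : Continuous fun x => confKilling (metric n 1 1) (formComp 1 1 W) x i j :=
      continuousOn_univ.1 ((contDiffOn_confKilling hn hε (hW 1 hε) i j).continuousOn.mono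
        fun x _ => chartDomain_one x)
    have hl : Continuous fun x : Coord n => √C * lam 1 x ^ 2 :=
      continuous_const.mul ((contDiff_lam_one (k := 0)).continuous.pow 2)
    refine le_of_tendsto_of_tendsto (b := 𝓝[≠] (0 : Coord n)) ((hc.abs.tendsto 0).mono_left nhdsWithin_le_nhds)
      ((hl.tendsto 0).mono_left nhdsWithin_le_nhds) ?_
    filter_upwards [eventually_punctured n 1] with x hx using hp x hx i j
  · exact hp x ⟨chartDomain_one x, hx⟩ i j

/-- The conformal Killing field `x ∂ₓ` tests the vector equation on the sphere, and shows that
`∫ m sinⁿ = 0`: the radial solution of the vector equation is regular at the antipode. -/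
lemma moment_pi (h : Admissible n 1 V ψ ρ τ φ)
    (hS : SolvesWith 1 V (radial n 1 ψ) (radial n 1 ρ) (radial n 1 τ) (fun _ => 0) (radial n 1 φ) W)
    (hW : IsCkForm 1 2 W) : moment n 1 (source n 1 τ φ) Real.pi = 0 := by
  have hn := h.n_ne_zero
  have hn3 := h.three_le
  have hn3' := h.three_le_cast
  have hε := one_mem_chartLabels 1
  have hm := h.continuous_source
  obtain ⟨C, hC0, hC⟩ := h.exists_bound_confKilling hS hW
  obtain ⟨M, hM0, hM⟩ := exists_bound_Icc hm 0 Real.pi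
  set S := confKilling (metric n 1 1) (formComp 1 1 W) with hSdef
  have hScd : ∀ i j, ContDiff ℝ 1 fun x => S x i j := fun i j =>
    contDiffOn_univ.1 ((contDiffOn_confKilling hn hε (hW 1 hε) i j).mono
      fun x _ => chartDomain_one x)
  set F : Fin n → Coord n → ℝ := fun k y => lam 1 y ^ (n - 2) * ∑ j, S y k j * y j with hF
  have hdiv : ∀ x, ∑ k, pd k (F k) x = ((n : ℝ) - 1) / n * (lam 1 x ^ n
      * (source n 1 τ φ (radius 1 (param n 1 1 x)) * sk 1 (radius 1 (param n 1 1 x)))) := fun x => by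
    have hx := chartDomain_one x
    simp only [hF]
    rw [sum_pd_contraction (by omega) hε hx (T := S) (X := fun y j => y j)
      (fun i j => (hScd i j).differentiable one_ne_zero x) (fun j => differentiableAt_coord j x)
      (confKilling_symm _ hn hε hx) (confKilling_trace _ hn hε hx)]
    have h1 : ∑ k, ∑ j, S x k j * pd k (fun y => y j) x = 0 := by
      simp only [pd_coord, mul_ite, mul_one, mul_zero, Finset.sum_ite_eq, Finset.mem_univ, if_true]
      exact confKilling_trace _ hn hε hx
    rw [h1, mul_zero, add_zero]
    by_cases hx0 : x = 0
    · subst hx0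
      simp [radius_param_zero hε, endPoint_one, sk_zero]
    · have hs := sk_ne (radius_mem hε hx hx0)
      simp only [hSdef, h.div₂_of_solvesWith hS hε ⟨hx, hx0⟩]
      have h2 : ∀ j, 1 * lam 1 x ^ 2 * x j * (((n : ℝ) - 1) / n)
          * (source n 1 τ φ (radius 1 (param n 1 1 x)) / sk 1 (radius 1 (param n 1 1 x))) * x j
          = (lam 1 x ^ 2 * (((n : ℝ) - 1) / n) * (source n 1 τ φ (radius 1 (param n 1 1 x))
            / sk 1 (radius 1 (param n 1 1 x)))) * x j ^ 2 := fun j => by ring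
      simp only [h2, ← Finset.mul_sum, ← norm_sq_eq]
      have h3 : lam 1 x ^ 2 * ‖x‖ ^ 2 = sk 1 (radius 1 (param n 1 1 x)) ^ 2 := by
        rw [sk_radius hε hx, mul_pow]
      rw [show lam 1 x ^ 2 * (((n : ℝ) - 1) / n) * (source n 1 τ φ (radius 1 (param n 1 1 x))
        / sk 1 (radius 1 (param n 1 1 x))) * ‖x‖ ^ 2 = (lam 1 x ^ 2 * ‖x‖ ^ 2)
          * (((n : ℝ) - 1) / n) * (source n 1 τ φ (radius 1 (param n 1 1 x))
            / sk 1 (radius 1 (param n 1 1 x))) by ring, h3]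
      field_simp
  have hrc : Continuous fun x : Coord n => radius 1 (param n 1 1 x) :=
    continuousOn_univ.1 ((continuousOn_radius n 1 1).mono fun x _ => chartDomain_one x)
  have hzero : ∫ x, ∑ k, pd k (F k) x = 0 := by
    refine integral_divergence_eq_zero (C := n * C * 4 ^ n) (fun k => ?_) (fun k x hx => ?_) ?_
    · exact (contDiff_lam_one.pow _).mul (ContDiff.sum fun j _ =>
        (hScd k j).mul (contDiff_coord j))
    · have hl := lam_pos (chartDomain_one x)
      have h1 : |∑ j, S x k j * x j| ≤ n * (C * lam 1 x ^ 2 * ‖x‖) := by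
        refine (Finset.abs_sum_le_sum_abs _ _).trans ((Finset.sum_le_sum fun j _ => ?_).trans_eq
          (by rw [Finset.sum_const, Finset.card_univ, Fintype.card_fin, nsmul_eq_mul]))
        rw [abs_mul]
        have h2 := hC x k j
        have h3 := PiLp.norm_apply_le x j
        rw [Real.norm_eq_abs] at h3
        gcongr
      have h4 : lam 1 x ^ (n - 2) * lam 1 x ^ 2 = lam 1 x ^ n := by
        rw [← pow_add, Nat.sub_add_cancel (by omega)]
      simp only [hF]
      rw [abs_mul, abs_of_pos (pow_pos hl _)]
      calc lam 1 x ^ (n - 2) * |∑ j, S x k j * x j| * ‖x‖ ^ n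
          ≤ lam 1 x ^ (n - 2) * (n * (C * lam 1 x ^ 2 * ‖x‖)) * ‖x‖ ^ n := by gcongr
        _ = n * C * ((lam 1 x ^ (n - 2) * lam 1 x ^ 2) * ‖x‖ ^ (n + 1)) := by ring
        _ ≤ n * C * 4 ^ n := by
          rw [h4]
          gcongr
          exact lam_pow_mul_norm_pow_le (by omega) hx
    · simp only [hdiv]
      refine Integrable.const_mul ?_ _
      refine ((integrable_lam_pow hn).mul_const M).mono'
        (((contDiff_lam_one (k := 0)).continuous.pow n).mul ((hm.comp hrc).mul
          ((continuous_sk 1).comp hrc))).aestronglyMeasurable (Eventually.of_forall fun x => ?_)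
      have hl := lam_pos (chartDomain_one x)
      rw [norm_mul, norm_mul, Real.norm_of_nonneg (pow_pos hl n).le]
      have h2 : ‖sk 1 (radius 1 (param n 1 1 x))‖ ≤ 1 := Real.abs_sin_le_one _
      have h3 : ‖source n 1 τ φ (radius 1 (param n 1 1 x))‖ ≤ M := hM _ (radius_one_mem_Icc x)
      have h4 := mul_le_mul h3 h2 (norm_nonneg _) hM0
      rw [mul_one] at h4
      gcongr
  simp only [hdiv] at hzero
  rw [integral_const_mul] at hzero
  refine moment_pi_eq_zero hn hm ((mul_eq_zero.1 hzero).resolve_left ?_)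
  have : (n : ℝ) - 1 ≠ 0 := by linarith
  positivity

end Admissible

/-- The energy identity on the sphere: a `C²` 1-form `U` for which `div (LU) = 0` satisfies
`LU = 0`. It is stated in one stereographic chart, with the decay of the components of a 1-form
and of a tensor of bounded length. -/
lemma confKilling_eq_zero_of_div₂ {n : ℕ} (hn : 3 ≤ n) {u : Coord n → Fin n → ℝ}
    (hu : ∀ i, ContDiff ℝ 2 fun x => u x i) {A C : ℝ} (hA : ∀ x i, |u x i| ≤ A * lam 1 x)
    (hC0 : 0 ≤ C) (hC : ∀ x i j, |confKilling (metric n 1 1) u x i j| ≤ C * lam 1 x ^ 2)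
    (hdiv : ∀ x j, div₂ (metric n 1 1) (confKilling (metric n 1 1) u) x j = 0)
    (x : Coord n) (i j : Fin n) : confKilling (metric n 1 1) u x i j = 0 := by
  have hn0 : n ≠ 0 := by omega
  have hε := one_mem_chartLabels 1
  set T := confKilling (metric n 1 1) u with hTdef
  have hTcd : ∀ i j, ContDiff ℝ 1 fun x => T x i j := fun i j =>
    contDiffOn_univ.1 ((contDiffOn_confKilling hn0 hε (fun i => (hu i).contDiffOn) i j).mono
      fun x _ => chartDomain_one x)
  have hlcd : ∀ k : ℕ∞ω, ContDiff ℝ k fun x : Coord n => (lam 1 x ^ 2)⁻¹ := fun k =>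
    (contDiff_lam_one.pow 2).inv fun x => (pow_pos (lam_pos (chartDomain_one x)) 2).ne'
  set F : Fin n → Coord n → ℝ := fun k y =>
    lam 1 y ^ (n - 2) * ∑ j, T y k j * (u y j * (lam 1 y ^ 2)⁻¹) with hF
  set E : Coord n → ℝ := fun x => lam 1 x ^ (n - 2) * ((lam 1 x ^ 2)⁻¹ * (1 / 2)
    * ∑ k, ∑ j, T x k j * T x k j) with hE
  have hdivF : ∀ x, ∑ k, pd k (F k) x = E x := fun x => by
    have hx := chartDomain_one x
    have hud := fun j => (hu j).differentiable two_ne_zero x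
    simp only [hF, hE]
    rw [sum_pd_contraction (by omega) hε hx (T := T) (X := fun y j => u y j * (lam 1 y ^ 2)⁻¹)
      (fun i j => (hTcd i j).differentiable one_ne_zero x)
      (fun j => (hud j).fun_mul ((hlcd 1).differentiable one_ne_zero x))
      (confKilling_symm _ hn0 hε hx) (confKilling_trace _ hn0 hε hx),
      sum_contraction_pd hn0 hε hx hud (confKilling_symm _ hn0 hε hx)
        (confKilling_trace _ hn0 hε hx)]
    simp only [hdiv, zero_mul, Finset.sum_const_zero, mul_zero, zero_add, ← hTdef]
  have hEc : Continuous E := ((contDiff_lam_one (k := 0)).continuous.pow _).mul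
    (((hlcd 0).continuous.mul continuous_const).mul (continuous_finsetSum _ fun k _ =>
      continuous_finsetSum _ fun j _ => (hTcd k j).continuous.mul (hTcd k j).continuous))
  have hE0 : ∀ x, 0 ≤ E x := fun x => by
    have hl := lam_pos (chartDomain_one x)
    have : 0 ≤ ∑ k, ∑ j, T x k j * T x k j :=
      Finset.sum_nonneg fun _ _ => Finset.sum_nonneg fun _ _ => mul_self_nonneg _
    simp only [hE]
    positivity
  have hEint : Integrable E := by
    refine ((integrable_lam_pow hn0).mul_const (n * (n * C ^ 2))).mono' hEc.aestronglyMeasurable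
      (Eventually.of_forall fun x => ?_)
    have hl := lam_pos (chartDomain_one x)
    have h1 : ∑ k, ∑ j, T x k j * T x k j ≤ n * (n * (C * lam 1 x ^ 2) ^ 2) := by
      refine (Finset.sum_le_sum fun k _ => (Finset.sum_le_sum fun j _ => ?_).trans_eq
        (by rw [Finset.sum_const, Finset.card_univ, Fintype.card_fin, nsmul_eq_mul])).trans_eq
          (by rw [Finset.sum_const, Finset.card_univ, Fintype.card_fin, nsmul_eq_mul])
      rw [← sq, ← sq_abs]
      have := hC x k j
      gcongr
    have h4 : lam 1 x ^ (n - 2) * lam 1 x ^ 2 = lam 1 x ^ n := by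
      rw [← pow_add, Nat.sub_add_cancel (by omega)]
    rw [Real.norm_of_nonneg (hE0 x)]
    simp only [hE]
    calc lam 1 x ^ (n - 2) * ((lam 1 x ^ 2)⁻¹ * (1 / 2) * ∑ k, ∑ j, T x k j * T x k j)
        ≤ lam 1 x ^ (n - 2) * ((lam 1 x ^ 2)⁻¹ * 1 * (n * (n * (C * lam 1 x ^ 2) ^ 2))) := by
          gcongr
          · exact Finset.sum_nonneg fun _ _ => Finset.sum_nonneg fun _ _ => mul_self_nonneg _
          · norm_num
      _ = (lam 1 x ^ (n - 2) * lam 1 x ^ 2) * (n * (n * C ^ 2)) := by field_simp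
      _ = lam 1 x ^ n * (n * (n * C ^ 2)) := by rw [h4]
  have hint : ∫ x, E x = 0 := by
    have h0 := integral_divergence_eq_zero (F := F) (C := n * (C * A) * 4 ^ (n - 1)) (fun k => ?_)
      (fun k x hx => ?_) (by simpa only [hdivF] using hEint)
    · simpa only [hdivF] using h0
    · exact (contDiff_lam_one.pow _).mul (ContDiff.sum fun j _ =>
        (hTcd k j).mul (((hu j).of_le (by norm_num)).mul (hlcd 1)))
    · have hl := lam_pos (chartDomain_one x)
      have hA0 : 0 ≤ A := by
        have h1 := (abs_nonneg _).trans (hA x k)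
        exact nonneg_of_mul_nonneg_left h1 hl
      have h1 : |∑ j, T x k j * (u x j * (lam 1 x ^ 2)⁻¹)|
          ≤ n * (C * lam 1 x ^ 2 * (A * lam 1 x * (lam 1 x ^ 2)⁻¹)) := by
        refine (Finset.abs_sum_le_sum_abs _ _).trans ((Finset.sum_le_sum fun j _ => ?_).trans_eq
          (by rw [Finset.sum_const, Finset.card_univ, Fintype.card_fin, nsmul_eq_mul]))
        rw [abs_mul, abs_mul, abs_of_pos (show 0 < (lam 1 x ^ 2)⁻¹ by positivity)]
        have h2 := hC x k j
        have h3 := hA x j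
        gcongr
      have h4 : lam 1 x ^ (n - 2) * lam 1 x = lam 1 x ^ (n - 1) := by
        rw [← pow_succ]
        congr 1
        omega
      simp only [hF]
      rw [abs_mul, abs_of_pos (pow_pos hl _)]
      calc lam 1 x ^ (n - 2) * |∑ j, T x k j * (u x j * (lam 1 x ^ 2)⁻¹)| * ‖x‖ ^ n
          ≤ lam 1 x ^ (n - 2) * (n * (C * lam 1 x ^ 2 * (A * lam 1 x * (lam 1 x ^ 2)⁻¹)))
            * ‖x‖ ^ n := by gcongr
        _ = n * (C * A) * ((lam 1 x ^ (n - 2) * lam 1 x) * ‖x‖ ^ n) := by field_simp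
        _ ≤ n * (C * A) * 4 ^ (n - 1) := by
          rw [h4]
          gcongr
          exact lam_pow_mul_norm_pow_le (by omega) hx
  have hE00 : E = 0 := (hEc.ae_eq_iff_eq volume continuous_zero).1
    ((integral_eq_zero_iff_of_nonneg hE0 hEint).1 hint)
  have hl := lam_pos (chartDomain_one x)
  have h1 : E x = 0 := by rw [hE00]; rfl
  have h2 : ∑ k, ∑ j, T x k j * T x k j = 0 := by
    simp only [hE] at h1
    refine ((mul_eq_zero.1 ((mul_eq_zero.1 h1).resolve_left (by positivity))).resolve_left ?_)
    positivity
  rw [Finset.sum_eq_zero_iff_of_nonneg fun _ _ => Finset.sum_nonneg fun _ _ =>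
    mul_self_nonneg _] at h2
  have h3 := h2 i (Finset.mem_univ i)
  rw [Finset.sum_eq_zero_iff_of_nonneg fun _ _ => mul_self_nonneg _] at h3
  exact mul_self_eq_zero.1 (h3 j (Finset.mem_univ j))

/-! ### Reduction to the radial equation -/

namespace Admissible

variable {n : ℕ} {κ : SignType} {V ψ ρ τ φ : ℝ → ℝ}

/-- On the sphere a solution `W` need not be radial, but by the energy identity `LW = LW₀` for the
radial solution `W₀` of the vector equation. -/
lemma radialLichnerowicz_of_sphere (h : Admissible n 1 V ψ ρ τ φ)
    {W : Ambient n → (Ambient n →L[ℝ] ℝ)}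
    (hS : SolvesWith 1 V (radial n 1 ψ) (radial n 1 ρ) (radial n 1 τ) (fun _ => 0) (radial n 1 φ) W)
    (hW : IsCkForm 1 2 W) : ∀ r ∈ radii 1, RadialLichnerowicz n 1 V ψ ρ τ φ r := by
  have hn := h.n_ne_zero
  have hn3 := h.three_le_cast
  have hε := one_mem_chartLabels 1
  have hm := h.continuous_source
  set m := source n 1 τ φ with hmdef
  have hY : ∀ ε ∈ chartLabels 1, moment n 1 m (endPoint ε) = 0 := fun ε hε => by
    rcases hε with rfl | ⟨-, rfl⟩
    · rw [endPoint_one, moment_zero]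
    · rw [endPoint_neg_one]; exact h.moment_pi hS hW
  have hm0 : ∀ ε ∈ chartLabels 1, Tendsto m (endFilter ε) (𝓝 0) := fun ε hε => h.tendsto_source hε
  have hk := continuous_profileK hm hm0 hY
  set B : ℝ → ℝ := fun r => profileB n 1 m r + 0 with hBdef
  have hB : ∀ r, HasDerivAt B (profileK n 1 m r / 2) r := fun r =>
    (hasDerivAt_profileB hk r).add_const 0
  have hW₀ : IsCkForm 1 2 (radialForm n 1 B) := isCkForm_radialForm hm hm0 hY 0
  set a : Coord n → Fin n → ℝ := formComp 1 1 W with ha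
  set b : Coord n → Fin n → ℝ := formComp 1 1 (radialForm n 1 B) with hb
  have hbr : ∀ y ∈ punctured n 1, ∀ i, b y i
      = 1 * B (radius 1 (param n 1 1 y)) * lam 1 y ^ 2 * y i := fun y hy i =>
    formComp_radialForm hy.1 i
  have hnb : ∀ x ∈ punctured n 1, normSq₂ (metric n 1 1) x (confKilling (metric n 1 1) b x)
      = ((n : ℝ) - 1) / n * (profileK n 1 m (radius 1 (param n 1 1 x))
        * sk 1 (radius 1 (param n 1 1 x))) ^ 2 := fun x hx =>
    normSq_confKilling_radial hn hε hx (k := profileK n 1 m) (hB _) hbr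
  have hcd : ∀ {V : Ambient n → (Ambient n →L[ℝ] ℝ)}, IsCkForm 1 2 V → ∀ i,
      ContDiff ℝ 2 fun x => formComp 1 1 V x i := fun hV i =>
    contDiffOn_univ.1 ((hV 1 hε i).mono fun x _ => chartDomain_one x)
  have hacd : ∀ i, ContDiff ℝ 2 fun x => a x i := hcd hW
  have hbcd : ∀ i, ContDiff ℝ 2 fun x => b x i := hcd hW₀
  have hLcd : ∀ {w : Coord n → Fin n → ℝ}, (∀ i, ContDiff ℝ 2 fun x => w x i) → ∀ i j,
      ContDiff ℝ 1 fun x => confKilling (metric n 1 1) w x i j := fun hw i j =>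
    contDiffOn_univ.1 ((contDiffOn_confKilling hn hε (fun i => (hw i).contDiffOn) i j).mono
      fun x _ => chartDomain_one x)
  have hLu : confKilling (metric n 1 1) (fun x i => a x i - b x i)
      = fun x i j => confKilling (metric n 1 1) a x i j - confKilling (metric n 1 1) b x i j := by
    funext x i j
    exact confKilling_sub hn hε (chartDomain_one x)
      (fun j => (hacd j).differentiable two_ne_zero x)
      (fun j => (hbcd j).differentiable two_ne_zero x) i j
  have hdivab : ∀ x j, div₂ (metric n 1 1) (confKilling (metric n 1 1) a) x j
      = div₂ (metric n 1 1) (confKilling (metric n 1 1) b) x j := fun x j => by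
    refine eqOn_chartDomain_of_punctured hn
      (continuousOn_div₂_confKilling hn hε (fun i => (hacd i).contDiffOn) j)
      (continuousOn_div₂_confKilling hn hε (fun i => (hbcd i).contDiffOn) j) (fun y hy => ?_)
      (chartDomain_one x)
    have hr := radius_mem hε hy.1 hy.2
    change div₂ (metric n 1 1) (confKilling (metric n 1 1) a) y j = div₂ _ _ y j
    rw [h.div₂_of_solvesWith hS hε hy, div₂_confKilling_radial hn hε hy (fun r _ => hB r)
      (hasDerivAt_profileK hm hr) hbr]
    ring
  -- bounds for the components of the two forms and of their images
  obtain ⟨A, hA⟩ := exists_bound_formComp hW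
  obtain ⟨A₀, hA₀⟩ := exists_bound_formComp hW₀
  obtain ⟨C, hC0, hC⟩ := h.exists_bound_confKilling hS hW
  obtain ⟨C₀, hC₀⟩ : ∃ C, ∀ x ∈ punctured n 1, ∀ i j,
      |confKilling (metric n 1 1) b x i j| ≤ √C * lam 1 x ^ 2 := by
    obtain ⟨D, -, hD⟩ := exists_bound_Icc
      (continuous_const.mul ((hk.mul (continuous_sk 1)).pow 2) :
        Continuous fun r => ((n : ℝ) - 1) / n * (profileK n 1 m r * sk 1 r) ^ 2) 0 Real.pi
    refine ⟨D, fun x hx => abs_le_of_normSq₂_le hε hx.1 ?_⟩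
    rw [hnb x hx]
    exact (le_abs_self _).trans (hD _ (radius_one_mem_Icc x))
  have hC₀' : ∀ x i j, |confKilling (metric n 1 1) b x i j| ≤ √C₀ * lam 1 x ^ 2 := fun x i j => by
    by_cases hx : x = 0
    · subst hx
      have hne := neBot_punctured_nhds_zero hn
      refine le_of_tendsto_of_tendsto (b := 𝓝[≠] (0 : Coord n))
        (((hLcd hbcd i j).continuous.abs.tendsto 0).mono_left nhdsWithin_le_nhds)
        ((((contDiff_lam_one (k := 0)).continuous.pow 2).const_mul (√C₀)).tendsto 0 |>.mono_left
          nhdsWithin_le_nhds) ?_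
      filter_upwards [eventually_punctured n 1] with x hx using hC₀ x hx i j
    · exact hC₀ x ⟨chartDomain_one x, hx⟩ i j
  have hzero := confKilling_eq_zero_of_div₂ h.three_le (u := fun x i => a x i - b x i)
    (fun i => (hacd i).sub (hbcd i)) (A := A + A₀) (C := C + √C₀)
    (fun x i => (abs_sub _ _).trans ((add_le_add (hA x i) (hA₀ x i)).trans_eq (by ring)))
    (by positivity)
    (fun x i j => by
      rw [hLu]
      exact (abs_sub _ _).trans ((add_le_add (hC x i j) (hC₀' x i j)).trans_eq (by ring)))
    (fun x j => by
      have hx := chartDomain_one x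
      rw [hLu, div₂_sub hε hx (confKilling_symm _ hn hε hx) (confKilling_trace _ hn hε hx)
        (confKilling_symm _ hn hε hx) (confKilling_trace _ hn hε hx)
        (fun i j => (hLcd hacd i j).differentiable one_ne_zero x)
        (fun i j => (hLcd hbcd i j).differentiable one_ne_zero x), hdivab, sub_self])
  have hab : confKilling (metric n 1 1) a = confKilling (metric n 1 1) b := by
    funext x i j
    have h1 := hzero x i j
    rw [hLu] at h1
    exact sub_eq_zero.1 h1
  intro r hr
  obtain ⟨e, he⟩ := exists_unit hn
  have hx := ray_mem he hε hr
  have hs := sk_ne hr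
  have h1 := h.lichDefect_of_solvesWith hS hε hx
  rw [← ha, hab, hnb _ hx, radius_ray he hε hr, profileK_of_mem hr] at h1
  rw [radialLichnerowicz_iff hr, h1]
  have h2 : (n : ℝ) - 1 ≠ 0 := by linarith
  have h3 : (n : ℝ) ≠ 0 := by linarith
  rw [hmdef]
  field_simp
  ring

theorem isSolution_iff (h : Admissible n κ V ψ ρ τ φ) :
    IsSolution n κ V ψ ρ τ φ ↔ ∀ r ∈ radii κ, RadialLichnerowicz n κ V ψ ρ τ φ r := by
  refine ⟨fun ⟨W, hW, hκ, hS⟩ => ?_, h.isSolution_of_radial⟩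
  rcases hκ with rfl | ⟨u, hu⟩
  · exact h.radialLichnerowicz_of_sphere hS hW
  · exact h.radialLichnerowicz_of_isRadialForm hS hW hu

end Admissible

/-! ### The function `S` and the explicit mean curvature -/

/-- The expression `2 N (φ'' + h φ') φ - κ n² φ² + I φ^(-N)`: the radial Lichnerowicz equation
has the mean-curvature term `τ² φ^(2N)` minus `φ^N` times this expression on its left. -/
def curvTerm (n : ℕ) (κ : SignType) (V ψ ρ φ : ℝ → ℝ) (r : ℝ) : ℝ :=
  2 * critExp n * (deriv (deriv φ) r + ((n : ℝ) - 1) * (ck κ r / sk κ r) * deriv φ r) * φ r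
    - (κ : ℝ) * (n : ℝ) ^ 2 * φ r ^ 2 + Ifun n V ψ ρ φ r * φ r ^ (-critExp n)

lemma explicitTau_eq (n : ℕ) (κ : SignType) (V ψ ρ φ : ℝ → ℝ) (r : ℝ) :
    explicitTau n κ V ψ ρ φ r = (Sfun n κ V ψ ρ φ r + curvTerm n κ V ψ ρ φ r)
      / (2 * Real.sqrt (φ r ^ critExp n * Sfun n κ V ψ ρ φ r)) := by
  rw [explicitTau, curvTerm]
  ring_nf

namespace Admissible

variable {n : ℕ} {κ : SignType} {V ψ ρ τ φ : ℝ → ℝ} {ε r : ℝ}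

lemma rpow_two_mul (h : Admissible n κ V ψ ρ τ φ) (hr : r ∈ radii κ) (p : ℝ) :
    φ r ^ (2 * p) = (φ r ^ p) ^ 2 := by
  rw [two_mul, Real.rpow_add (h.pos hr), sq]

lemma rpow_add_one (h : Admissible n κ V ψ ρ τ φ) (hr : r ∈ radii κ) (p : ℝ) :
    φ r ^ (p + 1) = φ r ^ p * φ r := Real.rpow_add_one (h.pos hr).ne' p

lemma rpow_add_two (h : Admissible n κ V ψ ρ τ φ) (hr : r ∈ radii κ) (p : ℝ) :
    φ r ^ (p + 2) = φ r ^ p * φ r ^ 2 := by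
  rw [Real.rpow_add (h.pos hr), Real.rpow_two]

lemma lichDefect_eq (h : Admissible n κ V ψ ρ τ φ) (hr : r ∈ radii κ) :
    lichDefect n κ V ψ ρ τ φ r
      = τ r ^ 2 * (φ r ^ critExp n) ^ 2 - φ r ^ critExp n * curvTerm n κ V ψ ρ φ r := by
  have hF := (Real.rpow_pos_of_pos (h.pos hr) (critExp n)).ne'
  rw [lichDefect, curvTerm, h.rpow_two_mul hr, h.rpow_add_one hr, h.rpow_add_two hr,
    Real.rpow_neg (h.pos hr).le, meanCurv]
  field_simp
  ring

lemma weight_pos (h : Admissible n κ V ψ ρ τ φ) (hr : r ∈ radii κ) : 0 < weight n κ φ r :=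
  mul_pos (Real.rpow_pos_of_pos (h.pos hr) _) (pow_pos (sk_pos hr) n)

lemma hasDerivAt_weight (h : Admissible n κ V ψ ρ τ φ) (hr : r ∈ radii κ) :
    HasDerivAt (weight n κ φ) (critExp n * φ r ^ (critExp n - 1) * deriv φ r * sk κ r ^ n
      + φ r ^ critExp n * (n * sk κ r ^ (n - 1) * ck κ r)) r := by
  have h1 := (hasDerivAt_profile h.n_ne_zero (by norm_num) h.phi hr).rpow_const (p := critExp n)
    (Or.inl (h.pos hr).ne')
  refine (h1.mul ((hasDerivAt_sk κ r).pow n)).congr_deriv ?_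
  simp only [Pi.pow_apply]
  ring

lemma deriv_weight (h : Admissible n κ V ψ ρ τ φ) (hr : r ∈ radii κ) :
    deriv (weight n κ φ) r = critExp n * φ r ^ (critExp n - 1) * deriv φ r * sk κ r ^ n
      + φ r ^ critExp n * (n * sk κ r ^ (n - 1) * ck κ r) := (h.hasDerivAt_weight hr).deriv

lemma tendsto_weight (h : Admissible n κ V ψ ρ τ φ) (hε : ε ∈ chartLabels κ) :
    Tendsto (weight n κ φ) (endFilter ε) (𝓝 0) := by
  have := (h.tendsto_rpow hε (critExp n)).mul ((tendsto_sk_endFilter hε).pow n)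
  rwa [zero_pow h.n_ne_zero, mul_zero] at this

lemma tendsto_deriv_weight (h : Admissible n κ V ψ ρ τ φ) (hε : ε ∈ chartLabels κ) :
    Tendsto (deriv (weight n κ φ)) (endFilter ε) (𝓝 0) := by
  have h3 := h.three_le
  have hφ' := tendsto_deriv_profile h.n_ne_zero hε (h.phi.of_le (by norm_num : 1 ≤ 3))
  have hs := tendsto_sk_endFilter hε
  have h1 := ((((h.tendsto_rpow hε (critExp n - 1)).const_mul (critExp n)).mul hφ').mul
    (hs.pow n)).add ((h.tendsto_rpow hε (critExp n)).mul (((hs.pow (n - 1)).const_mul (n : ℝ)).mul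
      (tendsto_ck_endFilter hε)))
  rw [zero_pow (by omega), zero_pow (by omega)] at h1
  simp only [mul_zero, zero_mul, add_zero] at h1
  refine h1.congr' ?_
  filter_upwards [radii_mem_endFilter hε] with r hr using (h.deriv_weight hr).symm

/-- The integrand in the definition of `S`, extended by `0`, is continuous. -/
lemma continuous_integrand (h : Admissible n κ V ψ ρ τ φ) :
    Continuous ((radii κ).indicator fun t =>
      Ifun n V ψ ρ φ t * φ t ^ (-(2 * critExp n)) * deriv (weight n κ φ) t) := by
  have hn := h.n_ne_zero
  refine continuous_indicator_radii ((h.continuousOn_Ifun.mul (h.continuousOn_rpow _)).mul ?_)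
    fun ε hε => ?_
  · have hφ' : ContinuousOn (deriv φ) (radii κ) :=
      continuousOn_deriv hn (h.phi.of_le (by norm_num : 1 ≤ 3))
    refine ContinuousOn.congr (f := fun r => critExp n * φ r ^ (critExp n - 1) * deriv φ r
      * sk κ r ^ n + φ r ^ critExp n * (n * sk κ r ^ (n - 1) * ck κ r)) ?_
      fun r hr => h.deriv_weight hr
    exact (((continuousOn_const.mul (h.continuousOn_rpow _)).mul hφ').mul
      ((continuous_sk κ).pow n).continuousOn).add ((h.continuousOn_rpow _).mul
        ((continuous_const.mul ((continuous_sk κ).pow _)).mul (continuous_ck κ)).continuousOn)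
  · obtain ⟨c, hc⟩ := h.tendsto_Ifun hε
    have := (hc.mul (h.tendsto_rpow hε (-(2 * critExp n)))).mul (h.tendsto_deriv_weight hε)
    rwa [mul_zero] at this

lemma pow_mul_Sfun (h : Admissible n κ V ψ ρ τ φ) (hr : r ∈ radii κ) :
    sk κ r ^ n * Sfun n κ V ψ ρ φ r
      = sk κ r ^ n * (critExp n ^ 2 * deriv φ r ^ 2 - (n : ℝ) ^ 2 * (κ : ℝ) * φ r ^ 2)
        + 2 * n * critExp n * (sk κ r ^ (n - 1) * ck κ r) * φ r * deriv φ r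
        + ∫ t in (0 : ℝ)..r, (radii κ).indicator (fun t =>
          Ifun n V ψ ρ φ t * φ t ^ (-(2 * critExp n)) * deriv (weight n κ φ) t) t := by
  have hs := sk_ne hr
  have h1 : ∫ t in (0 : ℝ)..r, Ifun n V ψ ρ φ t * φ t ^ (-(2 * critExp n))
        * deriv (weight n κ φ) t
      = ∫ t in (0 : ℝ)..r, (radii κ).indicator (fun t =>
          Ifun n V ψ ρ φ t * φ t ^ (-(2 * critExp n)) * deriv (weight n κ φ) t) t :=
    integral_eq_of_eqOn_radii (fun t ht => by rw [indicator_of_mem ht]) hr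
  rw [Sfun, h1]
  obtain ⟨p, hp⟩ := Nat.exists_eq_succ_of_ne_zero h.n_ne_zero
  simp only [hp, Nat.succ_eq_add_one, Nat.add_sub_cancel]
  field_simp
  ring

lemma tendsto_pow_mul_Sfun (h : Admissible n κ V ψ ρ τ φ) :
    Tendsto (fun r => sk κ r ^ n * Sfun n κ V ψ ρ φ r) (𝓝[>] 0) (𝓝 0) := by
  have hn := h.n_ne_zero
  have h3 := h.three_le
  have hε := one_mem_chartLabels κ
  have hφ := tendsto_profile hn hε h.phi
  have hφ' := tendsto_deriv_profile hn hε (h.phi.of_le (by norm_num : 1 ≤ 3))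
  have hs := tendsto_sk_endFilter hε
  have hK := ((continuous_iff_continuousAt.2 fun r =>
    (hasDerivAt_integral h.continuous_integrand r).continuousAt).tendsto (0 : ℝ)).mono_left
      (nhdsWithin_le_nhds (s := Ioi 0))
  rw [← endFilter_one] at hK ⊢
  have h1 := (((hs.pow n).mul (((hφ'.pow 2).const_mul (critExp n ^ 2)).sub
    ((hφ.pow 2).const_mul ((n : ℝ) ^ 2 * κ)))).add (((((hs.pow (n - 1)).mul
      (tendsto_ck_endFilter hε)).const_mul (2 * (n : ℝ) * critExp n)).mul hφ).mul hφ')).add hK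
  rw [zero_pow hn, zero_pow (by omega : n - 1 ≠ 0)] at h1
  simp only [mul_zero, zero_mul, add_zero, intervalIntegral.integral_same] at h1
  refine h1.congr' ?_
  filter_upwards [radii_mem_endFilter hε] with r hr using (h.pow_mul_Sfun hr).symm

/-- This is where the exponent `N = 2 n / (n - 2)` enters. -/
lemma hasDerivAt_pow_mul_Sfun (h : Admissible n κ V ψ ρ τ φ) (hr : r ∈ radii κ) :
    HasDerivAt (fun r => sk κ r ^ n * Sfun n κ V ψ ρ φ r)
      (deriv (weight n κ φ) r * (curvTerm n κ V ψ ρ φ r / φ r ^ critExp n)) r := by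
  have hn := h.n_ne_zero
  have hs := sk_ne hr
  have hφp := (h.pos hr).ne'
  have hF := (Real.rpow_pos_of_pos (h.pos hr) (critExp n)).ne'
  have hφ := hasDerivAt_profile hn (by norm_num) h.phi hr
  have hφ' := hasDerivAt_deriv_profile hn (by norm_num) h.phi hr
  have hsd := hasDerivAt_sk κ r
  have h1 := (((hsd.pow n).mul (((hφ'.pow 2).const_mul (critExp n ^ 2)).sub
    ((hφ.pow 2).const_mul ((n : ℝ) ^ 2 * κ)))).add (((((hsd.pow (n - 1)).mul
      (hasDerivAt_ck κ r)).const_mul (2 * (n : ℝ) * critExp n)).mul hφ).mul hφ')).add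
        (hasDerivAt_integral h.continuous_integrand r)
  have h2 : HasDerivAt (fun r => sk κ r ^ n * Sfun n κ V ψ ρ φ r) _ r :=
    h1.congr_of_eventuallyEq (eventually_of_mem ((isOpen_radii κ).mem_nhds hr)
      fun r hr => h.pow_mul_Sfun hr)
  refine h2.congr_deriv ?_
  have hc := ck_sq_add κ r
  rw [indicator_of_mem hr, h.deriv_weight hr, curvTerm, Real.rpow_neg (h.pos hr).le,
    Real.rpow_neg (h.pos hr).le, h.rpow_two_mul hr, Real.rpow_sub_one hφp]
  obtain ⟨p, hp⟩ : ∃ p, n = p + 2 := ⟨n - 2, by have := h.three_le; omega⟩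
  have hp0 : (p : ℝ) ≠ 0 := by
    have := h.three_le
    exact_mod_cast (by omega : p ≠ 0)
  have hnp : (n : ℝ) = p + 2 := by rw [hp]; push_cast; ring
  have hNp : critExp n = 2 * (p + 2) / p := by
    rw [critExp, hnp]
    congr 1
    ring
  have e1 : n - 1 = p + 1 := by omega
  have e2 : ((n - 1 : ℕ) : ℝ) = p + 1 := by rw [e1]; push_cast; ring
  have e3 : sk κ r ^ n = sk κ r ^ p * sk κ r ^ 2 := by rw [hp, pow_add]
  have hkap : (κ : ℝ) = (1 - ck κ r ^ 2) / sk κ r ^ 2 := by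
    field_simp
    linarith
  simp only [Pi.pow_apply, Pi.mul_apply, Pi.sub_apply, Nat.cast_ofNat, e2, e3]
  simp only [e1, Nat.add_sub_cancel]
  generalize φ r ^ critExp n = F at hF ⊢
  generalize Ifun n V ψ ρ φ r = J
  simp only [hNp, hnp, hkap]
  field_simp
  ring

/-- The function `τ w - ∫₀ʳ τ' w` for `w = φ^N s_κⁿ`. Like `±(φ^N S)^(1/2) s_κⁿ`, it has the
derivative `τ w'` and vanishes at the pole. -/
def tauMoment (n : ℕ) (κ : SignType) (τ φ : ℝ → ℝ) (r : ℝ) : ℝ :=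
  τ r * weight n κ φ r - moment n κ (source n κ τ φ) r

lemma hasDerivAt_tauMoment (h : Admissible n κ V ψ ρ τ φ) (hr : r ∈ radii κ) :
    HasDerivAt (tauMoment n κ τ φ) (τ r * deriv (weight n κ φ) r) r := by
  have h1 := ((hasDerivAt_profile h.n_ne_zero one_ne_zero h.tau hr).mul
    (h.hasDerivAt_weight hr)).sub (hasDerivAt_moment (n := n) (κ := κ) h.continuous_source r)
  refine h1.congr_deriv ?_
  rw [source_of_mem hr, h.deriv_weight hr, weight]
  ring

lemma tendsto_tauMoment (h : Admissible n κ V ψ ρ τ φ) :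
    Tendsto (tauMoment n κ τ φ) (𝓝[>] 0) (𝓝 0) := by
  have hε := one_mem_chartLabels κ
  have h1 := ((tendsto_profile h.n_ne_zero hε h.tau).mul (h.tendsto_weight hε)).sub
    (tendsto_moment (n := n) (κ := κ) h.continuous_source (by rw [endPoint_one, moment_zero]))
  rwa [mul_zero, sub_zero, endFilter_one] at h1

/-- Both `P² / w` and `s_κⁿ S`, where `P = tauMoment` and `w = φ^N s_κⁿ`, vanish at the pole, and by
the radial Lichnerowicz equation they have the same derivative. -/
lemma sq_tauMoment (h : Admissible n κ V ψ ρ τ φ)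
    (hL : ∀ r ∈ radii κ, RadialLichnerowicz n κ V ψ ρ τ φ r) (hr : r ∈ radii κ) :
    tauMoment n κ τ φ r ^ 2
      = φ r ^ critExp n * Sfun n κ V ψ ρ φ r * (sk κ r ^ n) ^ 2 := by
  have hε := one_mem_chartLabels κ
  have h1 : EqOn (fun r => tauMoment n κ τ φ r ^ 2 / weight n κ φ r)
      (fun r => sk κ r ^ n * Sfun n κ V ψ ρ φ r) (radii κ) := by
    refine eq_of_deriv_eq_radii (fun r hr => ?_) (fun r hr => h.hasDerivAt_pow_mul_Sfun hr) ?_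
    · have hw := (h.weight_pos hr).ne'
      have hs := sk_ne hr
      have hF := (Real.rpow_pos_of_pos (h.pos hr) (critExp n)).ne'
      have hwd := (h.hasDerivAt_weight hr).differentiableAt.hasDerivAt
      refine (((h.hasDerivAt_tauMoment hr).fun_pow 2).fun_div hwd hw).congr_deriv ?_
      have hE := (radialLichnerowicz_iff hr).1 (hL r hr)
      rw [h.lichDefect_eq hr] at hE
      have hA : curvTerm n κ V ψ ρ φ r / φ r ^ critExp n
          = τ r ^ 2 - (moment n κ (source n κ τ φ) r / weight n κ φ r) ^ 2 := by
        rw [weight]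
        field_simp at hE ⊢
        linarith
      rw [hA, tauMoment]
      field_simp
      ring
    · have hY := tendsto_div_sk_pow hε n
        (fun r _ => hasDerivAt_moment (n := n) (κ := κ) h.continuous_source r)
        (tendsto_moment h.continuous_source (by rw [endPoint_one, moment_zero]))
        (h.tendsto_source hε)
      have h2 := (((tendsto_profile h.n_ne_zero hε h.tau).sub ((hY.mul
        (tendsto_sk_endFilter hε)).div (h.tendsto_rpow hε (critExp n))
          (Real.rpow_pos_of_pos (h.pos_endPoint hε) _).ne')).mul
            (endFilter_one ▸ h.tendsto_tauMoment)).sub (endFilter_one ▸ h.tendsto_pow_mul_Sfun)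
      rw [mul_zero, sub_zero, endFilter_one] at h2
      refine h2.congr' ?_
      filter_upwards [endFilter_one ▸ radii_mem_endFilter hε] with r hr
      have hs := sk_ne hr
      have hF := (Real.rpow_pos_of_pos (h.pos hr) (critExp n)).ne'
      simp only [Pi.div_apply]
      rw [tauMoment, weight]
      field_simp
      ring
  have h2 := h1 hr
  have hw := (h.weight_pos hr).ne'
  simp only [div_eq_iff hw] at h2
  rw [h2, weight]
  ring

lemma Sfun_nonneg (h : Admissible n κ V ψ ρ τ φ)
    (hL : ∀ r ∈ radii κ, RadialLichnerowicz n κ V ψ ρ τ φ r) (hr : r ∈ radii κ) :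
    0 ≤ Sfun n κ V ψ ρ φ r := by
  have h1 := h.sq_tauMoment hL hr
  have hF := Real.rpow_pos_of_pos (h.pos hr) (critExp n)
  have hs := sk_pos hr
  by_contra! hneg
  have : φ r ^ critExp n * Sfun n κ V ψ ρ φ r * (sk κ r ^ n) ^ 2 < 0 :=
    mul_neg_of_neg_of_pos (mul_neg_of_pos_of_neg hF hneg) (by positivity)
  linarith [sq_nonneg (tauMoment n κ τ φ r)]

/-- The radial equation is a relation between `τ` and `q = tauMoment / s_κⁿ`, which is quadratic
in `q`, but linear in `τ` once `q² = φ^N S` is known. -/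
lemma two_mul_tau_mul (h : Admissible n κ V ψ ρ τ φ) (hr : r ∈ radii κ)
    {q : ℝ} (hq : tauMoment n κ τ φ r = q * sk κ r ^ n)
    (hq2 : q ^ 2 = φ r ^ critExp n * Sfun n κ V ψ ρ φ r) :
    RadialLichnerowicz n κ V ψ ρ τ φ r ↔
      2 * τ r * q = Sfun n κ V ψ ρ φ r + curvTerm n κ V ψ ρ φ r := by
  have hs := pow_ne_zero n (sk_ne hr)
  have hF := (Real.rpow_pos_of_pos (h.pos hr) (critExp n)).ne'
  have hY : moment n κ (source n κ τ φ) r / sk κ r ^ n = τ r * φ r ^ critExp n - q := by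
    rw [tauMoment, weight] at hq
    field_simp
    linarith
  rw [radialLichnerowicz_iff hr, h.lichDefect_eq hr, hY]
  constructor
  · intro h1
    refine mul_left_cancel₀ hF ?_
    linear_combination h1 + hq2
  · intro h1
    linear_combination φ r ^ critExp n * h1 - hq2

lemma sqrt_mul_pow_eq (hr : r ∈ radii κ) :
    √(φ r ^ critExp n * Sfun n κ V ψ ρ φ r) * sk κ r ^ n
      = √(weight n κ φ r * (sk κ r ^ n * Sfun n κ V ψ ρ φ r)) := by
  have hs := pow_pos (sk_pos hr) n
  rw [weight, show φ r ^ critExp n * sk κ r ^ n * (sk κ r ^ n * Sfun n κ V ψ ρ φ r)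
    = φ r ^ critExp n * Sfun n κ V ψ ρ φ r * (sk κ r ^ n) ^ 2 by ring,
    Real.sqrt_mul' (φ r ^ critExp n * Sfun n κ V ψ ρ φ r) (sq_nonneg _), Real.sqrt_sq hs.le]

lemma hasDerivAt_sqrt (h : Admissible n κ V ψ ρ τ φ)
    (hS : ∀ r ∈ radii κ, 0 < Sfun n κ V ψ ρ φ r) (hr : r ∈ radii κ) :
    HasDerivAt (fun r => √(φ r ^ critExp n * Sfun n κ V ψ ρ φ r) * sk κ r ^ n)
      (deriv (weight n κ φ) r * (Sfun n κ V ψ ρ φ r + curvTerm n κ V ψ ρ φ r)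
        / (2 * √(φ r ^ critExp n * Sfun n κ V ψ ρ φ r))) r := by
  have hs := pow_pos (sk_pos hr) n
  have hF := Real.rpow_pos_of_pos (h.pos hr) (critExp n)
  have h1 := mul_pos hF (hS r hr)
  have hpos : 0 < weight n κ φ r * (sk κ r ^ n * Sfun n κ V ψ ρ φ r) :=
    mul_pos (h.weight_pos hr) (mul_pos hs (hS r hr))
  have hwd := (h.hasDerivAt_weight hr).differentiableAt.hasDerivAt
  have h2 := ((hwd.fun_mul (h.hasDerivAt_pow_mul_Sfun hr)).sqrt hpos.ne').congr_of_eventuallyEq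
    (eventually_of_mem ((isOpen_radii κ).mem_nhds hr) fun r hr => sqrt_mul_pow_eq hr)
  refine h2.congr_deriv ?_
  rw [← sqrt_mul_pow_eq hr, weight]
  have h3 := (Real.sqrt_pos.2 h1).ne'
  field_simp

lemma tendsto_sqrt (h : Admissible n κ V ψ ρ τ φ) :
    Tendsto (fun r => √(φ r ^ critExp n * Sfun n κ V ψ ρ φ r) * sk κ r ^ n) (𝓝[>] 0) (𝓝 0) := by
  have hε := one_mem_chartLabels κ
  have h1 := (endFilter_one ▸ h.tendsto_weight hε).mul h.tendsto_pow_mul_Sfun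
  rw [mul_zero] at h1
  have h2 := (Real.continuous_sqrt.tendsto 0).comp h1
  rw [Real.sqrt_zero] at h2
  refine h2.congr' ?_
  filter_upwards [endFilter_one ▸ radii_mem_endFilter hε] with r hr
    using (sqrt_mul_pow_eq hr).symm

lemma eq_explicitTau_or (h : Admissible n κ V ψ ρ τ φ)
    (hL : ∀ r ∈ radii κ, RadialLichnerowicz n κ V ψ ρ τ φ r)
    (hS : ∀ r ∈ radii κ, 0 < Sfun n κ V ψ ρ φ r) :
    (∀ r ∈ radii κ, τ r = explicitTau n κ V ψ ρ φ r) ∨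
      (∀ r ∈ radii κ, τ r = -explicitTau n κ V ψ ρ φ r) := by
  rcases (ordConnected_radii κ).isPreconnected.eq_or_eq_neg_of_sq_eq
    (f := tauMoment n κ τ φ) (g := fun r => √(φ r ^ critExp n * Sfun n κ V ψ ρ φ r) * sk κ r ^ n)
    (fun r hr => (h.hasDerivAt_tauMoment hr).continuousAt.continuousWithinAt)
    (fun r hr => (h.hasDerivAt_sqrt hS hr).continuousAt.continuousWithinAt)
    (fun r hr => by
      have h1 := mul_pos (Real.rpow_pos_of_pos (h.pos hr) (critExp n)) (hS r hr)
      simp only [Pi.pow_apply]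
      rw [h.sq_tauMoment hL hr, mul_pow, Real.sq_sqrt h1.le])
    (fun {r} hr => by
      have h1 := mul_pos (Real.rpow_pos_of_pos (h.pos hr) (critExp n)) (hS r hr)
      have h2 := Real.sqrt_pos.2 h1
      have h3 := sk_pos hr
      positivity) with hP | hP
  · left
    intro r hr
    have h1 := mul_pos (Real.rpow_pos_of_pos (h.pos hr) (critExp n)) (hS r hr)
    have h2 := (Real.sqrt_pos.2 h1).ne'
    have h3 := (h.two_mul_tau_mul hr (hP hr) (Real.sq_sqrt h1.le)).1 (hL r hr)
    rw [explicitTau_eq, eq_div_iff (by positivity), ← h3]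
    ring
  · right
    intro r hr
    have h1 := mul_pos (Real.rpow_pos_of_pos (h.pos hr) (critExp n)) (hS r hr)
    have h2 := (Real.sqrt_pos.2 h1).ne'
    have h3 := (h.two_mul_tau_mul hr (q := -√(φ r ^ critExp n * Sfun n κ V ψ ρ φ r))
      ((hP hr).trans (by simp only [Pi.neg_apply]; ring)) (by rw [neg_sq, Real.sq_sqrt h1.le])).1
        (hL r hr)
    rw [explicitTau_eq, ← neg_div, eq_div_iff (by positivity), ← h3]
    ring

lemma radialLichnerowicz_of_explicitTau (h : Admissible n κ V ψ ρ τ φ)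
    (hS : ∀ r ∈ radii κ, 0 < Sfun n κ V ψ ρ φ r)
    (hτ : (∀ r ∈ radii κ, τ r = explicitTau n κ V ψ ρ φ r) ∨
      (∀ r ∈ radii κ, τ r = -explicitTau n κ V ψ ρ φ r)) :
    ∀ r ∈ radii κ, RadialLichnerowicz n κ V ψ ρ τ φ r := by
  obtain ⟨δ, hδ, hτ⟩ : ∃ δ : ℝ, δ ^ 2 = 1 ∧
      ∀ r ∈ radii κ, τ r = δ * explicitTau n κ V ψ ρ φ r := by
    rcases hτ with hτ | hτ
    · exact ⟨1, by norm_num, fun r hr => by rw [hτ r hr, one_mul]⟩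
    · exact ⟨-1, by norm_num, fun r hr => by rw [hτ r hr, neg_one_mul]⟩
  have hτ2 : ∀ r ∈ radii κ, 2 * τ r * (δ * √(φ r ^ critExp n * Sfun n κ V ψ ρ φ r))
      = Sfun n κ V ψ ρ φ r + curvTerm n κ V ψ ρ φ r := fun r hr => by
    have h1 := mul_pos (Real.rpow_pos_of_pos (h.pos hr) (critExp n)) (hS r hr)
    have h2 := (Real.sqrt_pos.2 h1).ne'
    rw [hτ r hr, explicitTau_eq]
    generalize √(φ r ^ critExp n * Sfun n κ V ψ ρ φ r) = q at h2 ⊢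
    field_simp
    linear_combination (Sfun n κ V ψ ρ φ r + curvTerm n κ V ψ ρ φ r) * hδ
  have hP : EqOn (tauMoment n κ τ φ)
      (fun r => δ * (√(φ r ^ critExp n * Sfun n κ V ψ ρ φ r) * sk κ r ^ n)) (radii κ) := by
    refine eq_of_deriv_eq_radii (fun r hr => h.hasDerivAt_tauMoment hr) (fun r hr => ?_) ?_
    · have h1 := mul_pos (Real.rpow_pos_of_pos (h.pos hr) (critExp n)) (hS r hr)
      have h2 := (Real.sqrt_pos.2 h1).ne'
      refine ((h.hasDerivAt_sqrt hS hr).const_mul δ).congr_deriv ?_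
      rw [← hτ2 r hr]
      field_simp
      linear_combination deriv (weight n κ φ) r * τ r * hδ
    · have h1 := h.tendsto_tauMoment.sub (h.tendsto_sqrt.const_mul δ)
      rwa [mul_zero, sub_zero] at h1
  intro r hr
  have h1 := mul_pos (Real.rpow_pos_of_pos (h.pos hr) (critExp n)) (hS r hr)
  refine (h.two_mul_tau_mul hr (q := δ * √(φ r ^ critExp n * Sfun n κ V ψ ρ φ r))
    ((hP hr).trans (by ring)) ?_).2 (hτ2 r hr)
  rw [mul_pow, hδ, one_mul, Real.sq_sqrt h1.le]

end Admissible

/-! ### The explicit 1-form -/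

section ExplicitForm

variable {n : ℕ} {κ : SignType} {m v : ℝ → ℝ} {a r : ℝ}

/-- The potential `H` of the radial form `s_κ B dr = dH`, with `B = profileB`. -/
def potential (n : ℕ) (κ : SignType) (m : ℝ → ℝ) (r : ℝ) : ℝ :=
  ∫ t in (0 : ℝ)..r, sk κ t * profileB n κ m t

lemma potential_zero : potential n κ m 0 = 0 := by simp [potential]

lemma profileB_zero : profileB n κ m 0 = 0 := by simp [profileB]

lemma continuous_profileB (hk : Continuous (profileK n κ m)) : Continuous (profileB n κ m) :=
  continuous_iff_continuousAt.2 fun r => (hasDerivAt_profileB hk r).continuousAt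

lemma hasDerivAt_potential (hk : Continuous (profileK n κ m)) (r : ℝ) :
    HasDerivAt (potential n κ m) (sk κ r * profileB n κ m r) r :=
  hasDerivAt_integral ((continuous_sk κ).mul (continuous_profileB hk)) r

lemma continuous_potential (hk : Continuous (profileK n κ m)) : Continuous (potential n κ m) :=
  continuous_iff_continuousAt.2 fun r => (hasDerivAt_potential hk r).continuousAt

/-- The equation `H'' + h H' + n κ H = (1 / 2) ∫₀ʳ m`. -/
lemma potential_ode (hm : Continuous m) (hk : Continuous (profileK n κ m)) (hr : r ∈ radii κ) :
    n * ck κ r * profileB n κ m r + sk κ r * profileK n κ m r / 2 + n * κ * potential n κ m r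
      = 1 / 2 * ∫ t in (0 : ℝ)..r, m t := by
  have h1 : EqOn (fun r => n * ck κ r * profileB n κ m r + sk κ r * profileK n κ m r / 2
      + n * κ * potential n κ m r) (fun r => 1 / 2 * ∫ t in (0 : ℝ)..r, m t) (radii κ) := by
    refine eq_of_deriv_eq_radii (fun r hr => ?_)
      (fun r _ => (hasDerivAt_integral hm r).const_mul (1 / 2)) ?_
    · have hs := sk_ne hr
      refine (((((hasDerivAt_ck κ r).const_mul (n : ℝ)).fun_mul (hasDerivAt_profileB hk r)).fun_add
        (((hasDerivAt_sk κ r).fun_mul (hasDerivAt_profileK hm hr)).div_const 2)).fun_add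
          ((hasDerivAt_potential hk r).const_mul ((n : ℝ) * κ))).congr_deriv ?_
      field_simp
      ring
    · have hint : Continuous fun r => ∫ t in (0 : ℝ)..r, m t :=
        continuous_iff_continuousAt.2 fun r => (hasDerivAt_integral hm r).continuousAt
      have hc : Continuous fun r => n * ck κ r * profileB n κ m r + sk κ r * profileK n κ m r / 2
          + n * κ * potential n κ m r - 1 / 2 * ∫ t in (0 : ℝ)..r, m t :=
        ((((continuous_const.mul (continuous_ck κ)).mul (continuous_profileB hk)).add
          (((continuous_sk κ).mul hk).div_const 2)).add
            (continuous_const.mul (continuous_potential hk))).sub (continuous_const.mul hint)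
      have h2 := (hc.tendsto 0).mono_left (nhdsWithin_le_nhds (s := Ioi 0))
      simpa [potential_zero, profileB_zero, sk_zero] using h2
  exact h1 hr

lemma integral_potential (hn : 2 ≤ n) (hm : Continuous m) (hk : Continuous (profileK n κ m))
    (hr : r ∈ radii κ) :
    ∫ t in (0 : ℝ)..r, (1 / 2 * ∫ s in (0 : ℝ)..t, m s) * ck κ t * sk κ t ^ (n - 1)
      = sk κ r ^ n * (ck κ r * profileB n κ m r + κ * potential n κ m r) := by
  have hint : Continuous fun r => ∫ t in (0 : ℝ)..r, m t :=
    continuous_iff_continuousAt.2 fun r => (hasDerivAt_integral hm r).continuousAt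
  have hc : Continuous fun t => (1 / 2 * ∫ s in (0 : ℝ)..t, m s) * ck κ t * sk κ t ^ (n - 1) :=
    ((continuous_const.mul hint).mul (continuous_ck κ)).mul ((continuous_sk κ).pow _)
  have h1 : EqOn (fun r => ∫ t in (0 : ℝ)..r, (1 / 2 * ∫ s in (0 : ℝ)..t, m s) * ck κ t
      * sk κ t ^ (n - 1)) (fun r => sk κ r ^ n * (ck κ r * profileB n κ m r
        + κ * potential n κ m r)) (radii κ) := by
    refine eq_of_deriv_eq_radii (fun r _ => hasDerivAt_integral hc r) (fun r hr => ?_) ?_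
    · refine (((hasDerivAt_sk κ r).fun_pow n).fun_mul (((hasDerivAt_ck κ r).fun_mul
        (hasDerivAt_profileB hk r)).fun_add
          ((hasDerivAt_potential hk r).const_mul (κ : ℝ)))).congr_deriv ?_
      rw [← potential_ode hm hk hr]
      obtain ⟨p, rfl⟩ := Nat.exists_eq_add_of_le' hn
      rw [show p + 2 - 1 = p + 1 by omega]
      push_cast
      ring
    · have hc' : Continuous fun r => (∫ t in (0 : ℝ)..r, (1 / 2 * ∫ s in (0 : ℝ)..t, m s)
          * ck κ t * sk κ t ^ (n - 1))
          - sk κ r ^ n * (ck κ r * profileB n κ m r + κ * potential n κ m r) :=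
        (continuous_iff_continuousAt.2 fun r => (hasDerivAt_integral hc r).continuousAt).sub
          (((continuous_sk κ).pow n).mul (((continuous_ck κ).mul (continuous_profileB hk)).add
            (continuous_const.mul (continuous_potential hk))))
      have h2 := (hc'.tendsto 0).mono_left (nhdsWithin_le_nhds (s := Ioi 0))
      simpa [potential_zero, profileB_zero, sk_zero] using h2
  exact h1 hr

lemma fv_eq (hv : ∀ t ∈ radii κ, v t = a * m t) (hr : r ∈ radii κ) :
    fv v r = a * (1 / 2 * ∫ t in (0 : ℝ)..r, m t) := by
  rw [fv, integral_eq_of_eqOn_radii (g := fun t => a * m t) hv hr,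
    intervalIntegral.integral_const_mul]
  ring

lemma integral_fv (hn : 2 ≤ n) (hm : Continuous m) (hk : Continuous (profileK n κ m))
    (hv : ∀ t ∈ radii κ, v t = a * m t) (hr : r ∈ radii κ) :
    ∫ t in (0 : ℝ)..r, fv v t * ck κ t * sk κ t ^ (n - 1)
      = a * (sk κ r ^ n * (ck κ r * profileB n κ m r + κ * potential n κ m r)) := by
  rw [← integral_potential hn hm hk hr, ← intervalIntegral.integral_const_mul]
  refine integral_eq_of_eqOn_radii (fun t ht => ?_) hr
  simp only [fv_eq hv ht]
  ring

/-- The integrand `q_v` is the derivative of `a H / c_κ`. -/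
lemma quotv_eq (hn : 2 ≤ n) (hm : Continuous m) (hk : Continuous (profileK n κ m))
    (hv : ∀ t ∈ radii κ, v t = a * m t) (hr : r ∈ radii κ ∨ sk κ r = 0) :
    quotv n κ v r = a * (sk κ r * (ck κ r * profileB n κ m r + κ * potential n κ m r)
      / ck κ r ^ 2) := by
  obtain ⟨p, rfl⟩ := Nat.exists_eq_add_of_le' hn
  rcases hr with hr | hr
  · have hs := sk_ne hr
    rw [quotv, integral_fv hn hm hk hv hr, show p + 2 - 1 = p + 1 by omega]
    field_simp
    ring
  · rw [quotv, hr]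
    simp

lemma integral_quotv (hn : 2 ≤ n) (hm : Continuous m) (hk : Continuous (profileK n κ m))
    (hv : ∀ t ∈ radii κ, v t = a * m t) {x y : ℝ} (hxy : x ≤ y)
    (hc : ∀ t ∈ Icc x y, ck κ t ≠ 0) (hs : ∀ t ∈ Ioc x y, t ∈ radii κ ∨ sk κ t = 0) :
    ∫ t in x..y, quotv n κ v t
      = a * (potential n κ m y / ck κ y - potential n κ m x / ck κ x) := by
  have h1 : ∫ t in x..y, quotv n κ v t = ∫ t in x..y, a * (sk κ t * (ck κ t * profileB n κ m t
      + κ * potential n κ m t) / ck κ t ^ 2) := by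
    refine intervalIntegral.integral_congr_ae (Eventually.of_forall fun t ht => ?_)
    rw [uIoc_of_le hxy] at ht
    exact quotv_eq hn hm hk hv (hs t ht)
  have hcont : ContinuousOn (fun t => sk κ t * (ck κ t * profileB n κ m t
      + κ * potential n κ m t) / ck κ t ^ 2) (uIcc x y) := by
    rw [uIcc_of_le hxy]
    exact ((continuous_sk κ).mul (((continuous_ck κ).mul (continuous_profileB hk)).add
      (continuous_const.mul (continuous_potential hk)))).continuousOn.div
        ((continuous_ck κ).pow 2).continuousOn fun t ht => pow_ne_zero 2 (hc t ht)
  rw [h1, intervalIntegral.integral_const_mul,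
    intervalIntegral.integral_eq_sub_of_hasDerivAt (f := fun t => potential n κ m t / ck κ t)
      (fun t ht => ?_) hcont.intervalIntegrable]
  rw [uIcc_of_le hxy] at ht
  have hct := hc t ht
  refine ((hasDerivAt_potential hk t).fun_div (hasDerivAt_ck κ t) hct).congr_deriv ?_
  field_simp
  ring

lemma ck_pos_of_ne_one (hκ : κ ≠ 1) (r : ℝ) : 0 < ck κ r := by
  rcases κ with _ | _ | _
  · exact one_pos
  · exact Real.cosh_pos r
  · exact absurd rfl hκ

lemma Fv_eq_of_ne_one (hκ : κ ≠ 1) (hn : 2 ≤ n) (hm : Continuous m)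
    (hk : Continuous (profileK n κ m)) (hv : ∀ t ∈ radii κ, v t = a * m t) (hr : r ∈ radii κ) :
    Fv n κ v r = a * potential n κ m r := by
  have hc := (ck_pos_of_ne_one hκ r).ne'
  have h1 : Fv n κ v r = ck κ r * ∫ s in (0 : ℝ)..r, quotv n κ v s := by
    rcases κ with _ | _ | _
    · rfl
    · rfl
    · exact absurd rfl hκ
  rw [h1, integral_quotv hn hm hk hv hr.1.le (fun t _ => (ck_pos_of_ne_one hκ t).ne')
    fun t ht => Or.inl (Ioc_subset_radii hr ht), potential_zero]
  field_simp
  ring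

lemma Gv_eq_of_le (hn : 2 ≤ n) (hm : Continuous m) (hk : Continuous (profileK n 1 m))
    (hv : ∀ t ∈ radii 1, v t = a * m t) (hr : 0 < r) (hr' : r ≤ Real.pi / 2) :
    Gv n v r = a * potential n 1 m r := by
  have hpi := Real.pi_pos
  rcases hr'.lt_or_eq with h | rfl
  · have hc : ∀ t ∈ Icc 0 r, 0 < ck 1 t := fun t ht =>
      Real.cos_pos_of_mem_Ioo ⟨by linarith [ht.1], ht.2.trans_lt h⟩
    have hc' := (hc r ⟨hr.le, le_rfl⟩).ne'
    rw [Gv, if_pos h, integral_quotv hn hm hk hv hr.le (fun t ht => (hc t ht).ne')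
      fun t ht => Or.inl ⟨ht.1, fun _ => by linarith [ht.2]⟩, potential_zero]
    change ck 1 r * _ = _
    field_simp
    ring
  · have h2 := integral_fv hn hm hk hv (r := Real.pi / 2) ⟨hr, fun _ => by linarith⟩
    rw [Gv, if_neg (lt_irrefl _), if_pos rfl]
    refine h2.trans ?_
    rw [show sk 1 (Real.pi / 2) = 1 from Real.sin_pi_div_two,
      show ck 1 (Real.pi / 2) = 0 from Real.cos_pi_div_two, SignType.coe_one]
    ring

lemma Gv_eq_of_lt (hn : 2 ≤ n) (hm : Continuous m) (hk : Continuous (profileK n 1 m))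
    (hv : ∀ t ∈ radii 1, v t = a * m t) (hr : Real.pi / 2 < r) (hr' : r < Real.pi) :
    Gv n v r = a * (potential n 1 m r + potential n 1 m Real.pi * Real.cos r) := by
  have hpi := Real.pi_pos
  have hc : ∀ t ∈ Icc r Real.pi, ck 1 t < 0 := fun t ht =>
    Real.cos_neg_of_pi_div_two_lt_of_lt (hr.trans_le ht.1) (by linarith [ht.2])
  have hc' := (hc r ⟨le_rfl, hr'.le⟩).ne
  rw [Gv, if_neg hr.not_gt, if_neg hr.ne', integral_quotv hn hm hk hv hr'.le
    (fun t ht => (hc t ht).ne) fun t ht => ?_, show ck 1 Real.pi = -1 from Real.cos_pi]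
  · change -(ck 1 r * _) = a * (_ + _ * ck 1 r)
    field_simp
    ring
  · rcases ht.2.lt_or_eq with h | h
    · exact Or.inl ⟨by linarith [ht.1], fun _ => h⟩
    · exact Or.inr (by rw [h]; exact Real.sin_pi)

lemma cv_eq (hn : 2 ≤ n) (hm : Continuous m) (hk : Continuous (profileK n 1 m))
    (hv : ∀ t ∈ radii 1, v t = a * m t) : cv n v = a * potential n 1 m Real.pi := by
  have hpi := Real.pi_pos
  set P := potential n 1 m Real.pi with hP
  obtain ⟨p, rfl⟩ := Nat.exists_eq_add_of_le' hn
  set X : ℝ → ℝ := fun s => a * (((p + 2 : ℕ) : ℝ) * Real.sin s ^ (p + 1) * Real.cos s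
    * profileB (p + 2) 1 m s + Real.sin s ^ (p + 2) * (profileK (p + 2) 1 m s / 2)) with hX
  set Y : ℝ → ℝ := fun s => -(a * P) * (((p + 2 : ℕ) : ℝ) * Real.sin s ^ (p + 1) * Real.cos s)
    with hY
  have hXc : Continuous X := by
    have := continuous_profileB hk
    fun_prop
  have hYc : Continuous Y := by fun_prop
  have hX' : ∀ s ∈ radii 1, ∀ G : ℝ, Real.sin s ^ (p + 1) * fv v s
      - ((p + 2 : ℕ) : ℝ) * Real.sin s ^ (p + 1) * (a * (potential (p + 2) 1 m s + G))
      = X s - a * (((p + 2 : ℕ) : ℝ) * Real.sin s ^ (p + 1) * G) := fun s hs G => by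
    rw [fv_eq hv hs, ← potential_ode hm hk hs, SignType.coe_one,
      show sk 1 s = Real.sin s from rfl, show ck 1 s = Real.cos s from rfl]
    simp only [hX]
    ring
  have h1ae : ∀ᵐ t, t ∈ Set.uIoc 0 (Real.pi / 2) → Real.sin t ^ (p + 2 - 1) * fv v t
      - ((p + 2 : ℕ) : ℝ) * Real.sin t ^ (p + 2 - 1) * Gv (p + 2) v t = X t := by
    refine Eventually.of_forall fun t ht => ?_
    rw [uIoc_of_le (by positivity)] at ht
    rw [Gv_eq_of_le hn hm hk hv ht.1 ht.2, show p + 2 - 1 = p + 1 by omega]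
    have := hX' t ⟨ht.1, fun _ => by linarith [ht.2]⟩ 0
    rw [add_zero] at this
    rw [this]
    ring
  have h2ae : ∀ᵐ t, t ∈ Set.uIoc (Real.pi / 2) Real.pi → Real.sin t ^ (p + 2 - 1) * fv v t
      - ((p + 2 : ℕ) : ℝ) * Real.sin t ^ (p + 2 - 1) * Gv (p + 2) v t = X t + Y t := by
    refine Eventually.of_forall fun t ht => ?_
    rw [uIoc_of_le (by linarith)] at ht
    rw [show p + 2 - 1 = p + 1 by omega]
    rcases ht.2.lt_or_eq with h | rfl
    · rw [Gv_eq_of_lt hn hm hk hv ht.1 h, hX' t ⟨by linarith [ht.1], fun _ => h⟩]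
      simp only [hY, hP]
      ring
    · simp [hX, hY]
  have h1i : IntervalIntegrable (fun s => Real.sin s ^ (p + 2 - 1) * fv v s
      - ((p + 2 : ℕ) : ℝ) * Real.sin s ^ (p + 2 - 1) * Gv (p + 2) v s) volume 0 (Real.pi / 2) :=
    (hXc.intervalIntegrable _ _).congr_ae ((ae_restrict_iff' measurableSet_uIoc).2
      (h1ae.mono fun t h ht => (h ht).symm))
  have h2i : IntervalIntegrable (fun s => Real.sin s ^ (p + 2 - 1) * fv v s
      - ((p + 2 : ℕ) : ℝ) * Real.sin s ^ (p + 2 - 1) * Gv (p + 2) v s) volume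
        (Real.pi / 2) Real.pi :=
    ((hXc.add hYc).intervalIntegrable _ _).congr_ae ((ae_restrict_iff' measurableSet_uIoc).2
      (h2ae.mono fun t h ht => (h ht).symm))
  have hsin : ∀ t, HasDerivAt (fun t => Real.sin t ^ (p + 2))
      (((p + 2 : ℕ) : ℝ) * Real.sin t ^ (p + 1) * Real.cos t) t := fun t =>
    (Real.hasDerivAt_sin t).fun_pow (p + 2)
  have hXint : ∀ x y, ∫ t in x..y, X t = a * (Real.sin y ^ (p + 2) * profileB (p + 2) 1 m y)
      - a * (Real.sin x ^ (p + 2) * profileB (p + 2) 1 m x) := fun x y =>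
    intervalIntegral.integral_eq_sub_of_hasDerivAt
      (f := fun t => a * (Real.sin t ^ (p + 2) * profileB (p + 2) 1 m t))
      (fun t _ => ((hsin t).fun_mul (hasDerivAt_profileB hk t)).const_mul a)
      (hXc.intervalIntegrable _ _)
  have hYint : ∫ t in (Real.pi / 2)..Real.pi, Y t = a * P := by
    rw [intervalIntegral.integral_eq_sub_of_hasDerivAt
      (f := fun t => -(a * P) * Real.sin t ^ (p + 2)) (fun t _ => (hsin t).const_mul _)
      (hYc.intervalIntegrable _ _)]
    simp
  rw [cv, ← intervalIntegral.integral_add_adjacent_intervals h1i h2i,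
    intervalIntegral.integral_congr_ae h1ae, intervalIntegral.integral_congr_ae h2ae,
    intervalIntegral.integral_add (hXc.intervalIntegrable _ _) (hYc.intervalIntegrable _ _),
    hYint, hXint, hXint]
  simp

lemma Fv_eq_sphere (hn : 2 ≤ n) (hm : Continuous m) (hk : Continuous (profileK n 1 m))
    (hv : ∀ t ∈ radii 1, v t = a * m t) (hr : r ∈ radii 1) :
    Fv n 1 v r = a * (potential n 1 m r + potential n 1 m Real.pi * Real.cos r) := by
  have h1 : Fv n 1 v r = if r < Real.pi / 2 then Gv n v r + cv n v * Real.cos r else Gv n v r := rfl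
  rw [h1]
  split_ifs with h
  · rw [Gv_eq_of_le hn hm hk hv hr.1 h.le, cv_eq hn hm hk hv]
    ring
  · rcases (not_lt.1 h).lt_or_eq with h | rfl
    · exact Gv_eq_of_lt hn hm hk hv h (hr.2 rfl)
    · rw [Gv_eq_of_le hn hm hk hv hr.1 le_rfl, Real.cos_pi_div_two]
      ring

/-- The derivative of `F_v` is a radial solution: the functions `s_κ (B + C)` differ by the
conformal Killing field with potential `c_κ`. -/
lemma exists_deriv_Fv (hn : 2 ≤ n) (hm : Continuous m) (hk : Continuous (profileK n κ m))
    (hv : ∀ t ∈ radii κ, v t = a * m t) :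
    ∃ C, ∀ r ∈ radii κ, deriv (Fv n κ v) r = a * (sk κ r * (profileB n κ m r + C)) := by
  by_cases hκ : κ = 1
  · subst hκ
    refine ⟨-potential n 1 m Real.pi, fun r hr => ?_⟩
    have h1 : HasDerivAt (fun r => a * (potential n 1 m r + potential n 1 m Real.pi * Real.cos r))
        _ r := ((hasDerivAt_potential hk r).fun_add ((Real.hasDerivAt_cos r).const_mul _)).const_mul a
    rw [(h1.congr_of_eventuallyEq (eventually_of_mem ((isOpen_radii 1).mem_nhds hr)
      fun r hr => Fv_eq_sphere hn hm hk hv hr)).deriv, show sk 1 r = Real.sin r from rfl]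
    ring
  · refine ⟨0, fun r hr => ?_⟩
    rw [(((hasDerivAt_potential hk r).const_mul a).congr_of_eventuallyEq (eventually_of_mem
      ((isOpen_radii κ).mem_nhds hr) fun r hr => Fv_eq_of_ne_one hκ hn hm hk hv hr)).deriv, add_zero]

end ExplicitForm

namespace Admissible

variable {n : ℕ} {κ : SignType} {V ψ ρ τ φ : ℝ → ℝ}

lemma exists_form_deriv_Fv (h : Admissible n κ V ψ ρ τ φ)
    (hL : ∀ r ∈ radii κ, RadialLichnerowicz n κ V ψ ρ τ φ r) :
    ∃ W : Ambient n → (Ambient n →L[ℝ] ℝ), IsCkForm κ 2 W ∧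
      IsRadialForm κ (fun r => (n : ℝ) / ((n : ℝ) - 1) *
        deriv (Fv n κ (fun s => ((n : ℝ) - 1) / n * φ s ^ critExp n * deriv τ s)) r) W ∧
      SolvesWith κ V (radial n κ ψ) (radial n κ ρ) (radial n κ τ) (fun _ => 0)
        (radial n κ φ) W := by
  have hn3 := h.three_le_cast
  have hm := h.continuous_source
  have hm0 := fun ε (hε : ε ∈ chartLabels κ) => h.tendsto_source hε
  have hY := fun ε (hε : ε ∈ chartLabels κ) => h.moment_endPoint hL hε
  obtain ⟨C, hC⟩ := exists_deriv_Fv (by have := h.three_le; omega) hm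
    (continuous_profileK hm hm0 hY) (a := ((n : ℝ) - 1) / n)
    (v := fun s => ((n : ℝ) - 1) / n * φ s ^ critExp n * deriv τ s)
    (fun t ht => by rw [source_of_mem ht]; ring)
  refine ⟨_, isCkForm_radialForm hm hm0 hY C, isRadialForm_radialForm fun r hr => ?_,
    h.solvesWith_radialForm hL C⟩
  have h1 : (n : ℝ) - 1 ≠ 0 := by linarith
  have h2 : (n : ℝ) ≠ 0 := by linarith
  rw [hC r hr]
  field_simp

end Admissible

end ConformalConstraint

end

open ConformalConstraint in
theorem theorem1 (n : ℕ) (hn : 3 ≤ n) (κ : SignType) (V ψ ρ τ φ : ℝ → ℝ)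
    (hV : Continuous V)
    (hψ : IsCk κ 1 (radial n κ ψ)) (hρ : IsCk κ 0 (radial n κ ρ))
    (hτ : IsCk κ 1 (radial n κ τ)) (hφ : IsCk κ 3 (radial n κ φ))
    (hφpos : ∀ p ∈ spaceForm n κ, 0 < radial n κ φ p)
    (hρψ : ∀ r ∈ radii κ, ρ r * deriv ψ r = 0) :
    (IsSolution n κ V ψ ρ τ φ ↔ ∀ r ∈ radii κ, RadialLichnerowicz n κ V ψ ρ τ φ r) ∧
    (IsSolution n κ V ψ ρ τ φ → ∀ r ∈ radii κ, 0 ≤ Sfun n κ V ψ ρ φ r) ∧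
    ((∀ r ∈ radii κ, 0 < Sfun n κ V ψ ρ φ r) →
      (∀ᵐ r ∂(volume.restrict (radii κ)), deriv (weight n κ φ) r ≠ 0) →
      (IsSolution n κ V ψ ρ τ φ ↔
        (∀ r ∈ radii κ, τ r = explicitTau n κ V ψ ρ φ r) ∨
        (∀ r ∈ radii κ, τ r = -explicitTau n κ V ψ ρ φ r))) ∧
    (IsSolution n κ V ψ ρ τ φ →
      ∃ W : Ambient n → (Ambient n →L[ℝ] ℝ), IsCkForm κ 2 W ∧
        IsRadialForm κ
          (fun r => (n : ℝ) / ((n : ℝ) - 1) *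
            deriv (Fv n κ (fun s => ((n : ℝ) - 1) / n * φ s ^ critExp n * deriv τ s)) r) W ∧
        SolvesWith κ V (radial n κ ψ) (radial n κ ρ) (radial n κ τ) (fun _ => 0)
          (radial n κ φ) W) := by
  have h : Admissible n κ V ψ ρ τ φ := ⟨hn, hV, hψ, hρ, hτ, hφ, hφpos, hρψ⟩
  refine ⟨h.isSolution_iff, fun hL r hr => h.Sfun_nonneg (h.isSolution_iff.1 hL) hr,
    fun hS _ => ⟨fun hL => h.eq_explicitTau_or (h.isSolution_iff.1 hL) hS, fun hτ' =>
      h.isSolution_iff.2 (h.radialLichnerowicz_of_explicitTau hS hτ')⟩,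
    fun hL => h.exists_form_deriv_Fv (h.isSolution_iff.1 hL)⟩
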